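/- Let $T>0$ and $\frac23<H<1$, and let $B=\{B_t\}_{t\ge 0}$ be a (jointly measurable) fractional Brownian motion of Hurst parameter $H$ on a probability space $(\Omega,\mathcal F,\mathbb P)$, that is, a centered Gaussian process with $\mathbb E[B_tB_s]=\frac12\left(t^{2H}+s^{2H}-|t-s|^{2H}\right)$. For $\varepsilon>0$ put $p_\varepsilon(x)=(2\pi\varepsilon)^{-1/2}e^{-x^2/(2\varepsilon)}$ and $$\alpha_\varepsilon=\int_0^T\int_0^t p'_\varepsilon(B_t-B_s)\,ds\,dt .$$ Then, as $\varepsilon\to0^+$, $$\varepsilon^{\frac32-\frac1H}\alpha_\varepsilon\ \xrightarrow{\ \mathrm{Law}\ }\ \mathcal N(0,\sigma^2),\qquad \sigma^2=\frac{T^{2H}(2H-1)}{4H\pi}\,\mathrm{B}\!\left(\tfrac1H,\tfrac{3H-2}{2H}\right)^2\mathrm{B}(2,2H-1),$$ where $\mathrm B(\cdot,\cdot)$ is the Beta function and $\mathcal N(0,\sigma^2)$ the centered normal law of variance $\sigma^2$. Moreover, for $q\ge0$ let $\mathcal H_q$ be the $q$-th Wiener chaos of $B$, the closed linear span in $L^2(\Omega,\mathcal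 F,\mathbb P)$ of the variables $H_q(X)$, where $H_q(x)=(-1)^qe^{x^2/2}\frac{d^q}{dx^q}e^{-x^2/2}$ is the $q$-th Hermite polynomial and $X$ runs over the elements of unit norm of the closed linear span of $\{B_t\}_{t\ge0}$ in $L^2(\Omega,\mathcal F,\mathbb P)$, and let $J_q$ be the orthogonal projection of $L^2(\Omega,\mathcal F,\mathbb P)$ onto $\mathcal H_q$. Then for every $\varepsilon>0$ we have $\alpha_\varepsilon\in L^2(\Omega,\mathcal F,\mathbb P)$, the component $J_1[\alpha_\varepsilon]$ is centered Gaussian, and $\alpha_\varepsilon-J_1[\alpha_\varepsilon]=\sum_{q\ge2}J_q[\alpha_\varepsilon]$ with convergence in $L^2$; and, as $\varepsilon\to0^+$, $$\varepsilon^{\frac32-\frac1H}J_1[\alpha_\varepsilon]\ \xrightarrow{\ \mathrm{Law}\ }\ \mathcal N(0,\sigma^2),\qquad \varepsilon^{\frac32-\frac1H}\sum_{q\ge2}J_q[\alpha_\varepsilon]\ \to\ 0\quad\text{in }L^2(\Omega,\mathcal F,\mathbb P).$$ -/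

import Mathlib

open MeasureTheory ProbabilityTheory Filter Topology
open scoped NNReal ENNReal

noncomputable section

namespace SelfIntersection

/-- `B` is a fractional Brownian motion with Hurst parameter `H` under `P`: a centered Gaussian
process with covariance `(t ^ (2H) + s ^ (2H) - |t - s| ^ (2H)) / 2`. As pathwise time integrals of
`B` are taken, `B` is jointly measurable in time and outcome, up to a null set of `dt ⊗ P` on
`[0, ∞) × Ω`; this
holds in particular for a version with almost surely continuous paths. -/
structure IsFractionalBrownianMotion {Ω : Type*} [MeasurableSpace Ω] (H : ℝ)
    (B : ℝ≥0 → Ω → ℝ) (P : Measure Ω) : Prop where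
  isGaussianProcess : IsGaussianProcess B P
  centered : ∀ t, ∫ ω, B t ω ∂P = 0
  covariance : ∀ s t : ℝ≥0, ∫ ω, B t ω * B s ω ∂P =
    1 / 2 * ((t : ℝ) ^ (2 * H) + (s : ℝ) ^ (2 * H) - |(t : ℝ) - (s : ℝ)| ^ (2 * H))
  aemeasurable : AEMeasurable (fun x : ℝ × Ω => B x.1.toNNReal x.2)
    ((volume.restrict (Set.Ici (0 : ℝ))).prod P)

/-- The heat kernel `p_ε(x) = (2πε)^(-1/2) exp(-x² / (2ε))`. -/
def heatKernel (ε x : ℝ) : ℝ := (√(2 * Real.pi * ε))⁻¹ * Real.exp (-x ^ 2 / (2 * ε))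

/-- The random variable `α_ε = ∫_0^T ∫_0^t p_ε'(B_t - B_s) ds dt`. -/
def alpha {Ω : Type*} (B : ℝ≥0 → Ω → ℝ) (T ε : ℝ) (ω : Ω) : ℝ :=
  ∫ t in (0 : ℝ)..T, ∫ s in (0 : ℝ)..t,
    deriv (heatKernel ε) (B t.toNNReal ω - B s.toNNReal ω)

/-- The Gaussian space of `B`: the closed linear span of the variables `B_t` in `L²(P)`, that is
`{B(h) : h ∈ 𝔥}` where `𝔥` is the Hilbert space of `B` and `h ↦ B(h)` its isometry to `L²(P)`. -/
def gaussianSpace {Ω : Type*} [MeasurableSpace Ω] (B : ℝ≥0 → Ω → ℝ) (P : Measure Ω) :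
    Submodule ℝ (Lp ℝ 2 P) :=
  (Submodule.span ℝ {Y : Lp ℝ 2 P | ∃ t, Y =ᵐ[P] B t}).topologicalClosure

/-- The `q`-th Wiener chaos of `B`: the closed linear span in `L²(P)` of the variables `H_q(X)`,
with `X` in the Gaussian space of unit norm and `H_q` the `q`-th probabilists' Hermite
polynomial. -/
def wienerChaos {Ω : Type*} [MeasurableSpace Ω] (B : ℝ≥0 → Ω → ℝ) (P : Measure Ω) (q : ℕ) :
    Submodule ℝ (Lp ℝ 2 P) :=
  (Submodule.span ℝ {Y : Lp ℝ 2 P | ∃ X ∈ gaussianSpace B P, ‖X‖ = 1 ∧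
    Y =ᵐ[P] fun ω => Polynomial.aeval (X ω) (Polynomial.hermite q)}).topologicalClosure

instance {Ω : Type*} [MeasurableSpace Ω] (B : ℝ≥0 → Ω → ℝ) (P : Measure Ω) (q : ℕ) :
    CompleteSpace (wienerChaos B P q) :=
  (Submodule.isClosed_topologicalClosure _).completeSpace_coe

/-- `J_q`, the orthogonal projection of `L²(P)` onto the `q`-th Wiener chaos of `B`. -/
def chaosProj {Ω : Type*} [MeasurableSpace Ω] (B : ℝ≥0 → Ω → ℝ) (P : Measure Ω) (q : ℕ) :
    Lp ℝ 2 P →L[ℝ] Lp ℝ 2 P :=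
  (wienerChaos B P q).starProjection

/-- The limiting variance
`σ² = T^(2H) (2H-1) / (4Hπ) * B(1/H, (3H-2)/(2H))² * B(2, 2H-1)`, with the Beta function `B`. -/
def limitVariance (H T : ℝ) : ℝ :=
  T ^ (2 * H) * (2 * H - 1) / (4 * H * Real.pi) *
    beta (1 / H) ((3 * H - 2) / (2 * H)) ^ 2 * beta 2 (2 * H - 1)

end SelfIntersection

end

/-! The renormalized first chaos already converges in `L²`, to a multiple of `B_T`, and everything
else is negligible; the limit is therefore Gaussian without any central limit argument.

First chaos. For `X` in the Gaussian space, `J_1[p_ε'(X)] = -(2π)^(-1/2) (ε + ‖X‖²)^(-3/2) X`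
(`chaosProj_one_kernelLp`). Hence `J_1[α_ε]` is the integral over `0 < u < T` of `-(2π)^(-1/2) (ε +
u^(2H))^(-3/2)` times `∫_0^(T-u) (B_(s+u) - B_s) ds`. The inner integral telescopes to `∫_(T-u)^T B
- ∫_0^u B`, which is close to `u B_T` for small `u`. Substituting `u = ε^(1/(2H)) x` and using
dominated convergence gives the limit `-(2π)^(-1/2) (∫_0^∞ x (1 + x^(2H))^(-3/2) dx) B_T`
(`tendsto_smul_integral_endIncrement`). The integral converges exactly when `H > 2/3`, and it is a
Beta value.

Higher chaoses. With `μ` the covariance of two increments and `v₁`, `v₂` their variances, the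
components of order at least two have covariance `(2π)⁻¹ μ [((ε+v₁)(ε+v₂) - μ²)^(-3/2) -
((ε+v₁)(ε+v₂))^(-3/2)]`. Its double integral over pairs of increments is bounded in two regimes
(`exists_remainder_le`). If the endpoints are close relative to the lengths, a quantitative form of
nondegeneracy bounds the determinant from below. Otherwise the correlation is at most `(1+H)/2 < 1`,
the bracket is of second order in it, and the decay of `μ` in the distance makes the bound
integrable. Both contributions gain a positive power of `ε` over the normalization.

The chaos expansion rests on the orthogonality of Hermite polynomials (Mehler's formula) and on the
fact that `p_ε'(X)` is orthogonal to whatever is orthogonal to every `H_n(X/‖X‖)`, seen through the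
Fourier representation of `p_ε'`. -/

noncomputable section

set_option linter.unusedSectionVars false

namespace SelfIntersection

/-! ### Covariance of two increments: nondegeneracy and decay -/

section

/-- The covariance of the increments of a fractional Brownian motion over `[s, t]` and
`[s', t']`. -/
def incCov (H t s t' s' : ℝ) : ℝ :=
  (|t - s'| ^ (2 * H) + |t' - s| ^ (2 * H) - |s - s'| ^ (2 * H) - |t - t'| ^ (2 * H)) / 2

lemma incCov_comm (H t s t' s' : ℝ) : incCov H t s t' s' = incCov H t' s' t s := by
  unfold incCov
  rw [abs_sub_comm s s', abs_sub_comm t t']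
  ring

lemma abs_rpow_two_mul (H x : ℝ) : |x| ^ (2 * H) = (x ^ 2) ^ H := by
  rw [Real.rpow_mul (abs_nonneg x), Real.rpow_two, sq_abs]

/-- Concavity: the graph of a power lies below its tangent at `x`. This is Bernoulli's inequality at
`y / x - 1`. -/
lemma rpow_le_tangent {H x y : ℝ} (hH : 0 ≤ H) (hH' : H ≤ 1) (hx : 0 < x) (hy : 0 ≤ y) :
    y ^ H ≤ x ^ H + H * x ^ (H - 1) * (y - x) := by
  have h := rpow_one_add_le_one_add_mul_self (s := y / x - 1) (p := H)
    (by have := div_nonneg hy hx.le; linarith) hH hH'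
  rw [add_sub_cancel, Real.div_rpow hy hx.le, div_le_iff₀ (Real.rpow_pos_of_pos hx H)] at h
  rw [Real.rpow_sub_one hx.ne']
  calc y ^ H ≤ _ := h
    _ = _ := by field_simp

lemma mul_rpow_sub_one_le {H x y : ℝ} (hH' : H ≤ 1) (hx : 0 ≤ x) (hxy : x ≤ y) :
    x * y ^ (H - 1) ≤ x ^ H := by
  rcases hx.eq_or_lt with rfl | hx
  · simpa using Real.rpow_nonneg le_rfl H
  calc x * y ^ (H - 1) ≤ x * x ^ (H - 1) :=
        mul_le_mul_of_nonneg_left (Real.rpow_le_rpow_of_nonpos hx hxy (by linarith)) hx.le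
    _ = x ^ H := by rw [Real.rpow_sub_one hx.ne']; field_simp

/-- In the application `M`, `m` are the squares of `t - s'`, `t' - s`, while `A`, `B` are those of
`t - t'`, `s - s'`, and `X` is the product of the lengths. Each difference of powers is replaced by
a tangent bound, with the slopes chosen equal so that `hsum` can be used: the slope at `X` when `B ≤
m`, the slope at `A` when `m < B`. -/
lemma rpow_add_rpow_sub_le {H A B M m X : ℝ} (hH : 0 < H) (hH' : H < 1) (hX : 0 < X)
    (hXA : X ≤ A) (hBA : B ≤ A) (hB : 0 ≤ B) (hm : 0 ≤ m) (hAM : A ≤ M)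
    (hsum : M + m = A + B + 2 * X) :
    M ^ H + m ^ H - A ^ H - B ^ H ≤ (1 + H) * X ^ H := by
  have hA : 0 < A := hX.trans_le hXA
  have h1 := rpow_le_tangent hH.le hH'.le hA (hA.le.trans hAM)
  have h2 : A ^ (H - 1) ≤ X ^ (H - 1) := Real.rpow_le_rpow_of_nonpos hX hXA (by linarith)
  have hXX : X ^ (H - 1) * X = X ^ H := by rw [Real.rpow_sub_one hX.ne']; field_simp
  have hA1 : 0 ≤ A ^ (H - 1) := Real.rpow_nonneg hA.le _
  rcases le_or_gt B m with hBm | hBm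
  · have h3 : m ^ H ≤ (m - B) ^ H + B ^ H := by
      have := Real.rpow_add_le_add_rpow (sub_nonneg.2 hBm) hB hH.le hH'.le
      simpa using this
    have h4 := rpow_le_tangent hH.le hH'.le hX (sub_nonneg.2 hBm)
    have h5 : H * A ^ (H - 1) * (M - A) ≤ H * X ^ (H - 1) * (M - A) := by
      gcongr
    have : H * X ^ (H - 1) * (M - A) + H * X ^ (H - 1) * (m - B - X) = H * X ^ H := by
      rw [← hXX]
      linear_combination H * X ^ (H - 1) * hsum
    linarith
  · have hB' : 0 < B := hm.trans_lt hBm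
    have h3 := rpow_le_tangent hH.le hH'.le hB' hm
    have h4 : A ^ (H - 1) ≤ B ^ (H - 1) := Real.rpow_le_rpow_of_nonpos hB' hBA (by linarith)
    have h5 : H * B ^ (H - 1) * (m - B) ≤ H * A ^ (H - 1) * (m - B) :=
      mul_le_mul_of_nonpos_right (by gcongr) (by linarith)
    have h6 : H * A ^ (H - 1) * (M - A) + H * A ^ (H - 1) * (m - B) = 2 * H * (A ^ (H - 1) * X) := by
      linear_combination H * A ^ (H - 1) * hsum
    have h7 : A ^ (H - 1) * X ≤ X ^ H := by
      rw [← hXX]; gcongr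
    have h8 : 2 * H * (A ^ (H - 1) * X) ≤ (1 + H) * X ^ H := by
      have : 0 ≤ X ^ H := Real.rpow_nonneg hX.le _
      have : 0 ≤ A ^ (H - 1) * X := by positivity
      nlinarith
    linarith

/-- Quantitative nondegeneracy of two increments whose endpoints are close. -/
lemma incCov_le_of_close {H t s t' s' : ℝ} (hH : 0 < H) (hH' : H < 1) (h : s < t) (h' : s' < t')
    (hs : (s - s') ^ 2 ≤ (t - s) * (t' - s')) (ht : (t - t') ^ 2 ≤ (t - s) * (t' - s')) :
    incCov H t s t' s' ≤ ((t - s) * (t' - s')) ^ H -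
      (1 - H) / 2 * (|s - s'| ^ (2 * H) + |t - t'| ^ (2 * H)) := by
  have hX : 0 < (t - s) * (t' - s') := mul_pos (sub_pos.2 h) (sub_pos.2 h')
  simp only [incCov, abs_rpow_two_mul]
  -- Both crossing terms are linearized at `X`; by the parallelogram-type identity in `h5` the
  -- linear parts involve only `(s - s')²` and `(t - t')²`. Closeness bounds them by `H` times the
  -- powers that the covariance subtracts, so a fraction `1 - H` of these survives.
  have h1 := rpow_le_tangent hH.le hH'.le hX (sq_nonneg (t - s'))
  have h2 := rpow_le_tangent hH.le hH'.le hX (sq_nonneg (t' - s))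
  have h3 := mul_rpow_sub_one_le hH'.le (sq_nonneg _) hs
  have h4 := mul_rpow_sub_one_le hH'.le (sq_nonneg _) ht
  set X := (t - s) * (t' - s') with hXdef
  have h5 : H * X ^ (H - 1) * ((t - s') ^ 2 - X) + H * X ^ (H - 1) * ((t' - s) ^ 2 - X)
      = H * ((s - s') ^ 2 * X ^ (H - 1)) + H * ((t - t') ^ 2 * X ^ (H - 1)) := by
    have : (t - s') ^ 2 + (t' - s) ^ 2 = (s - s') ^ 2 + (t - t') ^ 2 + 2 * X := by
      rw [hXdef]; ring
    linear_combination H * X ^ (H - 1) * this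
  have h6 := mul_le_mul_of_nonneg_left h3 hH.le
  have h7 := mul_le_mul_of_nonneg_left h4 hH.le
  linarith

/-- The variances have geometric mean `((t - s) * (t' - s')) ^ H`, so the correlation stays away
from `1` as soon as the pair is not close. One of the two crossing distances dominates both `|s -
s'|` and `|t - t'|`; it takes the role of `M` in `rpow_add_rpow_sub_le`. -/
lemma incCov_le_of_far {H t s t' s' : ℝ} (hH : 0 < H) (hH' : H < 1) (h : s < t) (h' : s' < t')
    (hst : (t - s) * (t' - s') < (s - s') ^ 2 ∨ (t - s) * (t' - s') < (t - t') ^ 2) :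
    incCov H t s t' s' ≤ (1 + H) / 2 * ((t - s) * (t' - s')) ^ H := by
  have hX : 0 < (t - s) * (t' - s') := mul_pos (sub_pos.2 h) (sub_pos.2 h')
  simp only [incCov, abs_rpow_two_mul]
  have hsum : (t - s') ^ 2 + (t' - s) ^ 2 =
      (s - s') ^ 2 + (t - t') ^ 2 + 2 * ((t - s) * (t' - s')) := by ring
  have key : ∀ M m : ℝ, 0 ≤ m → (s - s') ^ 2 ≤ M → (t - t') ^ 2 ≤ M →
      M + m = (s - s') ^ 2 + (t - t') ^ 2 + 2 * ((t - s) * (t' - s')) →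
      M ^ H + m ^ H - ((s - s') ^ 2) ^ H - ((t - t') ^ 2) ^ H ≤
        (1 + H) * ((t - s) * (t' - s')) ^ H := by
    intro M m hm hM1 hM2 hs
    rcases le_total ((s - s') ^ 2) ((t - t') ^ 2) with hab | hab
    · have := rpow_add_rpow_sub_le hH hH' hX (A := (t - t') ^ 2) (B := (s - s') ^ 2)
        (by rcases hst with h | h <;> linarith) hab (sq_nonneg _) hm hM2 (by linarith)
      linarith
    · have := rpow_add_rpow_sub_le hH hH' hX (A := (s - s') ^ 2) (B := (t - t') ^ 2)
        (by rcases hst with h | h <;> linarith) hab (sq_nonneg _) hm hM1 (by linarith)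
      linarith
  have hmax : ((s - s') ^ 2 ≤ (t - s') ^ 2 ∧ (t - t') ^ 2 ≤ (t - s') ^ 2) ∨
      ((s - s') ^ 2 ≤ (t' - s) ^ 2 ∧ (t - t') ^ 2 ≤ (t' - s) ^ 2) := by
    rcases le_total s s' with h1 | h1 <;> rcases le_total t t' with h2 | h2 <;>
      rcases le_total (t - s') (t' - s) with h3 | h3
    all_goals
      first
      | exact .inl ⟨sq_le_sq' (by linarith) (by linarith), sq_le_sq' (by linarith) (by linarith)⟩
      | exact .inr ⟨sq_le_sq' (by linarith) (by linarith), sq_le_sq' (by linarith) (by linarith)⟩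
  rcases hmax with ⟨h1, h2⟩ | ⟨h1, h2⟩
  · have := key _ _ (sq_nonneg (t' - s)) h1 h2 hsum
    linarith
  · have := key _ _ (sq_nonneg (t - s')) h1 h2 (by linarith)
    linarith

/-- The expression is the increment over a step `u` of the derivative of `|·| ^ p`, which is odd and
increasing; the two cases separate whether the step crosses the origin. -/
lemma abs_rpow_deriv_sub_bounds {p z u : ℝ} (hp : 1 < p) (hp' : p < 2) (hz : 0 < z)
    (hu : 0 < u) :
    0 ≤ p * |z| ^ (p - 2) * z - p * |z - u| ^ (p - 2) * (z - u) ∧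
      p * |z| ^ (p - 2) * z - p * |z - u| ^ (p - 2) * (z - u) ≤ 2 * p * u * z ^ (p - 2) := by
  have hpos : ∀ y : ℝ, 0 ≤ y → |y| ^ (p - 2) * y = y ^ (p - 1) := by
    intro y hy
    rcases hy.eq_or_lt with rfl | hy
    · rw [Real.zero_rpow (by linarith)]; simp
    · rw [abs_of_pos hy, ← Real.rpow_add_one hy.ne']; congr 1; ring
  have hzz : z ^ (p - 1) = z ^ (p - 2) * z := by
    rw [← Real.rpow_add_one hz.ne']; congr 1; ring
  have e1 : p * |z| ^ (p - 2) * z = p * z ^ (p - 1) := by rw [mul_assoc, hpos z hz.le]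
  rw [e1, mul_assoc p]
  have hz2 : 0 ≤ z ^ (p - 2) := Real.rpow_nonneg hz.le _
  rcases le_or_gt u z with huz | huz
  · rw [hpos _ (sub_nonneg.2 huz)]
    have hm : (z - u) ^ (p - 1) ≤ z ^ (p - 1) :=
      Real.rpow_le_rpow (sub_nonneg.2 huz) (by linarith) (by linarith)
    have hl : z ^ (p - 2) * (z - u) ≤ (z - u) ^ (p - 1) := by
      have := mul_rpow_sub_one_le (H := p - 1) (by linarith) (sub_nonneg.2 huz)
        (by linarith : z - u ≤ z)
      rw [show p - 1 - 1 = p - 2 by ring] at this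
      linarith
    constructor
    · nlinarith
    · have : p * z ^ (p - 1) - p * (z - u) ^ (p - 1) ≤ p * (z ^ (p - 2) * u) := by
        rw [hzz, ← mul_sub]; gcongr; nlinarith
      have : 0 ≤ p * (z ^ (p - 2) * u) := by positivity
      linarith
  · have e2 : |z - u| ^ (p - 2) * (z - u) = -(u - z) ^ (p - 1) := by
      have := hpos (u - z) (by linarith)
      rw [abs_sub_comm, ← this]; ring
    rw [e2]
    have h0 : 0 ≤ (u - z) ^ (p - 1) := Real.rpow_nonneg (by linarith) _
    have h1 : 0 ≤ z ^ (p - 1) := Real.rpow_nonneg hz.le _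
    have h2 : (u - z) ^ (p - 1) ≤ u * z ^ (p - 2) := by
      calc (u - z) ^ (p - 1) ≤ u ^ (p - 1) :=
            Real.rpow_le_rpow (by linarith) (by linarith) (by linarith)
        _ = u * u ^ (p - 2) := by
            rw [mul_comm, ← Real.rpow_add_one hu.ne']; congr 1; ring
        _ ≤ u * z ^ (p - 2) := by
            gcongr 1
            exact Real.rpow_le_rpow_of_nonpos hz huz.le (by linarith)
    have h3 : z ^ (p - 1) ≤ u * z ^ (p - 2) := by rw [hzz, mul_comm]; gcongr
    have hp0 : 0 < p := by linarith
    constructor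
    · nlinarith [mul_nonneg hp0.le h0, mul_nonneg hp0.le h1]
    · nlinarith [mul_le_mul_of_nonneg_left h2 hp0.le, mul_le_mul_of_nonneg_left h3 hp0.le]

/-- Twice the covariance is the increment over `[0, t' - s']` of `φ`, itself a first difference of
`|·| ^ (2H)`, so the mean value inequality applies. The upper bound must exclude `s = s'`: there `0
^ (2H - 2)` takes the default value `0`. -/
lemma incCov_bounds_of_le {H t s t' s' : ℝ} (hH : 1 / 2 < H) (hH' : H < 1) (h : s < t)
    (h' : s' < t') (hs : s ≤ s') :
    0 ≤ incCov H t s t' s' ∧ (s ≠ s' →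
      incCov H t s t' s' ≤ 2 * H * ((t - s) * (t' - s') * |s - s'| ^ (2 * H - 2))) := by
  set a := s' - s with ha
  have ha0 : 0 ≤ a := sub_nonneg.2 hs
  set φ : ℝ → ℝ := fun y => |a + y| ^ (2 * H) - |a + y - (t - s)| ^ (2 * H) with hφ
  have hd : ∀ y, HasDerivAt φ (2 * H * |a + y| ^ (2 * H - 2) * (a + y) -
      2 * H * |a + y - (t - s)| ^ (2 * H - 2) * (a + y - (t - s))) y := by
    intro y
    have h1 := (hasDerivAt_abs_rpow (a + y) (by linarith : 1 < 2 * H)).comp y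
      ((hasDerivAt_id y).const_add a)
    have h2 := (hasDerivAt_abs_rpow (a + y - (t - s)) (by linarith : 1 < 2 * H)).comp y
      (((hasDerivAt_id y).const_add a).sub_const (t - s))
    simpa [Function.comp_def] using! h1.sub h2
  have hcont : ContinuousOn φ (Set.Ici 0) := fun y _ => (hd y).continuousAt.continuousWithinAt
  have hdiff : DifferentiableOn ℝ φ (interior (Set.Ici 0)) :=
    fun y _ => (hd y).differentiableAt.differentiableWithinAt
  have hval : 2 * incCov H t s t' s' = φ (t' - s') - φ 0 := by
    simp only [hφ, incCov, ha]
    rw [abs_sub_comm t s', abs_sub_comm s s', abs_sub_comm t t']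
    ring_nf
  constructor
  · have := (convex_Ici (0 : ℝ)).mul_sub_le_image_sub_of_le_deriv hcont hdiff (C := 0)
      (fun y hy => by
        rw [interior_Ici, Set.mem_Ioi] at hy
        rw [(hd y).deriv]
        exact (abs_rpow_deriv_sub_bounds (by linarith) (by linarith) (by linarith : 0 < a + y)
          (sub_pos.2 h)).1) 0 Set.self_mem_Ici (t' - s') (sub_pos.2 h').le (sub_pos.2 h').le
    linarith
  · intro hne
    have hapos : 0 < a := lt_of_le_of_ne ha0 (fun h => hne (by linarith))
    have := (convex_Ici (0 : ℝ)).image_sub_le_mul_sub_of_deriv_le hcont hdiff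
      (C := 2 * (2 * H) * (t - s) * a ^ (2 * H - 2))
      (fun y hy => by
        rw [interior_Ici, Set.mem_Ioi] at hy
        rw [(hd y).deriv]
        refine (abs_rpow_deriv_sub_bounds (by linarith) (by linarith) (by linarith : 0 < a + y)
          (sub_pos.2 h)).2.trans ?_
        have : (a + y) ^ (2 * H - 2) ≤ a ^ (2 * H - 2) :=
          Real.rpow_le_rpow_of_nonpos hapos (by linarith) (by linarith)
        have hts := sub_pos.2 h
        gcongr)
      0 Set.self_mem_Ici (t' - s') (sub_pos.2 h').le (sub_pos.2 h').le
    rw [abs_sub_comm s s', ← ha, abs_of_pos hapos]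
    linarith

lemma incCov_nonneg {H t s t' s' : ℝ} (hH : 1 / 2 < H) (hH' : H < 1) (h : s < t)
    (h' : s' < t') : 0 ≤ incCov H t s t' s' := by
  rcases le_total s s' with hs | hs
  · exact (incCov_bounds_of_le hH hH' h h' hs).1
  · rw [incCov_comm]; exact (incCov_bounds_of_le hH hH' h' h hs).1

lemma incCov_le_mul {H t s t' s' : ℝ} (hH : 1 / 2 < H) (hH' : H < 1) (h : s < t)
    (h' : s' < t') (hne : s ≠ s') :
    incCov H t s t' s' ≤ 2 * H * ((t - s) * (t' - s') * |s - s'| ^ (2 * H - 2)) := by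
  rcases le_total s s' with hs | hs
  · exact (incCov_bounds_of_le hH hH' h h' hs).2 hne
  · rw [incCov_comm, abs_sub_comm, mul_comm (t - s)]
    exact (incCov_bounds_of_le hH hH' h' h hs).2 hne.symm

end

/-! ### The Gaussian space and its joint laws -/

section

variable {Ω : Type*} [MeasurableSpace Ω] {P : Measure Ω} [IsProbabilityMeasure P]

lemma integral_norm_le_norm_Lp {E : Type*} [NormedAddCommGroup E] (X : Lp E 2 P) :
    ∫ ω, ‖X ω‖ ∂P ≤ ‖X‖ := by
  rw [Lp.norm_def, integral_norm_eq_lintegral_enorm (Lp.aestronglyMeasurable X),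
    ← eLpNorm_one_eq_lintegral_enorm]
  exact ENNReal.toReal_mono (Lp.eLpNorm_ne_top X)
    (eLpNorm_le_eLpNorm_of_exponent_le (by norm_num) (Lp.aestronglyMeasurable X))

lemma Lp_two_integrable {E : Type*} [NormedAddCommGroup E] (X : Lp E 2 P) : Integrable X P :=
  (Lp.memLp X).integrable (by norm_num)

lemma inner_eq_integral_mul (X Y : Lp ℝ 2 P) : inner ℝ X Y = ∫ ω, X ω * Y ω ∂P := by
  rw [L2.inner_def]
  exact integral_congr_ae (.of_forall fun ω => by simp [mul_comm])

lemma integrable_Lp_mul (X Y : Lp ℝ 2 P) : Integrable (fun ω => X ω * Y ω) P :=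
  (Lp.memLp X).integrable_mul (Lp.memLp Y)

/-- The characteristic function at `ξ` is `|ξ|`-Lipschitz for the `L²` distance, so being centered
Gaussian with variance `‖X‖²` is a closed condition. -/
lemma continuous_integral_cexp (ξ : ℝ) :
    Continuous fun X : Lp ℝ 2 P => ∫ ω, Complex.exp (ξ * X ω * Complex.I) ∂P := by
  refine LipschitzWith.continuous (K := ‖ξ‖₊) (LipschitzWith.of_dist_le_mul fun X Y => ?_)
  have hint : ∀ Z : Lp ℝ 2 P, Integrable (fun ω => Complex.exp (ξ * Z ω * Complex.I)) P := by
    intro Z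
    refine Integrable.of_bound (C := 1) ?_ (.of_forall fun ω => ?_)
    · have := (Lp.aestronglyMeasurable Z).aemeasurable
      exact AEMeasurable.aestronglyMeasurable (by fun_prop)
    · rw [← Complex.ofReal_mul, Complex.norm_exp_ofReal_mul_I]
  rw [dist_eq_norm, dist_eq_norm, ← integral_sub (hint X) (hint Y)]
  have hb : ∀ x y : ℝ, ‖Complex.exp (ξ * x * Complex.I) - Complex.exp (ξ * y * Complex.I)‖ ≤
      ‖ξ‖ * ‖x - y‖ := by
    intro x y
    have h1 : Complex.exp (ξ * x * Complex.I) - Complex.exp (ξ * y * Complex.I) =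
        Complex.exp ((ξ * y : ℝ) * Complex.I) *
          (Complex.exp (Complex.I * (ξ * (x - y) : ℝ)) - 1) := by
      rw [mul_sub, ← Complex.exp_add]
      push_cast
      ring_nf
    rw [h1, norm_mul, Complex.norm_exp_ofReal_mul_I, one_mul, ← norm_mul]
    exact Real.norm_exp_I_mul_ofReal_sub_one_le
  calc _ ≤ ∫ ω, ‖ξ‖ * ‖(X - Y) ω‖ ∂P := by
        refine norm_integral_le_of_norm_le ((Lp_two_integrable (X - Y)).norm.const_mul _) ?_
        filter_upwards [Lp.coeFn_sub X Y] with ω hω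
        rw [hω]
        exact hb _ _
    _ ≤ _ := by
        rw [integral_const_mul]
        exact mul_le_mul_of_nonneg_left (integral_norm_le_norm_Lp _) (norm_nonneg _)

lemma map_eq_gaussianReal_iff (X : Lp ℝ 2 P) (v : ℝ≥0) :
    P.map X = gaussianReal 0 v ↔
      ∀ ξ : ℝ, ∫ ω, Complex.exp (ξ * X ω * Complex.I) ∂P = Complex.exp (-(v * ξ ^ 2 / 2)) := by
  have hX := (Lp.aestronglyMeasurable X).aemeasurable
  have h : ∀ ξ : ℝ, charFun (P.map X) ξ = ∫ ω, Complex.exp (ξ * X ω * Complex.I) ∂P := by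
    intro ξ
    rw [charFun_apply_real, integral_map hX]
    fun_prop
  constructor
  · intro h' ξ
    rw [← h, h', charFun_gaussianReal]
    simp
  · intro h'
    have := Measure.isProbabilityMeasure_map (μ := P) hX
    refine Measure.ext_of_charFun (funext fun ξ => ?_)
    rw [h, h', charFun_gaussianReal]
    simp

section GaussianSpace

variable {H : ℝ} {B : ℝ≥0 → Ω → ℝ}

/-- The value `B_t` as an element of `L²`. -/
def IsFractionalBrownianMotion.toL2 (hB : IsFractionalBrownianMotion H B P) (t : ℝ≥0) :
    Lp ℝ 2 P :=
  (hB.isGaussianProcess.hasGaussianLaw_eval t).memLp_two.toLp (B t)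

lemma IsFractionalBrownianMotion.coeFn_toL2 (hB : IsFractionalBrownianMotion H B P) (t : ℝ≥0) :
    hB.toL2 t =ᵐ[P] B t := MemLp.coeFn_toLp _

lemma IsFractionalBrownianMotion.gaussianSpace_eq (hB : IsFractionalBrownianMotion H B P) :
    gaussianSpace B P = (Submodule.span ℝ (Set.range hB.toL2)).topologicalClosure := by
  unfold gaussianSpace
  congr 2
  ext Y
  constructor
  · rintro ⟨t, ht⟩
    exact ⟨t, Lp.ext ((hB.coeFn_toL2 t).trans ht.symm)⟩
  · rintro ⟨t, rfl⟩
    exact ⟨t, hB.coeFn_toL2 t⟩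

lemma IsFractionalBrownianMotion.toL2_mem (hB : IsFractionalBrownianMotion H B P) (t : ℝ≥0) :
    hB.toL2 t ∈ gaussianSpace B P := by
  rw [hB.gaussianSpace_eq]
  exact Submodule.le_topologicalClosure _ (Submodule.subset_span ⟨t, rfl⟩)

lemma IsFractionalBrownianMotion.inner_toL2 (hB : IsFractionalBrownianMotion H B P) (s t : ℝ≥0) :
    inner ℝ (hB.toL2 t) (hB.toL2 s) =
      1 / 2 * ((t : ℝ) ^ (2 * H) + (s : ℝ) ^ (2 * H) - |(t : ℝ) - (s : ℝ)| ^ (2 * H)) := by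
  rw [inner_eq_integral_mul, ← hB.covariance]
  refine integral_congr_ae ?_
  filter_upwards [hB.coeFn_toL2 t, hB.coeFn_toL2 s] with ω h1 h2
  rw [h1, h2]

/-- Finite linear combinations are Gaussian because `B` is a Gaussian process. The identity of
characteristic functions then extends to the closure, both sides being continuous in `X`. -/
lemma IsFractionalBrownianMotion.map_eq_gaussianReal (hB : IsFractionalBrownianMotion H B P)
    {X : Lp ℝ 2 P} (hX : X ∈ gaussianSpace B P) : P.map X = gaussianReal 0 (‖X‖₊ ^ 2) := by
  rw [hB.gaussianSpace_eq] at hX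
  rw [map_eq_gaussianReal_iff]
  intro ξ
  suffices h : ((Submodule.span ℝ (Set.range hB.toL2)).topologicalClosure : Set (Lp ℝ 2 P)) ⊆
      {X | ∫ ω, Complex.exp (ξ * X ω * Complex.I) ∂P =
        Complex.exp (-(((‖X‖₊ ^ 2 : ℝ≥0) : ℝ) * ξ ^ 2 / 2))} from h hX
  rw [Submodule.topologicalClosure_coe]
  refine closure_minimal ?_ (isClosed_eq (continuous_integral_cexp ξ) ?_)
  · intro Y hY
    rw [SetLike.mem_coe, Finsupp.mem_span_range_iff_exists_finsupp] at hY
    obtain ⟨c, rfl⟩ := hY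
    set Y := c.sum fun t a => a • hB.toL2 t with hYdef
    have hY : ⇑Y =ᵐ[P] ∑ t ∈ c.support, fun ω => c t • B t ω := by
      rw [hYdef, Finsupp.sum]
      refine (Lp.coeFn_finsetSum _ _).trans ?_
      have : ∀ᵐ ω ∂P, ∀ t ∈ c.support, (c t • hB.toL2 t) ω = c t • B t ω := by
        rw [Finset.eventually_all]
        intro t _
        filter_upwards [hB.coeFn_toL2 t, Lp.coeFn_smul (c t) (hB.toL2 t)] with ω h1 h2
        rw [h2, Pi.smul_apply, h1]
      filter_upwards [this] with ω hω
      simp only [Finset.sum_apply]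
      exact Finset.sum_congr rfl hω
    have hg : HasGaussianLaw Y P :=
      ((hB.isGaussianProcess.smul c).hasGaussianLaw_sum (I := c.support)).congr hY.symm
    have h0 : ∫ ω, Y ω ∂P = 0 := by
      rw [integral_congr_ae hY]
      simp only [Finset.sum_apply]
      rw [integral_finsetSum]
      · simp [integral_const_mul, hB.centered]
      · intro t _
        exact ((hB.isGaussianProcess.hasGaussianLaw_eval t).integrable).const_mul (c t)
    have hv : Var[Y; P].toNNReal = ‖Y‖₊ ^ 2 := by
      rw [variance_of_integral_eq_zero hg.aemeasurable h0]
      have : ∫ ω, Y ω ^ 2 ∂P = ‖Y‖ ^ 2 := by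
        rw [← real_inner_self_eq_norm_sq, inner_eq_integral_mul]
        simp only [sq]
      rw [this, Real.toNNReal_pow (norm_nonneg _), norm_toNNReal]
    have := hg.map_eq_gaussianReal
    rw [h0, hv] at this
    exact (map_eq_gaussianReal_iff Y _).1 this ξ
  · push_cast
    fun_prop

end GaussianSpace

section Gaussian

variable {G : Submodule ℝ (Lp ℝ 2 P)}

/-- Two elements of a Gaussian space as linear functions of independent standard normal
variables. -/
lemma exists_map_prodMk_eq (hG : ∀ X ∈ G, P.map X = gaussianReal 0 (‖X‖₊ ^ 2))
    {X Y : Lp ℝ 2 P} (hX : X ∈ G) (hY : Y ∈ G) :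
    ∃ k c : ℝ, ‖X‖ * k = inner ℝ X Y ∧ k ^ 2 + c ^ 2 = ‖Y‖ ^ 2 ∧
      P.map (fun ω => (X ω, Y ω)) =
        ((gaussianReal 0 1).prod (gaussianReal 0 1)).map
          fun p : ℝ × ℝ => (‖X‖ * p.1, k * p.1 + c * p.2) := by
  -- Gram–Schmidt: `k` is the coordinate of `Y` along `X / ‖X‖` and `c` the norm of the residual.
  -- For `X = 0` the first equation is void and the whole norm goes into `k`.
  obtain ⟨k, c, hk, hc⟩ : ∃ k c : ℝ, ‖X‖ * k = inner ℝ X Y ∧ k ^ 2 + c ^ 2 = ‖Y‖ ^ 2 := by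
    by_cases h0 : X = 0
    · exact ⟨‖Y‖, 0, by simp [h0], by simp⟩
    · have hXn : ‖X‖ ≠ 0 := norm_ne_zero_iff.2 h0
      have hCS := abs_real_inner_le_norm X Y
      have : (inner ℝ X Y / ‖X‖) ^ 2 ≤ ‖Y‖ ^ 2 := by
        rw [sq_le_sq, abs_div, abs_norm, abs_norm, div_le_iff₀ (by positivity)]
        linarith
      refine ⟨inner ℝ X Y / ‖X‖, √(‖Y‖ ^ 2 - (inner ℝ X Y / ‖X‖) ^ 2), by field_simp, ?_⟩
      rw [Real.sq_sqrt (by linarith)]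
      ring
  refine ⟨k, c, hk, hc, ?_⟩
  have hXm := (Lp.aestronglyMeasurable X).aemeasurable
  have hYm := (Lp.aestronglyMeasurable Y).aemeasurable
  have hpm : Measurable fun p : ℝ × ℝ => (‖X‖ * p.1, k * p.1 + c * p.2) := by fun_prop
  have := Measure.isProbabilityMeasure_map (μ := P) (hXm.prodMk hYm)
  have := Measure.isProbabilityMeasure_map
    (μ := (gaussianReal 0 1).prod (gaussianReal 0 1)) hpm.aemeasurable
  -- Cramér–Wold: every linear functional of the pair lies again in `G`, so its characteristic
  -- function is known from its norm.
  refine Measure.ext_of_charFunDual (funext fun L => ?_)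
  set l₁ := L (1, 0)
  set l₂ := L (0, 1)
  have hL : ∀ x y : ℝ, L (x, y) = l₁ * x + l₂ * y := by
    intro x y
    have : ((x, y) : ℝ × ℝ) = x • (1, 0) + y • (0, 1) := by simp
    rw [this, map_add, map_smul, map_smul]
    simp only [smul_eq_mul, l₁, l₂]
    ring
  rw [charFunDual_apply, charFunDual_apply, integral_map (hXm.prodMk hYm) (by fun_prop),
    integral_map hpm.aemeasurable (by fun_prop)]
  simp only [hL]
  have h1 : ∫ ω, Complex.exp ((l₁ * X ω + l₂ * Y ω : ℝ) * Complex.I) ∂P =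
      Complex.exp (-((‖l₁ • X + l₂ • Y‖ ^ 2 : ℝ) / 2)) := by
    have := (map_eq_gaussianReal_iff _ _).1
      (hG _ (G.add_mem (G.smul_mem l₁ hX) (G.smul_mem l₂ hY))) 1
    have h2 : (((‖l₁ • X + l₂ • Y‖₊ ^ 2 : ℝ≥0) : ℝ) : ℂ) * (1 : ℝ) ^ 2 / 2 =
        (‖l₁ • X + l₂ • Y‖ ^ 2 : ℝ) / 2 := by push_cast; simp
    rw [← h2]
    refine Eq.trans (integral_congr_ae ?_) this
    filter_upwards [Lp.coeFn_add (l₁ • X) (l₂ • Y), Lp.coeFn_smul l₁ X, Lp.coeFn_smul l₂ Y]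
      with ω e1 e2 e3
    rw [e1, Pi.add_apply, e2, e3]
    simp
  have h3 : ∀ p : ℝ × ℝ, Complex.exp ((l₁ * (‖X‖ * p.1) + l₂ * (k * p.1 + c * p.2) : ℝ) *
      Complex.I) = Complex.exp ((l₁ * ‖X‖ + l₂ * k : ℝ) * p.1 * Complex.I) *
        Complex.exp ((l₂ * c : ℝ) * p.2 * Complex.I) := by
    intro p
    rw [← Complex.exp_add]
    push_cast
    ring_nf
  rw [h1]
  simp only [h3]
  rw [integral_prod_mul (fun x : ℝ => Complex.exp ((l₁ * ‖X‖ + l₂ * k : ℝ) * x * Complex.I))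
    (fun y : ℝ => Complex.exp ((l₂ * c : ℝ) * y * Complex.I)),
    ← charFun_apply_real, ← charFun_apply_real, charFun_gaussianReal, charFun_gaussianReal,
    ← Complex.exp_add]
  congr 1
  have : ‖l₁ • X + l₂ • Y‖ ^ 2 = (l₁ * ‖X‖ + l₂ * k) ^ 2 + (l₂ * c) ^ 2 := by
    rw [norm_add_sq_real, norm_smul, norm_smul, real_inner_smul_left, real_inner_smul_right, ← hk,
      mul_pow, mul_pow, ← hc, Real.norm_eq_abs, Real.norm_eq_abs, sq_abs, sq_abs]
    ring
  rw [this]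
  push_cast
  ring

end Gaussian

end

/-! ### Gaussian integrals of the heat kernel -/

section

variable {Ω : Type*} [MeasurableSpace Ω] {P : Measure Ω} [IsProbabilityMeasure P]

/-- The square root of a nonpositive number and the inverse of `0` are `0` by convention. This makes
the objects below meaningful for all real `ε`, which convergence in distribution requires of the
whole family. -/
lemma heatKernel_of_nonpos {ε : ℝ} (hε : ε ≤ 0) : heatKernel ε = 0 := by
  ext x
  have : 2 * Real.pi * ε ≤ 0 := mul_nonpos_of_nonneg_of_nonpos (by positivity) hε
  simp [heatKernel, Real.sqrt_eq_zero_of_nonpos this]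

lemma hasDerivAt_heatKernel {ε : ℝ} (hε : ε ≠ 0) (x : ℝ) :
    HasDerivAt (heatKernel ε) (-(x / ε) * heatKernel ε x) x := by
  unfold heatKernel
  have h1 : HasDerivAt (fun x : ℝ => -x ^ 2 / (2 * ε)) (-(x / ε)) x := by
    have := ((hasDerivAt_pow 2 x).neg).div_const (2 * ε)
    convert! this using 1
    push_cast
    field_simp
  convert! (h1.exp.const_mul (√(2 * Real.pi * ε))⁻¹) using 1
  ring

lemma deriv_heatKernel {ε : ℝ} (hε : 0 < ε) (x : ℝ) :
    deriv (heatKernel ε) x = -(x / ε) * heatKernel ε x :=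
  (hasDerivAt_heatKernel hε.ne' x).deriv

lemma deriv_heatKernel_zero (ε : ℝ) : deriv (heatKernel ε) 0 = 0 := by
  rcases le_or_gt ε 0 with h | h
  · rw [heatKernel_of_nonpos h]; simp
  · rw [deriv_heatKernel h]; simp

lemma heatKernel_nonneg (ε x : ℝ) : 0 ≤ heatKernel ε x := by unfold heatKernel; positivity

lemma sq_div_mul_heatKernel_le {ε : ℝ} (hε : 0 < ε) (x : ℝ) :
    (1 + x ^ 2 / ε) * heatKernel ε x ≤ 3 * (√(2 * Real.pi * ε))⁻¹ := by
  unfold heatKernel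
  have h1 : 1 + x ^ 2 / ε ≤ 3 * Real.exp (x ^ 2 / (2 * ε)) := by
    have := Real.add_one_le_exp (x ^ 2 / (2 * ε))
    have h2 : x ^ 2 / ε = 2 * (x ^ 2 / (2 * ε)) := by field_simp
    have h3 : 0 ≤ x ^ 2 / (2 * ε) := by positivity
    rw [h2]; linarith
  rw [neg_div, Real.exp_neg]
  calc _ ≤ 3 * Real.exp (x ^ 2 / (2 * ε)) *
        ((√(2 * Real.pi * ε))⁻¹ * (Real.exp (x ^ 2 / (2 * ε)))⁻¹) := by gcongr
    _ = _ := by field_simp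

lemma abs_deriv_heatKernel_le {ε : ℝ} (hε : 0 < ε) (x : ℝ) :
    |deriv (heatKernel ε) x| ≤ 3 * (√(2 * Real.pi * ε))⁻¹ * (√ε)⁻¹ := by
  rw [deriv_heatKernel hε, abs_mul, abs_neg, abs_div, abs_of_pos hε,
    abs_of_nonneg (heatKernel_nonneg _ _)]
  have h1 : |x| / ε ≤ (1 + x ^ 2 / ε) * (√ε)⁻¹ := by
    have hs : √ε * √ε = ε := Real.mul_self_sqrt hε.le
    have hs0 : 0 < √ε := Real.sqrt_pos.2 hε
    have h2 : |x| / ε = (|x| / √ε) * (√ε)⁻¹ := by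
      rw [← div_eq_mul_inv, div_div, hs]
    have h3 : x ^ 2 / ε = (|x| / √ε) ^ 2 := by rw [div_pow, sq_abs, sq √ε, hs]
    rw [h2, h3]
    gcongr
    nlinarith [sq_nonneg (|x| / √ε - 1), sq_nonneg (|x| / √ε)]
  calc |x| / ε * heatKernel ε x ≤ (1 + x ^ 2 / ε) * (√ε)⁻¹ * heatKernel ε x :=
        mul_le_mul_of_nonneg_right h1 (heatKernel_nonneg _ _)
    _ = (1 + x ^ 2 / ε) * heatKernel ε x * (√ε)⁻¹ := by ring
    _ ≤ _ := mul_le_mul_of_nonneg_right (sq_div_mul_heatKernel_le hε x) (by positivity)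

/-- Being Lipschitz and zero at `0`, the function `p_ε'` acts continuously on `L²`; this is what
allows `α_ε` to be a Bochner integral. -/
lemma exists_lipschitzWith_deriv_heatKernel (ε : ℝ) :
    ∃ K, LipschitzWith K (deriv (heatKernel ε)) := by
  rcases le_or_gt ε 0 with h | hε
  · refine ⟨0, ?_⟩
    rw [heatKernel_of_nonpos h]
    have : deriv (0 : ℝ → ℝ) = fun _ => 0 := by ext; simp
    rw [this]
    exact LipschitzWith.const 0
  · have hd : ∀ x, HasDerivAt (deriv (heatKernel ε))
        ((x ^ 2 / ε ^ 2 - 1 / ε) * heatKernel ε x) x := by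
      intro x
      have h1 := (((hasDerivAt_id x).div_const ε).neg).mul (hasDerivAt_heatKernel hε.ne' x)
      refine HasDerivAt.congr_of_eventuallyEq (h1.congr_deriv ?_)
        (.of_forall fun y => deriv_heatKernel hε y)
      simp only [id, Pi.neg_apply]
      field_simp
      ring
    refine ⟨(3 * (√(2 * Real.pi * ε))⁻¹ * ε⁻¹).toNNReal,
      lipschitzWith_of_nnnorm_deriv_le (fun x => (hd x).differentiableAt) fun x => ?_⟩
    rw [← NNReal.coe_le_coe, coe_nnnorm, (hd x).deriv, Real.coe_toNNReal _ (by positivity),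
      norm_mul, Real.norm_eq_abs, Real.norm_of_nonneg (heatKernel_nonneg _ _)]
    have h1 : |x ^ 2 / ε ^ 2 - 1 / ε| ≤ (1 + x ^ 2 / ε) * ε⁻¹ := by
      have h2 : x ^ 2 / ε ^ 2 - 1 / ε = (x ^ 2 / ε - 1) * ε⁻¹ := by field_simp
      rw [h2, abs_mul, abs_of_pos (inv_pos.2 hε)]
      gcongr
      have : 0 ≤ x ^ 2 / ε := by positivity
      rw [abs_le]; constructor <;> linarith
    calc _ ≤ (1 + x ^ 2 / ε) * ε⁻¹ * heatKernel ε x :=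
          mul_le_mul_of_nonneg_right h1 (heatKernel_nonneg _ _)
      _ = (1 + x ^ 2 / ε) * heatKernel ε x * ε⁻¹ := by ring
      _ ≤ _ := mul_le_mul_of_nonneg_right (sq_div_mul_heatKernel_le hε x) (by positivity)

lemma measurable_deriv_heatKernel (ε : ℝ) : Measurable (deriv (heatKernel ε)) :=
  measurable_deriv _

/-- The class of `p_ε'(X)` in `L²`. -/
def kernelLp (ε : ℝ) (X : Lp ℝ 2 P) : Lp ℝ 2 P :=
  (exists_lipschitzWith_deriv_heatKernel ε).choose_spec.compLp (deriv_heatKernel_zero ε) X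

lemma coeFn_kernelLp (ε : ℝ) (X : Lp ℝ 2 P) :
    kernelLp ε X =ᵐ[P] fun ω => deriv (heatKernel ε) (X ω) :=
  LipschitzWith.coeFn_compLp _ _ _

lemma continuous_kernelLp (ε : ℝ) : Continuous (kernelLp (P := P) ε) :=
  (exists_lipschitzWith_deriv_heatKernel ε).choose_spec.continuous_compLp (deriv_heatKernel_zero ε)

/-- Completing the square in `y`: the product of the two Gaussian densities is a third one, times a
heat kernel in `m` that carries the mass. -/
lemma heatKernel_mul_gaussianPDFReal {ε w : ℝ} (hε : 0 < ε) (hw : 0 < w) (m c y : ℝ) :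
    heatKernel ε (m + c * y) * gaussianPDFReal 0 w.toNNReal y =
      heatKernel (ε + c ^ 2 * w) m *
        gaussianPDFReal (-(m * c * w / (ε + c ^ 2 * w))) (ε * w / (ε + c ^ 2 * w)).toNNReal y := by
  have hq : 0 < ε + c ^ 2 * w := by positivity
  rw [gaussianPDFReal_def, gaussianPDFReal_def, Real.coe_toNNReal _ hw.le,
    Real.coe_toNNReal _ (by positivity)]
  unfold heatKernel
  have h1 : √(2 * Real.pi * ε) * √(2 * Real.pi * w) =
      √(2 * Real.pi * (ε + c ^ 2 * w)) * √(2 * Real.pi * (ε * w / (ε + c ^ 2 * w))) := by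
    rw [← Real.sqrt_mul (by positivity), ← Real.sqrt_mul (by positivity)]
    congr 1
    field_simp
  have h2 : -(m + c * y) ^ 2 / (2 * ε) + -(y - 0) ^ 2 / (2 * w) =
      -m ^ 2 / (2 * (ε + c ^ 2 * w)) + -(y - -(m * c * w / (ε + c ^ 2 * w))) ^ 2 /
        (2 * (ε * w / (ε + c ^ 2 * w))) := by
    field_simp
    ring
  calc _ = (√(2 * Real.pi * ε) * √(2 * Real.pi * w))⁻¹ *
        Real.exp (-(m + c * y) ^ 2 / (2 * ε) + -(y - 0) ^ 2 / (2 * w)) := by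
        rw [mul_inv, Real.exp_add]; ring
    _ = _ := by rw [h1, h2, mul_inv, Real.exp_add]; ring

/-- Integration of a function against a heat kernel and a Gaussian law. -/
lemma integral_mul_heatKernel_gaussianReal {ε w : ℝ} (hε : 0 < ε) (hw : 0 < w) (m c : ℝ)
    (f : ℝ → ℝ) :
    ∫ y, f y * heatKernel ε (m + c * y) ∂gaussianReal 0 w.toNNReal =
      heatKernel (ε + c ^ 2 * w) m * ∫ y, f y ∂gaussianReal (-(m * c * w / (ε + c ^ 2 * w)))
        (ε * w / (ε + c ^ 2 * w)).toNNReal := by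
  have hq : 0 < ε + c ^ 2 * w := by positivity
  rw [integral_gaussianReal_eq_integral_smul (by simpa using hw),
    integral_gaussianReal_eq_integral_smul (by simpa using (by positivity)),
    ← integral_const_mul]
  refine integral_congr_ae (.of_forall fun y => ?_)
  simp only [smul_eq_mul]
  rw [mul_left_comm, mul_comm (gaussianPDFReal _ _ _), heatKernel_mul_gaussianPDFReal hε hw]
  ring

lemma integrable_id_gaussianReal (m : ℝ) (v : ℝ≥0) : Integrable (fun y => y) (gaussianReal m v) :=
  memLp_one_iff_integrable.1 (memLp_id_gaussianReal 1)

lemma integral_sq_gaussianReal (v : ℝ≥0) : ∫ y, y * y ∂gaussianReal 0 v = v := by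
  have h := variance_id_gaussianReal (μ := 0) (v := v)
  rw [variance_of_integral_eq_zero (by fun_prop) (by simp)] at h
  rw [← h]
  simp [sq]

/-- The semigroup property of the heat kernel, differentiated in `m`: averaging over an independent
Gaussian of variance `c²` adds `c²` to `ε`. -/
lemma integral_deriv_heatKernel_add {ε : ℝ} (hε : 0 < ε) (m c : ℝ) :
    ∫ y, deriv (heatKernel ε) (m + c * y) ∂gaussianReal 0 1 =
      deriv (heatKernel (ε + c ^ 2)) m := by
  have hq : 0 < ε + c ^ 2 := by positivity
  have h := integral_mul_heatKernel_gaussianReal hε one_pos m c fun y => -((m + c * y) / ε)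
  simp only [Real.toNNReal_one, mul_one] at h
  simp only [deriv_heatKernel hε, deriv_heatKernel hq]
  rw [h, integral_neg, integral_div, integral_add (integrable_const _)
    ((integrable_id_gaussianReal _ _).const_mul _), integral_const_mul, integral_id_gaussianReal]
  simp
  field_simp
  ring

lemma integral_deriv_heatKernel_mul_self {ε : ℝ} (hε : 0 < ε) (a : ℝ) :
    ∫ x, deriv (heatKernel ε) (a * x) * x ∂gaussianReal 0 1 =
      -(√(2 * Real.pi))⁻¹ * (a * (ε + a ^ 2) ^ (-(3 / 2) : ℝ)) := by
  have hq : 0 < ε + a ^ 2 := by positivity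
  have h := integral_mul_heatKernel_gaussianReal hε one_pos 0 a fun y => -(a / ε) * (y * y)
  simp only [Real.toNNReal_one, mul_one, zero_add, zero_mul, zero_div, neg_zero] at h
  have h' : ∫ x, deriv (heatKernel ε) (a * x) * x ∂gaussianReal 0 1 =
      ∫ y, -(a / ε) * (y * y) * heatKernel ε (a * y) ∂gaussianReal 0 1 := by
    refine integral_congr_ae (.of_forall fun y => ?_)
    simp only [deriv_heatKernel hε]
    ring
  rw [h', h, integral_const_mul, integral_sq_gaussianReal, Real.coe_toNNReal _ (by positivity)]
  have h3 : (ε + a ^ 2) ^ (-(3 / 2) : ℝ) = (√(ε + a ^ 2))⁻¹ * (ε + a ^ 2)⁻¹ := by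
    rw [Real.sqrt_eq_rpow, ← Real.rpow_neg hq.le, ← Real.rpow_neg_one, ← Real.rpow_add hq]
    norm_num
  rw [h3]
  simp only [heatKernel]
  rw [Real.sqrt_mul (by positivity) (ε + a ^ 2)]
  simp
  field_simp

/-- The two kernels are absorbed one after the other into the Gaussian weight, leaving a second
moment. The two normalizing factors `δ + k²` and `ε + a² δ / (δ + k²)` multiply to the determinant
of a regularized covariance matrix (`hQ`). -/
lemma integral_deriv_heatKernel_mul {ε δ : ℝ} (hε : 0 < ε) (hδ : 0 < δ) (a k : ℝ) :
    ∫ x, deriv (heatKernel ε) (a * x) * deriv (heatKernel δ) (k * x) ∂gaussianReal 0 1 =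
      (2 * Real.pi)⁻¹ * (a * k * ((ε + a ^ 2) * (δ + k ^ 2) - (a * k) ^ 2) ^ (-(3 / 2) : ℝ)) := by
  have hq : 0 < δ + k ^ 2 := by positivity
  have hr : 0 < ε + a ^ 2 * (δ / (δ + k ^ 2)) := by positivity
  have hQ : (ε + a ^ 2) * (δ + k ^ 2) - (a * k) ^ 2 =
      (δ + k ^ 2) * (ε + a ^ 2 * (δ / (δ + k ^ 2))) := by
    field_simp; ring
  have h := integral_mul_heatKernel_gaussianReal hδ one_pos 0 k
    fun y => (a * k) / (ε * δ) * (y * y) * heatKernel ε (a * y)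
  simp only [Real.toNNReal_one, mul_one, zero_add, zero_mul, zero_div, neg_zero] at h
  have h2 := integral_mul_heatKernel_gaussianReal hε (w := δ / (δ + k ^ 2)) (by positivity) 0 a
    fun y => (a * k) / (ε * δ) * (y * y)
  simp only [zero_add, zero_mul, zero_div, neg_zero] at h2
  have h' : ∫ x, deriv (heatKernel ε) (a * x) * deriv (heatKernel δ) (k * x) ∂gaussianReal 0 1 =
      ∫ y, (a * k) / (ε * δ) * (y * y) * heatKernel ε (a * y) * heatKernel δ (k * y)
        ∂gaussianReal 0 1 := by
    refine integral_congr_ae (.of_forall fun y => ?_)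
    simp only [deriv_heatKernel hε, deriv_heatKernel hδ]
    field_simp
  rw [h', h, h2, integral_const_mul, integral_sq_gaussianReal, Real.coe_toNNReal _ (by positivity),
    hQ]
  have h3 : ∀ z : ℝ, 0 < z → z ^ (-(3 / 2) : ℝ) = (√z)⁻¹ * z⁻¹ := by
    intro z hz
    rw [Real.sqrt_eq_rpow, ← Real.rpow_neg hz.le, ← Real.rpow_neg_one, ← Real.rpow_add hz]
    norm_num
  rw [h3 _ (mul_pos hq hr), Real.sqrt_mul hq.le]
  simp only [heatKernel]
  rw [Real.sqrt_mul (by positivity) (δ + k ^ 2), Real.sqrt_mul (by positivity) (ε + _)]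
  have hpi : √(2 * Real.pi) * √(2 * Real.pi) = 2 * Real.pi := Real.mul_self_sqrt (by positivity)
  have e1 : (-0 ^ 2 / (2 * (δ + k ^ 2)) : ℝ) = 0 := by simp
  have e2 : (-0 ^ 2 / (2 * (ε + a ^ 2 * (δ / (δ + k ^ 2)))) : ℝ) = 0 := by simp
  rw [e1, e2, Real.exp_zero]
  set r := ε + a ^ 2 * (δ / (δ + k ^ 2))
  set q := δ + k ^ 2
  have := Real.sqrt_pos.2 hr
  have := Real.sqrt_pos.2 hq
  set z := √(2 * Real.pi)
  rw [← hpi]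
  have : 0 < z := Real.sqrt_pos.2 (by positivity)
  field_simp

section Gaussian

variable {G : Submodule ℝ (Lp ℝ 2 P)}

lemma exists_integral_eq (hG : ∀ X ∈ G, P.map X = gaussianReal 0 (‖X‖₊ ^ 2))
    {X Y : Lp ℝ 2 P} (hX : X ∈ G) (hY : Y ∈ G) :
    ∃ k c : ℝ, ‖X‖ * k = inner ℝ X Y ∧ k ^ 2 + c ^ 2 = ‖Y‖ ^ 2 ∧
      ∀ f g : ℝ → ℝ, Measurable f → Measurable g → Integrable (fun ω => f (X ω) * g (Y ω)) P →
        ∫ ω, f (X ω) * g (Y ω) ∂P = ∫ x, f (‖X‖ * x) *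
          ∫ y, g (k * x + c * y) ∂gaussianReal 0 1 ∂gaussianReal 0 1 := by
  obtain ⟨k, c, hk, hc, hmap⟩ := exists_map_prodMk_eq hG hX hY
  refine ⟨k, c, hk, hc, fun f g hf hg hint => ?_⟩
  have hXm := (Lp.aestronglyMeasurable X).aemeasurable
  have hYm := (Lp.aestronglyMeasurable Y).aemeasurable
  have hpm : Measurable fun p : ℝ × ℝ => (‖X‖ * p.1, k * p.1 + c * p.2) := by fun_prop
  have hFm : Measurable fun p : ℝ × ℝ => f p.1 * g p.2 := by fun_prop
  have h1 : ∫ ω, f (X ω) * g (Y ω) ∂P =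
      ∫ p, f p.1 * g p.2 ∂P.map fun ω => (X ω, Y ω) := by
    rw [integral_map (hXm.prodMk hYm) hFm.aestronglyMeasurable]
  have h2 : Integrable (fun p : ℝ × ℝ => f p.1 * g p.2) (P.map fun ω => (X ω, Y ω)) :=
    (integrable_map_measure hFm.aestronglyMeasurable (hXm.prodMk hYm)).2 hint
  rw [hmap] at h1 h2
  rw [h1, integral_map hpm.aemeasurable hFm.aestronglyMeasurable]
  rw [integrable_map_measure hFm.aestronglyMeasurable hpm.aemeasurable] at h2
  refine (integral_prod _ h2).trans ?_
  simp only [Function.comp_apply, integral_const_mul]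

lemma inner_kernelLp_left (hG : ∀ X ∈ G, P.map X = gaussianReal 0 (‖X‖₊ ^ 2)) {ε : ℝ} (hε : 0 < ε)
    {X Y : Lp ℝ 2 P} (hX : X ∈ G) (hY : Y ∈ G) :
    inner ℝ (kernelLp ε X) Y =
      -(√(2 * Real.pi))⁻¹ * (inner ℝ X Y * (ε + ‖X‖ ^ 2) ^ (-(3 / 2) : ℝ)) := by
  obtain ⟨k, c, hk, -, h⟩ := exists_integral_eq hG hX hY
  have hae : (fun ω => kernelLp ε X ω * Y ω) =ᵐ[P] fun ω => deriv (heatKernel ε) (X ω) * id (Y ω) := by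
    filter_upwards [coeFn_kernelLp ε X] with ω hω
    rw [hω, id]
  rw [inner_eq_integral_mul, integral_congr_ae hae, h _ _ (measurable_deriv_heatKernel ε)
    measurable_id ((integrable_Lp_mul _ _).congr hae)]
  have : ∀ x : ℝ, ∫ y, id (k * x + c * y) ∂gaussianReal 0 1 = k * x := by
    intro x
    simp only [id]
    rw [integral_add (integrable_const _) ((integrable_id_gaussianReal _ _).const_mul _),
      integral_const_mul c, integral_id_gaussianReal]
    simp
  simp only [this]
  rw [← hk]
  have h2 : ∀ x : ℝ, deriv (heatKernel ε) (‖X‖ * x) * (k * x) =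
      k * (deriv (heatKernel ε) (‖X‖ * x) * x) := fun x => by ring
  simp only [h2]
  rw [integral_const_mul, integral_deriv_heatKernel_mul_self hε]
  ring

/-- The part of `Y` independent of `X` is averaged out first, which replaces `ε` by `ε + c²` in the
second kernel; `c² + k² = ‖Y‖²` restores a symmetric formula. -/
lemma inner_kernelLp_kernelLp (hG : ∀ X ∈ G, P.map X = gaussianReal 0 (‖X‖₊ ^ 2)) {ε : ℝ}
    (hε : 0 < ε) {X Y : Lp ℝ 2 P} (hX : X ∈ G) (hY : Y ∈ G) :
    inner ℝ (kernelLp ε X) (kernelLp ε Y) = (2 * Real.pi)⁻¹ * (inner ℝ X Y *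
      ((ε + ‖X‖ ^ 2) * (ε + ‖Y‖ ^ 2) - inner ℝ X Y ^ 2) ^ (-(3 / 2) : ℝ)) := by
  obtain ⟨k, c, hk, hc, h⟩ := exists_integral_eq hG hX hY
  have hae : (fun ω => kernelLp ε X ω * kernelLp ε Y ω) =ᵐ[P]
      fun ω => deriv (heatKernel ε) (X ω) * deriv (heatKernel ε) (Y ω) := by
    filter_upwards [coeFn_kernelLp ε X, coeFn_kernelLp ε Y] with ω h1 h2
    rw [h1, h2]
  rw [inner_eq_integral_mul, integral_congr_ae hae, h _ _ (measurable_deriv_heatKernel ε)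
    (measurable_deriv_heatKernel ε) ((integrable_Lp_mul _ _).congr hae)]
  simp only [integral_deriv_heatKernel_add hε]
  rw [integral_deriv_heatKernel_mul hε (by positivity), ← hk, ← hc]
  ring_nf

lemma integral_kernelLp (hG : ∀ X ∈ G, P.map X = gaussianReal 0 (‖X‖₊ ^ 2)) {ε : ℝ} (hε : 0 < ε)
    {X : Lp ℝ 2 P} (hX : X ∈ G) : ∫ ω, kernelLp ε X ω ∂P = 0 := by
  obtain ⟨k, c, -, -, h⟩ := exists_integral_eq hG hX hX
  have hae : (fun ω => kernelLp ε X ω) =ᵐ[P]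
      fun ω => deriv (heatKernel ε) (X ω) * (fun _ => (1 : ℝ)) (X ω) := by
    filter_upwards [coeFn_kernelLp ε X] with ω h1
    rw [h1, mul_one]
  have h0 := integral_deriv_heatKernel_add hε 0 ‖X‖
  rw [deriv_heatKernel_zero] at h0
  rw [integral_congr_ae hae, h _ _ (measurable_deriv_heatKernel ε) measurable_const
    ((Lp_two_integrable _).congr hae)]
  simpa using h0

end Gaussian

end

/-! ### Hermite polynomials and the Fourier representation of the kernel -/

section

variable {Ω : Type*} [MeasurableSpace Ω] {P : Measure Ω} [IsProbabilityMeasure P]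

lemma memLp_polynomial_gaussianReal (m : ℝ) (v : ℝ≥0) (p : Polynomial ℝ) :
    MemLp (fun x => p.eval x) 2 (gaussianReal m v) := by
  induction p using Polynomial.induction_on' with
  | add p q hp hq => simpa only [Polynomial.eval_add] using! hp.add hq
  | monomial n a =>
    simp only [Polynomial.eval_monomial]
    refine MemLp.const_mul ?_ a
    rw [memLp_two_iff_integrable_sq (by fun_prop)]
    simp only [← pow_mul]
    exact integrable_pow_of_mem_interior_integrableExpSet (X := id) (by simp) _

lemma integrable_polynomial_gaussianReal (m : ℝ) (v : ℝ≥0) (p : Polynomial ℝ) :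
    Integrable (fun x => p.eval x) (gaussianReal m v) :=
  (memLp_polynomial_gaussianReal m v p).integrable (by norm_num)

/-- Gaussian integration by parts. -/
lemma integral_id_mul_gaussianReal {f f' : ℝ → ℝ} (hf : ∀ x, HasDerivAt f (f' x) x)
    (h1 : Integrable (fun x => x * f x) (gaussianReal 0 1)) (h2 : Integrable f' (gaussianReal 0 1))
    (h3 : Integrable f (gaussianReal 0 1)) :
    ∫ x, x * f x ∂gaussianReal 0 1 = ∫ x, f' x ∂gaussianReal 0 1 := by
  have hint : ∀ g : ℝ → ℝ, Integrable g (gaussianReal 0 1) ↔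
      Integrable (fun x => gaussianPDFReal 0 1 x * g x) := by
    intro g
    rw [gaussianReal_of_var_ne_zero 0 one_ne_zero, integrable_withDensity_iff_integrable_smul'
      (measurable_gaussianPDF _ _) (.of_forall fun x => by simp [gaussianPDF])]
    simp [gaussianPDF, ENNReal.toReal_ofReal (gaussianPDFReal_nonneg _ _ _)]
  have hd : ∀ x, HasDerivAt (gaussianPDFReal 0 1) (-(x * gaussianPDFReal 0 1 x)) x := by
    have he : gaussianPDFReal 0 1 = heatKernel 1 := by
      ext x; simp [gaussianPDFReal_def, heatKernel]
    intro x
    rw [he]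
    exact (hasDerivAt_heatKernel one_ne_zero x).congr_deriv (by ring)
  rw [integral_gaussianReal_eq_integral_smul one_ne_zero,
    integral_gaussianReal_eq_integral_smul one_ne_zero]
  simp only [smul_eq_mul]
  have := integral_mul_deriv_eq_deriv_mul_of_integrable (u := f) (u' := f')
    (v := gaussianPDFReal 0 1) (v' := fun x => -(x * gaussianPDFReal 0 1 x))
    (fun x _ => hf x) (fun x _ => hd x)
    (((hint _).1 h1).neg.congr (.of_forall fun x => by simp only [Pi.neg_apply, Pi.mul_apply]; ring))
    (((hint _).1 h2).congr (.of_forall fun x => by simp only [Pi.mul_apply]; ring))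
    (((hint _).1 h3).congr (.of_forall fun x => by simp only [Pi.mul_apply]; ring))
  have e1 : ∫ x, gaussianPDFReal 0 1 x * (x * f x) = -∫ x, f x * -(x * gaussianPDFReal 0 1 x) := by
    rw [← integral_neg]; congr 1; ext x; ring
  rw [e1, this, neg_neg]
  congr 1; ext x; ring

lemma integral_id_mul_polynomial_gaussianReal (p : Polynomial ℝ) :
    ∫ x, x * p.eval x ∂gaussianReal 0 1 = ∫ x, p.derivative.eval x ∂gaussianReal 0 1 :=
  integral_id_mul_gaussianReal (fun x => p.hasDerivAt x)
    (by
      have h := integrable_polynomial_gaussianReal 0 1 (Polynomial.X * p)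
      simp only [Polynomial.eval_mul, Polynomial.eval_X] at h
      exact h)
    (integrable_polynomial_gaussianReal _ _ _) (integrable_polynomial_gaussianReal _ _ _)

/-- The probabilists' Hermite polynomials with real coefficients. -/
def hermiteReal (n : ℕ) : Polynomial ℝ := (Polynomial.hermite n).map (Int.castRingHom ℝ)

lemma aeval_hermite (x : ℝ) (n : ℕ) :
    Polynomial.aeval x (Polynomial.hermite n) = (hermiteReal n).eval x := by
  rw [hermiteReal, Polynomial.eval_map, Polynomial.aeval_def]
  rfl

lemma hermiteReal_succ (n : ℕ) :
    hermiteReal (n + 1) = Polynomial.X * hermiteReal n - (hermiteReal n).derivative := by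
  simp [hermiteReal, Polynomial.hermite_succ, Polynomial.derivative_map]

lemma hermiteReal_zero : hermiteReal 0 = 1 := by simp [hermiteReal]

lemma hermiteReal_one : hermiteReal 1 = Polynomial.X := by simp [hermiteReal]

lemma derivative_hermiteReal_succ (n : ℕ) :
    (hermiteReal (n + 1)).derivative = Polynomial.C ((n : ℝ) + 1) * hermiteReal n := by
  induction n with
  | zero => simp [hermiteReal_one, hermiteReal_zero]
  | succ n ih =>
    rw [hermiteReal_succ (n + 1), Polynomial.derivative_sub, ih, Polynomial.derivative_mul,
      Polynomial.derivative_X, ih, Polynomial.derivative_C_mul]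
    have := hermiteReal_succ n
    push_cast
    simp only [Polynomial.C_add, Polynomial.C_1]
    linear_combination (-(Polynomial.C (n : ℝ) + 1)) * this

lemma degree_hermiteReal (n : ℕ) : (hermiteReal n).degree = n := by
  rw [hermiteReal, Polynomial.degree_map_eq_of_injective (RingHom.injective_int _),
    Polynomial.degree_hermite]

/-- With `H_(n+1) = x H_n - H_n'`, integration by parts moves one derivative onto `g`, so the
degrees of both factors drop until `g` vanishes. -/
lemma integral_hermiteReal_mul_of_degree_lt (n : ℕ) {g : Polynomial ℝ} (hg : g.degree < n) :
    ∫ x, (hermiteReal n).eval x * g.eval x ∂gaussianReal 0 1 = 0 := by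
  induction n generalizing g with
  | zero =>
    have : g = 0 := by
      rw [← Polynomial.degree_eq_bot]
      exact Nat.WithBot.lt_zero_iff.1 (by simpa using hg)
    simp [this]
  | succ n ih =>
    have hg' : g.derivative.degree < n := by
      by_cases h0 : g = 0
      · simp [h0]
      · refine (Polynomial.degree_derivative_lt h0).trans_le ?_
        rw [Polynomial.degree_eq_natDegree h0] at hg ⊢
        exact_mod_cast Nat.lt_succ_iff.1 (by exact_mod_cast hg)
    have h1 := integral_id_mul_polynomial_gaussianReal (hermiteReal n * g)
    rw [Polynomial.derivative_mul] at h1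
    simp only [Polynomial.eval_add, Polynomial.eval_mul] at h1
    have hi := fun p : Polynomial ℝ => integrable_polynomial_gaussianReal 0 1 p
    have i1 := hi ((hermiteReal n).derivative * g)
    have i2 := hi (hermiteReal n * g.derivative)
    have i3 := hi (Polynomial.X * (hermiteReal n * g))
    simp only [Polynomial.eval_mul, Polynomial.eval_X] at i1 i2 i3
    rw [integral_add i1 i2, ih hg', add_zero] at h1
    have h2 : ∀ x, (hermiteReal (n + 1)).eval x * g.eval x =
        x * ((hermiteReal n).eval x * g.eval x) - (hermiteReal n).derivative.eval x * g.eval x := by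
      intro x
      rw [hermiteReal_succ]
      simp only [Polynomial.eval_sub, Polynomial.eval_mul, Polynomial.eval_X]
      ring
    simp only [h2]
    rw [integral_sub i3 i1, h1, sub_self]

lemma integral_hermiteReal_mul_hermiteReal {m n : ℕ} (hmn : m ≠ n) :
    ∫ x, (hermiteReal m).eval x * (hermiteReal n).eval x ∂gaussianReal 0 1 = 0 := by
  rcases hmn.lt_or_gt with h | h
  · simp only [mul_comm (Polynomial.eval _ (hermiteReal m))]
    exact integral_hermiteReal_mul_of_degree_lt n (by rw [degree_hermiteReal]; exact_mod_cast h)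
  · exact integral_hermiteReal_mul_of_degree_lt m (by rw [degree_hermiteReal]; exact_mod_cast h)

/-- Mehler's formula for Hermite polynomials. -/
lemma integral_hermiteReal_add {k c : ℝ} (hkc : k ^ 2 + c ^ 2 = 1) (n : ℕ) (x : ℝ) :
    ∫ y, (hermiteReal n).eval (k * x + c * y) ∂gaussianReal 0 1 =
      k ^ n * (hermiteReal n).eval x := by
  have hi : ∀ p : Polynomial ℝ, Integrable (fun y => p.eval (k * x + c * y)) (gaussianReal 0 1) := by
    intro p
    have := integrable_polynomial_gaussianReal 0 1
      (p.comp (Polynomial.C (k * x) + Polynomial.C c * Polynomial.X))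
    simpa [Polynomial.eval_comp] using this
  -- Integration by parts in `y` turns the term `c y p` into `c² p'`, and `c² - 1 = -k²`.
  have hrec : ∀ p : Polynomial ℝ, ∫ y, (Polynomial.X * p - p.derivative).eval (k * x + c * y)
      ∂gaussianReal 0 1 = k * x * (∫ y, p.eval (k * x + c * y) ∂gaussianReal 0 1) -
        k ^ 2 * ∫ y, p.derivative.eval (k * x + c * y) ∂gaussianReal 0 1 := by
    intro p
    set q := p.comp (Polynomial.C (k * x) + Polynomial.C c * Polynomial.X) with hq
    have hq1 : ∀ y, q.eval y = p.eval (k * x + c * y) := fun y => by simp [hq, Polynomial.eval_comp]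
    have hq2 : ∀ y, q.derivative.eval y = c * p.derivative.eval (k * x + c * y) := fun y => by
      simp [hq, Polynomial.derivative_comp, Polynomial.eval_comp]
    have h := integral_id_mul_polynomial_gaussianReal q
    simp only [hq1, hq2, integral_const_mul] at h
    have i1 : Integrable (fun y => y * p.eval (k * x + c * y)) (gaussianReal 0 1) := by
      have h := integrable_polynomial_gaussianReal 0 1 (Polynomial.X * q)
      simp only [Polynomial.eval_mul, Polynomial.eval_X, hq1] at h
      exact h
    have h2 : ∀ y, (Polynomial.X * p - p.derivative).eval (k * x + c * y) =
        k * x * p.eval (k * x + c * y) + c * (y * p.eval (k * x + c * y)) -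
          p.derivative.eval (k * x + c * y) := by
      intro y
      simp only [Polynomial.eval_sub, Polynomial.eval_mul, Polynomial.eval_X]
      ring
    simp only [h2]
    have i2 : Integrable (fun y => k * x * p.eval (k * x + c * y)) (gaussianReal 0 1) :=
      (hi p).const_mul _
    have i3 : Integrable (fun y => c * (y * p.eval (k * x + c * y))) (gaussianReal 0 1) :=
      i1.const_mul c
    have i4 : Integrable (fun y => k * x * p.eval (k * x + c * y) +
        c * (y * p.eval (k * x + c * y))) (gaussianReal 0 1) := i2.add i3
    rw [integral_sub i4 (hi p.derivative), integral_add i2 i3, integral_const_mul,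
      integral_const_mul, h]
    linear_combination (∫ y, p.derivative.eval (k * x + c * y) ∂gaussianReal 0 1) * hkc
  -- Two consecutive degrees are carried along, because the recursion involves `H_(n+1)'`, a
  -- multiple of `H_n`.
  suffices h : ∀ n, (∫ y, (hermiteReal n).eval (k * x + c * y) ∂gaussianReal 0 1 =
      k ^ n * (hermiteReal n).eval x) ∧
      (∫ y, (hermiteReal (n + 1)).eval (k * x + c * y) ∂gaussianReal 0 1 =
        k ^ (n + 1) * (hermiteReal (n + 1)).eval x) from (h n).1
  intro n
  induction n with
  | zero =>
    refine ⟨by simp [hermiteReal_zero], ?_⟩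
    rw [hermiteReal_succ, hrec]
    simp [hermiteReal_zero]
  | succ n ih =>
    refine ⟨ih.2, ?_⟩
    rw [hermiteReal_succ (n + 1), hrec, ih.2, derivative_hermiteReal_succ]
    simp only [Polynomial.eval_mul, Polynomial.eval_C, integral_const_mul, Polynomial.eval_sub,
      Polynomial.eval_X, ih.1]
    ring

/-- The Gaussian is its own Fourier transform: `exp (-a² / 2)` is the mean of `cos (a y)`, and
integration by parts produces the factor `y` with a sine. Thus orthogonality to all `sin (ξ X)`
passes to `p_ε'(X)`. -/
lemma heatKernel_deriv_eq_integral_sin {ε : ℝ} (hε : 0 < ε) (x : ℝ) :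
    deriv (heatKernel ε) x = -((√ε)⁻¹ * (√(2 * Real.pi * ε))⁻¹) *
      ∫ y, y * Real.sin (y * (x / √ε)) ∂gaussianReal 0 1 := by
  set a := x / √ε with ha
  have hs : ∀ y, HasDerivAt (fun y => Real.sin (y * a)) (a * Real.cos (y * a)) y := by
    intro y
    have := ((hasDerivAt_id y).mul_const a).sin
    simpa [mul_comm] using this
  have hb : ∀ f : ℝ → ℝ, Continuous f → (∀ y, |f y| ≤ 1) → Integrable f (gaussianReal 0 1) :=
    fun f hf h => Integrable.of_bound hf.aestronglyMeasurable 1 (.of_forall h)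
  have h1 : Integrable (fun y => y * Real.sin (y * a)) (gaussianReal 0 1) :=
    (integrable_id_gaussianReal 0 1).mul_bdd (c := 1)
      (Continuous.aestronglyMeasurable (by fun_prop)) (.of_forall fun y => Real.abs_sin_le_one _)
  have hcos : Integrable (fun y => Real.cos (y * a)) (gaussianReal 0 1) :=
    hb _ (by fun_prop) fun y => Real.abs_cos_le_one _
  rw [integral_id_mul_gaussianReal hs h1 (hcos.const_mul a)
    (hb _ (by fun_prop) fun y => Real.abs_sin_le_one _), integral_const_mul]
  have h2 : ∫ y, Real.cos (y * a) ∂gaussianReal 0 1 = Real.exp (-(a ^ 2 / 2)) := by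
    have h := charFun_gaussianReal (μ := 0) (v := 1) a
    rw [charFun_apply_real] at h
    have h3 := congrArg Complex.re h
    have hint : Integrable (fun y : ℝ => Complex.exp (a * y * Complex.I)) (gaussianReal 0 1) := by
      refine Integrable.of_bound (C := 1) (by fun_prop) (.of_forall fun y => ?_)
      rw [← Complex.ofReal_mul, Complex.norm_exp_ofReal_mul_I]
    have h4 := integral_re hint
    simp only [RCLike.re_eq_complex_re] at h4
    rw [← h4] at h3
    have h5 : ∀ y : ℝ, (Complex.exp (a * y * Complex.I)).re = Real.cos (y * a) := by
      intro y
      rw [← Complex.ofReal_mul, Complex.exp_ofReal_mul_I_re, mul_comm]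
    simp only [h5] at h3
    rw [h3]
    have : ((a : ℂ) * (0 : ℝ) * Complex.I - ((1 : ℝ≥0) : ℝ) * (a : ℂ) ^ 2 / 2) =
        ((-(a ^ 2 / 2) : ℝ) : ℂ) := by push_cast; ring
    rw [this, Complex.exp_ofReal_re]
  rw [h2, deriv_heatKernel hε]
  unfold heatKernel
  have hsq : √ε * √ε = ε := Real.mul_self_sqrt hε.le
  have h3 : -x ^ 2 / (2 * ε) = -(a ^ 2 / 2) := by
    rw [ha, div_pow, Real.sq_sqrt hε.le]; field_simp
  rw [h3]
  have h4 : x / ε = (√ε)⁻¹ * a := by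
    rw [ha, inv_mul_eq_div, div_div, hsq]
  rw [h4]
  ring

end

/-! ### Chaos decomposition of the kernel -/

section

/-- Expansion of an element of the closed span of pairwise orthogonal subspaces. -/
lemma hasSum_starProjection_of_mem_closure {E : Type*} [NormedAddCommGroup E]
    [InnerProductSpace ℝ E] (F : ℕ → Submodule ℝ E) [∀ i, (F i).HasOrthogonalProjection]
    (hF : ∀ i j, i ≠ j → F i ⟂ F j) {x : E} (hx : x ∈ (⨆ i, F i).topologicalClosure) :
    HasSum (fun i => (F i).starProjection x) x := by
  have horth : ∀ s : Finset ℕ, ⨆ i ∈ s, F i ≤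
      (Submodule.span ℝ {x - ∑ i ∈ s, (F i).starProjection x})ᗮ := by
    refine fun s => iSup₂_le fun j hj w hw => ?_
    rw [Submodule.mem_orthogonal_singleton_iff_inner_right, inner_sub_left, sum_inner,
      Finset.sum_eq_single_of_mem j hj, ← inner_sub_left,
      Submodule.starProjection_inner_eq_zero _ _ hw]
    intro i _ hij
    exact (hF i j hij) |>.inner_eq (Submodule.starProjection_apply_mem _ _) hw
  -- By Pythagoras the partial sum is the best approximation of `x` within the finite span, so any
  -- approximant supported in `s` controls the error for every larger index set.
  have hmin : ∀ s : Finset ℕ, ∀ w ∈ ⨆ i ∈ s, F i,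
      ‖x - ∑ i ∈ s, (F i).starProjection x‖ ≤ ‖x - w‖ := by
    intro s w hw
    set S := ∑ i ∈ s, (F i).starProjection x
    have hS : S ∈ ⨆ i ∈ s, F i := Submodule.sum_mem _ fun i hi =>
      Submodule.mem_iSup_of_mem i (Submodule.mem_iSup_of_mem hi
        (Submodule.starProjection_apply_mem _ _))
    have h0 : inner ℝ (x - S) (S - w) = 0 :=
      Submodule.mem_orthogonal_singleton_iff_inner_right.1 (horth s (Submodule.sub_mem _ hS hw))
    have h1 := norm_add_sq_eq_norm_sq_add_norm_sq_of_inner_eq_zero _ _ h0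
    rw [sub_add_sub_cancel] at h1
    nlinarith [norm_nonneg (x - S), norm_nonneg (x - w), mul_self_nonneg ‖S - w‖]
  rw [HasSum, SummationFilter.unconditional_filter, Metric.tendsto_atTop]
  intro ε hε
  obtain ⟨y, hy, hxy⟩ := Metric.mem_closure_iff.1 hx ε hε
  obtain ⟨s, hs⟩ := Submodule.mem_iSup_iff_exists_finset.1 hy
  refine ⟨s, fun t ht => ?_⟩
  rw [dist_comm, dist_eq_norm]
  refine (hmin t y ?_).trans_lt (by rwa [← dist_eq_norm])
  exact (iSup_le_iSup_of_subset (fun i hi => ht hi) : ⨆ i ∈ s, F i ≤ ⨆ i ∈ t, F i) hs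

variable {Ω : Type*} [MeasurableSpace Ω] {P : Measure Ω} [IsProbabilityMeasure P]

section Gaussian

variable {G : Submodule ℝ (Lp ℝ 2 P)}

lemma memLp_comp_of_map_eq {X : Lp ℝ 2 P} {v : ℝ≥0} (hX : P.map X = gaussianReal 0 v)
    (p : Polynomial ℝ) : MemLp (fun ω => p.eval (X ω)) 2 P := by
  have h := memLp_polynomial_gaussianReal 0 v p
  rw [← hX] at h
  exact (memLp_map_measure_iff (by fun_prop) (Lp.aestronglyMeasurable X).aemeasurable).1 h

lemma integrable_exp_mul_abs_of_map_eq {X : Lp ℝ 2 P} {v : ℝ≥0} (hX : P.map X = gaussianReal 0 v)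
    (t : ℝ) : Integrable (fun ω => Real.exp (t * |X ω|)) P := by
  have h : ∀ t : ℝ, Integrable (fun ω => Real.exp (t * X ω)) P := by
    intro t
    have h := integrable_exp_mul_gaussianReal (μ := 0) (v := v) t
    rw [← hX, integrable_map_measure (by fun_prop) (Lp.aestronglyMeasurable X).aemeasurable] at h
    exact h
  exact integrable_exp_mul_abs (h t) (h (-t))

/-- Conditioning on `X` replaces `H_n(Y)` by `k ^ n H_n(X)` (Mehler), which reduces orthogonality to
one dimension. -/
lemma inner_hermite_eq_zero (hG : ∀ X ∈ G, P.map X = gaussianReal 0 (‖X‖₊ ^ 2))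
    {m n : ℕ} (hmn : m ≠ n) {X Y Z W : Lp ℝ 2 P} (hX : X ∈ G) (hY : Y ∈ G) (hX1 : ‖X‖ = 1)
    (hY1 : ‖Y‖ = 1) (hZ : Z =ᵐ[P] fun ω => (hermiteReal m).eval (X ω))
    (hW : W =ᵐ[P] fun ω => (hermiteReal n).eval (Y ω)) : inner ℝ Z W = 0 := by
  obtain ⟨k, c, hk, hc, h⟩ := exists_integral_eq hG hX hY
  rw [hX1] at h
  rw [hY1, one_pow] at hc
  have hae : (fun ω => Z ω * W ω) =ᵐ[P]
      fun ω => (hermiteReal m).eval (X ω) * (hermiteReal n).eval (Y ω) := by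
    filter_upwards [hZ, hW] with ω h1 h2
    rw [h1, h2]
  rw [inner_eq_integral_mul, integral_congr_ae hae, h (fun x => (hermiteReal m).eval x)
    (fun x => (hermiteReal n).eval x) (by fun_prop) (by fun_prop)
    ((integrable_Lp_mul _ _).congr hae)]
  simp only [integral_hermiteReal_add hc, one_mul]
  have h2 : ∀ x, (hermiteReal m).eval x * (k ^ n * (hermiteReal n).eval x) =
      k ^ n * ((hermiteReal m).eval x * (hermiteReal n).eval x) := fun x => by ring
  simp only [h2]
  rw [integral_const_mul, integral_hermiteReal_mul_hermiteReal hmn, mul_zero]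

lemma integral_mul_polynomial_eq_zero {X g : Lp ℝ 2 P} {v : ℝ≥0}
    (hX : P.map X = gaussianReal 0 v)
    (hg : ∀ n, ∫ ω, g ω * (hermiteReal n).eval (X ω) ∂P = 0) (p : Polynomial ℝ) :
    ∫ ω, g ω * p.eval (X ω) ∂P = 0 := by
  have hspan := Polynomial.Sequence.span ⟨hermiteReal, degree_hermiteReal⟩ fun i => by
    have h : (hermiteReal i).leadingCoeff ≠ 0 := by
      rw [Polynomial.leadingCoeff_ne_zero, ← Polynomial.degree_ne_bot, degree_hermiteReal]
      exact WithBot.natCast_ne_bot i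
    exact h.isUnit
  have hp : p ∈ Submodule.span ℝ (Set.range hermiteReal) := by
    have := Submodule.mem_top (R := ℝ) (x := p)
    rwa [← hspan] at this
  have hint : ∀ q : Polynomial ℝ, Integrable (fun ω => g ω * q.eval (X ω)) P := fun q =>
    (Lp.memLp g).integrable_mul (memLp_comp_of_map_eq hX q)
  induction hp using Submodule.span_induction with
  | mem q hq =>
    obtain ⟨n, rfl⟩ := hq
    exact hg n
  | zero => simp
  | add q r _ _ h1 h2 =>
    simp only [Polynomial.eval_add, mul_add]
    rw [integral_add (hint q) (hint r), h1, h2, add_zero]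
  | smul a q _ h1 =>
    simp only [Polynomial.eval_smul, smul_eq_mul, mul_left_comm _ a]
    rw [integral_const_mul, h1, mul_zero]

/-- The exponential series of `i ξ X` may be integrated term by term against `g`: it is dominated by
`|g| exp (|ξ| |X|)`, integrable since Gaussian variables have all exponential moments. Each term is
a monomial in `X`, hence contributes nothing; the sine is the imaginary part. -/
lemma integral_mul_sin_eq_zero {X g : Lp ℝ 2 P} {v : ℝ≥0} (hX : P.map X = gaussianReal 0 v)
    (hg : ∀ n, ∫ ω, g ω * (hermiteReal n).eval (X ω) ∂P = 0) (ξ : ℝ) :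
    ∫ ω, g ω * Real.sin (ξ * X ω) ∂P = 0 := by
  have hgm := (Lp.aestronglyMeasurable g).aemeasurable
  have hXm := (Lp.aestronglyMeasurable X).aemeasurable
  have hexp : MemLp (fun ω => Real.exp (|ξ| * |X ω|)) 2 P := by
    rw [memLp_two_iff_integrable_sq (AEMeasurable.aestronglyMeasurable (by fun_prop))]
    have := integrable_exp_mul_abs_of_map_eq hX (2 * |ξ|)
    refine this.congr (.of_forall fun ω => ?_)
    simp only
    rw [sq, ← Real.exp_add]
    ring_nf
  have hrexp : ∀ x : ℝ, HasSum (fun n : ℕ => x ^ n / n.factorial) (Real.exp x) := fun x => by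
    have := NormedSpace.expSeries_div_hasSum_exp x
    rwa [← Real.exp_eq_exp_ℝ] at this
  have hcexp : ∀ x : ℂ, HasSum (fun n : ℕ => x ^ n / n.factorial) (Complex.exp x) := fun x => by
    have := NormedSpace.expSeries_div_hasSum_exp x
    rwa [← Complex.exp_eq_exp_ℂ] at this
  have hb : ∀ ω, HasSum (fun n : ℕ => |g ω| * ((|ξ| * |X ω|) ^ n / n.factorial))
      (|g ω| * Real.exp (|ξ| * |X ω|)) := fun ω => (hrexp _).mul_left _
  have key := hasSum_integral_of_dominated_convergence (μ := P)
    (F := fun (n : ℕ) ω => (g ω : ℂ) * ((ξ * X ω * Complex.I) ^ n / n.factorial))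
    (f := fun ω => (g ω : ℂ) * Complex.exp (ξ * X ω * Complex.I))
    (fun n ω => |g ω| * ((|ξ| * |X ω|) ^ n / n.factorial))
    (fun n => AEMeasurable.aestronglyMeasurable (by fun_prop))
    (fun n => .of_forall fun ω => by simp)
    (.of_forall fun ω => (hb ω).summable)
    (by
      simp only [fun ω => (hb ω).tsum_eq]
      exact (Lp.memLp g).abs.integrable_mul hexp)
    (.of_forall fun ω => (hcexp _).mul_left _)
  have hzero : ∀ n : ℕ, ∫ ω, (g ω : ℂ) * ((ξ * X ω * Complex.I) ^ n / n.factorial) ∂P = 0 := by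
    intro n
    have h1 : ∀ ω, (g ω : ℂ) * ((ξ * X ω * Complex.I) ^ n / n.factorial) =
        ((ξ * Complex.I) ^ n / n.factorial) *
          ((g ω * ((Polynomial.X : Polynomial ℝ) ^ n).eval (X ω) : ℝ) : ℂ) := by
      intro ω
      simp only [Polynomial.eval_pow, Polynomial.eval_X]
      push_cast
      ring
    simp only [h1]
    rw [integral_const_mul, integral_complex_ofReal, integral_mul_polynomial_eq_zero hX hg]
    simp
  have h0 : ∫ ω, (g ω : ℂ) * Complex.exp (ξ * X ω * Complex.I) ∂P = 0 := by
    simp only [hzero] at key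
    exact key.unique hasSum_zero
  have hint : Integrable (fun ω => (g ω : ℂ) * Complex.exp (ξ * X ω * Complex.I)) P := by
    refine (Lp_two_integrable g).ofReal.mul_bdd (c := 1)
      (AEMeasurable.aestronglyMeasurable (by fun_prop)) (.of_forall fun ω => ?_)
    rw [← Complex.ofReal_mul, Complex.norm_exp_ofReal_mul_I]
  have h2 := integral_im hint
  rw [h0, map_zero] at h2
  rw [← h2]
  refine integral_congr_ae (.of_forall fun ω => ?_)
  simp only [RCLike.im_eq_complex_im]
  rw [Complex.im_ofReal_mul, ← Complex.ofReal_mul, Complex.exp_ofReal_mul_I_im]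

lemma integral_mul_deriv_heatKernel_eq_zero {X g : Lp ℝ 2 P} {v : ℝ≥0}
    (hX : P.map X = gaussianReal 0 v) (hg : ∀ n, ∫ ω, g ω * (hermiteReal n).eval (X ω) ∂P = 0)
    {ε : ℝ} (hε : 0 < ε) (a : ℝ) : ∫ ω, g ω * deriv (heatKernel ε) (a * X ω) ∂P = 0 := by
  have hgm := (Lp.aestronglyMeasurable g).aemeasurable
  have hXm := (Lp.aestronglyMeasurable X).aemeasurable
  simp only [heatKernel_deriv_eq_integral_sin hε]
  set C := -((√ε)⁻¹ * (√(2 * Real.pi * ε))⁻¹)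
  have h1 : ∀ ω, g ω * (C * ∫ y, y * Real.sin (y * (a * X ω / √ε)) ∂gaussianReal 0 1) =
      C * ∫ y, g ω * (y * Real.sin (y * (a * X ω / √ε))) ∂gaussianReal 0 1 := by
    intro ω
    rw [integral_const_mul]
    ring
  simp only [h1]
  rw [integral_const_mul, integral_integral_swap]
  · have h2 : ∀ y, ∫ ω, g ω * (y * Real.sin (y * (a * X ω / √ε))) ∂P = 0 := by
      intro y
      have h3 : ∀ ω, g ω * (y * Real.sin (y * (a * X ω / √ε))) =
          y * (g ω * Real.sin ((y * a / √ε) * X ω)) := by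
        intro ω
        rw [show y * (a * X ω / √ε) = y * a / √ε * X ω by ring]
        ring
      simp only [h3]
      rw [integral_const_mul, integral_mul_sin_eq_zero hX hg, mul_zero]
    simp only [h2, integral_zero, mul_zero]
  · have h4 : Integrable (fun p : Ω × ℝ => g p.1 * p.2) (P.prod (gaussianReal 0 1)) :=
      (Lp_two_integrable g).mul_prod (integrable_id_gaussianReal 0 1)
    have hX1 : AEMeasurable (fun p : Ω × ℝ => X p.1) (P.prod (gaussianReal 0 1)) := hXm.comp_fst
    have h5 := h4.mul_bdd (c := 1) (g := fun p : Ω × ℝ => Real.sin (p.2 * (a * X p.1 / √ε)))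
      (AEMeasurable.aestronglyMeasurable (by fun_prop)) (.of_forall fun p => Real.abs_sin_le_one _)
    refine h5.congr (.of_forall fun p => ?_)
    simp only [Function.uncurry]
    ring

end Gaussian

section Chaos

variable {H : ℝ} {B : ℝ≥0 → Ω → ℝ}

lemma mem_wienerChaos_of_ae_eq {n : ℕ} {X Y : Lp ℝ 2 P} (hX : X ∈ gaussianSpace B P)
    (hX1 : ‖X‖ = 1) (hY : Y =ᵐ[P] fun ω => (hermiteReal n).eval (X ω)) :
    Y ∈ wienerChaos B P n :=
  Submodule.le_topologicalClosure _ (Submodule.subset_span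
    ⟨X, hX, hX1, by simpa only [aeval_hermite] using hY⟩)

/-- Since `H_1(x) = x`, only the unit-norm constraint has to be removed, by scaling. -/
lemma wienerChaos_one : wienerChaos B P 1 = gaussianSpace B P := by
  refine le_antisymm (Submodule.topologicalClosure_minimal _ (Submodule.span_le.2 ?_)
    (Submodule.isClosed_topologicalClosure _)) ?_
  · rintro Y ⟨X, hX, -, hY⟩
    have : Y = X := Lp.ext (hY.trans (.of_forall fun ω => by simp))
    rwa [this]
  · intro X hX
    by_cases h0 : X = 0
    · rw [h0]; exact Submodule.zero_mem _
    · have hn : ‖X‖ ≠ 0 := norm_ne_zero_iff.2 h0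
      have : X = ‖X‖ • (‖X‖⁻¹ • X) := by rw [smul_smul, mul_inv_cancel₀ hn, one_smul]
      rw [this]
      refine Submodule.smul_mem _ _ (mem_wienerChaos_of_ae_eq (X := ‖X‖⁻¹ • X)
        (Submodule.smul_mem _ _ hX) ?_ (.of_forall fun ω => by simp [hermiteReal_one]))
      rw [norm_smul, norm_inv, norm_norm, inv_mul_cancel₀ hn]

lemma IsFractionalBrownianMotion.wienerChaos_isOrtho (hB : IsFractionalBrownianMotion H B P)
    {m n : ℕ} (hmn : m ≠ n) : wienerChaos B P m ⟂ wienerChaos B P n := by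
  have h : Submodule.span ℝ {Y : Lp ℝ 2 P | ∃ X ∈ gaussianSpace B P, ‖X‖ = 1 ∧
      Y =ᵐ[P] fun ω => Polynomial.aeval (X ω) (Polynomial.hermite m)} ⟂
      Submodule.span ℝ {Y : Lp ℝ 2 P | ∃ X ∈ gaussianSpace B P, ‖X‖ = 1 ∧
        Y =ᵐ[P] fun ω => Polynomial.aeval (X ω) (Polynomial.hermite n)} := by
    rw [Submodule.isOrtho_span]
    rintro Z ⟨X, hX, hX1, hZ⟩ W ⟨Y, hY, hY1, hW⟩
    simp only [aeval_hermite] at hZ hW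
    exact inner_hermite_eq_zero (fun X hX => hB.map_eq_gaussianReal hX) hmn hX hY hX1 hY1 hZ hW
  refine Submodule.topologicalClosure_minimal _ ?_ (Submodule.isClosed_orthogonal _)
  refine Submodule.isOrtho_iff_le.1 (Submodule.IsOrtho.symm ?_)
  exact Submodule.topologicalClosure_minimal _ (Submodule.isOrtho_iff_le.1 h.symm)
    (Submodule.isClosed_orthogonal _)

/-- Closures are double orthogonal complements, so it suffices to test against `g` orthogonal to all
chaoses. Such a `g` is orthogonal to every Hermite polynomial in the normalized variable `X / ‖X‖`.
-/
lemma IsFractionalBrownianMotion.kernelLp_mem (hB : IsFractionalBrownianMotion H B P) {ε : ℝ}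
    (hε : 0 < ε) {X : Lp ℝ 2 P} (hX : X ∈ gaussianSpace B P) :
    kernelLp ε X ∈ (⨆ n, wienerChaos B P n).topologicalClosure := by
  by_cases h0 : X = 0
  · have : kernelLp ε X = 0 := by
      refine Lp.ext ((coeFn_kernelLp ε X).trans ?_)
      rw [h0]
      filter_upwards [Lp.coeFn_zero ℝ 2 P] with ω h
      rw [h, Pi.zero_apply, deriv_heatKernel_zero]
    rw [this]
    exact Submodule.zero_mem _
  · rw [← Submodule.orthogonal_orthogonal_eq_closure]
    intro g hg
    have hn : ‖X‖ ≠ 0 := norm_ne_zero_iff.2 h0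
    set Y := ‖X‖⁻¹ • X with hYdef
    have hY : Y ∈ gaussianSpace B P := Submodule.smul_mem _ _ hX
    have hY1 : ‖Y‖ = 1 := by rw [hYdef, norm_smul, norm_inv, norm_norm, inv_mul_cancel₀ hn]
    have hYl := hB.map_eq_gaussianReal hY
    have hgY : ∀ n, ∫ ω, g ω * (hermiteReal n).eval (Y ω) ∂P = 0 := by
      intro n
      have hm := memLp_comp_of_map_eq hYl (hermiteReal n)
      have h1 : inner ℝ (hm.toLp _) g = 0 :=
        hg _ (Submodule.mem_iSup_of_mem n (mem_wienerChaos_of_ae_eq hY hY1 hm.coeFn_toLp))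
      rw [real_inner_comm, inner_eq_integral_mul] at h1
      rw [← h1]
      refine integral_congr_ae ?_
      filter_upwards [hm.coeFn_toLp] with ω h
      rw [h]
    rw [inner_eq_integral_mul, ← integral_mul_deriv_heatKernel_eq_zero hYl hgY hε ‖X‖]
    refine integral_congr_ae ?_
    filter_upwards [coeFn_kernelLp ε X, Lp.coeFn_smul ‖X‖⁻¹ X] with ω h1 h2
    rw [h1, hYdef, h2, Pi.smul_apply, smul_eq_mul, mul_inv_cancel_left₀ hn]

/-- By `inner_kernelLp_left`, pairing `p_ε'(X)` with an element `Y` of the Gaussian space gives a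
fixed multiple of `⟨X, Y⟩`; the projection is that multiple of `X`. -/
lemma IsFractionalBrownianMotion.chaosProj_one_kernelLp (hB : IsFractionalBrownianMotion H B P)
    {ε : ℝ} (hε : 0 < ε) {X : Lp ℝ 2 P} (hX : X ∈ gaussianSpace B P) :
    chaosProj B P 1 (kernelLp ε X) =
      (-(√(2 * Real.pi))⁻¹ * (ε + ‖X‖ ^ 2) ^ (-(3 / 2) : ℝ)) • X := by
  refine Submodule.eq_starProjection_of_mem_of_inner_eq_zero ?_ ?_
  · rw [wienerChaos_one]; exact Submodule.smul_mem _ _ hX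
  · intro Y hY
    rw [wienerChaos_one] at hY
    rw [inner_sub_left, inner_kernelLp_left (fun X hX => hB.map_eq_gaussianReal hX) hε hX hY,
      real_inner_smul_left]
    ring

lemma IsFractionalBrownianMotion.chaosProj_zero_kernelLp (hB : IsFractionalBrownianMotion H B P)
    {ε : ℝ} (hε : 0 < ε) {X : Lp ℝ 2 P} (hX : X ∈ gaussianSpace B P) :
    chaosProj B P 0 (kernelLp ε X) = 0 := by
  refine Submodule.eq_starProjection_of_mem_of_inner_eq_zero (Submodule.zero_mem _) ?_
  rw [sub_zero]
  intro Y hY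
  suffices h : wienerChaos B P 0 ≤ (Submodule.span ℝ {kernelLp ε X})ᗮ from
    Submodule.mem_orthogonal_singleton_iff_inner_right.1 (h hY)
  refine Submodule.topologicalClosure_minimal _ (Submodule.span_le.2 ?_)
    (Submodule.isClosed_orthogonal _)
  rintro Z ⟨_, _, _, hZ⟩
  rw [SetLike.mem_coe, Submodule.mem_orthogonal_singleton_iff_inner_right, inner_eq_integral_mul,
    ← integral_kernelLp (fun X hX => hB.map_eq_gaussianReal hX) hε hX]
  refine integral_congr_ae ?_
  filter_upwards [hZ] with ω h
  rw [h]
  simp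

end Chaos

end

/-! ### `α_ε` as a Bochner integral in `L²` over the triangle -/

section

lemma integral_mem_submodule {α E : Type*} [MeasurableSpace α] {μ : Measure α}
    [NormedAddCommGroup E] [InnerProductSpace ℝ E] [CompleteSpace E] (V : Submodule ℝ E)
    [V.HasOrthogonalProjection] {f : α → E} (hf : Integrable f μ) (h : ∀ x, f x ∈ V) :
    ∫ x, f x ∂μ ∈ V := by
  rw [← Submodule.starProjection_eq_self_iff, ← ContinuousLinearMap.integral_comp_comm _ hf]
  exact integral_congr_ae (.of_forall fun x => Submodule.starProjection_eq_self_iff.2 (h x))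

/-- The open region `0 < s < t ≤ T`, in the variables `(t, s)`. -/
def triangle (T : ℝ) : Set (ℝ × ℝ) := {x | 0 < x.2 ∧ x.2 < x.1 ∧ x.1 ≤ T}

lemma measurableSet_triangle (T : ℝ) : MeasurableSet (triangle T) :=
  (measurableSet_lt measurable_const measurable_snd).inter
    ((measurableSet_lt measurable_snd measurable_fst).inter
      (measurableSet_le measurable_fst measurable_const))

lemma triangle_subset (T : ℝ) : triangle T ⊆ Set.Icc 0 T ×ˢ Set.Icc 0 T := by
  rintro ⟨t, s⟩ ⟨h1, h2, h3⟩
  simp only at h1 h2 h3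
  exact ⟨⟨by simp only; linarith, h3⟩, ⟨h1.le, by simp only; linarith⟩⟩

instance (T : ℝ) : IsFiniteMeasure ((volume : Measure (ℝ × ℝ)).restrict (triangle T)) :=
  ⟨by
    rw [Measure.restrict_apply_univ]
    exact (measure_mono (triangle_subset T)).trans_lt
      (isCompact_Icc.prod isCompact_Icc).measure_lt_top⟩

lemma _root_.Continuous.integrableOn_triangle {E : Type*} [NormedAddCommGroup E] {f : ℝ × ℝ → E}
    (hf : Continuous f) (T : ℝ) : IntegrableOn f (triangle T) :=
  (hf.continuousOn.integrableOn_compact (isCompact_Icc.prod isCompact_Icc)).mono_set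
    (triangle_subset T)

lemma integral_triangle {E : Type*} [NormedAddCommGroup E] [NormedSpace ℝ E] {T : ℝ} (hT : 0 ≤ T)
    {g : ℝ × ℝ → E} (hg : IntegrableOn g (triangle T)) :
    ∫ t in (0 : ℝ)..T, ∫ s in (0 : ℝ)..t, g (t, s) = ∫ x in triangle T, g x := by
  have hg' := (integrable_indicator_iff (measurableSet_triangle T)).2 hg
  rw [← integral_indicator (measurableSet_triangle T), Measure.volume_eq_prod]
  rw [Measure.volume_eq_prod] at hg'
  rw [integral_prod _ hg', intervalIntegral.integral_of_le hT,
    ← integral_indicator measurableSet_Ioc]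
  refine integral_congr_ae (.of_forall fun t => ?_)
  simp only
  classical
  by_cases ht : t ∈ Set.Ioc 0 T
  · rw [Set.indicator_of_mem ht, intervalIntegral.integral_of_le ht.1.le,
      integral_Ioc_eq_integral_Ioo, ← integral_indicator measurableSet_Ioo]
    refine integral_congr_ae (.of_forall fun s => ?_)
    simp only [Set.indicator_apply]
    refine if_congr ?_ rfl rfl
    simp [triangle, ht.2]
  · rw [Set.indicator_of_notMem ht]
    symm
    refine integral_eq_zero_of_ae (.of_forall fun s => ?_)
    refine Set.indicator_of_notMem ?_ _
    rintro ⟨h1, h2, h3⟩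
    exact ht ⟨h1.trans h2, h3⟩

variable {Ω : Type*} [MeasurableSpace Ω] {P : Measure Ω} [IsProbabilityMeasure P]

/-- The Bochner integral in `L²` of a bounded process is its pathwise integral. -/
lemma integral_Lp_ae_eq {X : Type*} [MeasurableSpace X] {μ : Measure X} [IsFiniteMeasure μ]
    {F : X → Lp ℝ 2 P} (hF : Integrable F μ) {f : X × Ω → ℝ}
    (hf : AEStronglyMeasurable f (μ.prod P)) {C : ℝ} (hC : ∀ z, ‖f z‖ ≤ C)
    (hFf : ∀ᵐ x ∂μ, F x =ᵐ[P] fun ω => f (x, ω)) :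
    (∫ x, F x ∂μ : Lp ℝ 2 P) =ᵐ[P] fun ω => ∫ x, f (x, ω) ∂μ := by
  have hfi : Integrable f (μ.prod P) := .of_bound hf C (.of_forall hC)
  have hu : MemLp (fun ω => ∫ x, f (x, ω) ∂μ) 2 P :=
    MemLp.of_bound hfi.integral_prod_right.aestronglyMeasurable (C * μ.real Set.univ)
      (.of_forall fun ω => norm_integral_le_of_norm_le_const (.of_forall fun x => hC _))
  suffices h : ∫ x, F x ∂μ = hu.toLp _ by rw [h]; exact hu.coeFn_toLp
  -- Both sides are compared by testing against an arbitrary `g` in `L²`, where the identity becomes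
  -- Fubini's theorem.
  refine ext_inner_right ℝ fun g => ?_
  rw [real_inner_comm, ← integral_inner hF, real_inner_comm, inner_eq_integral_mul]
  have h1 : ∫ ω, g ω * hu.toLp _ ω ∂P = ∫ ω, ∫ x, g ω * f (x, ω) ∂μ ∂P := by
    refine integral_congr_ae ?_
    filter_upwards [hu.coeFn_toLp] with ω hω
    rw [hω, integral_const_mul]
  have h2 : ∫ x, inner ℝ g (F x) ∂μ = ∫ x, ∫ ω, g ω * f (x, ω) ∂P ∂μ := by
    refine integral_congr_ae ?_
    filter_upwards [hFf] with x hx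
    rw [inner_eq_integral_mul]
    refine integral_congr_ae ?_
    filter_upwards [hx] with ω hω
    rw [hω]
  rw [h1, h2, integral_integral_swap]
  have h3 : Integrable (fun z : X × Ω => g z.2) (μ.prod P) := (Lp_two_integrable g).comp_snd μ
  exact h3.mul_bdd hf (.of_forall hC)

section fBm

variable {H : ℝ} {B : ℝ≥0 → Ω → ℝ}

lemma IsFractionalBrownianMotion.norm_toL2_sub (hB : IsFractionalBrownianMotion H B P) (hH : 0 < H)
    (s t : ℝ≥0) : ‖hB.toL2 t - hB.toL2 s‖ ^ 2 = |(t : ℝ) - s| ^ (2 * H) := by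
  have h0 : ∀ t : ℝ≥0, ‖hB.toL2 t‖ ^ 2 = (t : ℝ) ^ (2 * H) := by
    intro t
    rw [← real_inner_self_eq_norm_sq, hB.inner_toL2, sub_self, abs_zero,
      Real.zero_rpow (by linarith)]
    ring
  rw [norm_sub_sq_real, h0, h0, hB.inner_toL2]
  ring

lemma IsFractionalBrownianMotion.norm_toL2_sub' (hB : IsFractionalBrownianMotion H B P)
    (hH : 0 < H) (s t : ℝ≥0) : ‖hB.toL2 t - hB.toL2 s‖ = |(t : ℝ) - s| ^ H := by
  rw [← Real.sqrt_sq (norm_nonneg _), hB.norm_toL2_sub hH, mul_comm, Real.rpow_mul (abs_nonneg _),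
    Real.rpow_two, Real.sqrt_sq (by positivity)]

lemma IsFractionalBrownianMotion.toL2_zero (hB : IsFractionalBrownianMotion H B P)
    (hH : 0 < H) : hB.toL2 0 = 0 := by
  rw [← norm_eq_zero, ← sq_eq_zero_iff, ← real_inner_self_eq_norm_sq, hB.inner_toL2]
  simp [Real.zero_rpow (by linarith : 2 * H ≠ 0)]

lemma IsFractionalBrownianMotion.continuous_toL2 (hB : IsFractionalBrownianMotion H B P)
    (hH : 0 < H) : Continuous hB.toL2 := by
  rw [continuous_iff_continuousAt]
  intro s
  rw [ContinuousAt, tendsto_iff_norm_sub_tendsto_zero]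
  simp only [hB.norm_toL2_sub' hH]
  have : Continuous fun t : ℝ≥0 => |(t : ℝ) - s| ^ H := by
    refine Continuous.rpow_const (by fun_prop) fun _ => .inr hH.le
  have h := this.tendsto s
  simpa [Real.zero_rpow hH.ne'] using h

/-- The increment `B_t - B_s` in `L²` at `x = (t, s)`. -/
def IsFractionalBrownianMotion.incr (hB : IsFractionalBrownianMotion H B P) (x : ℝ × ℝ) :
    Lp ℝ 2 P := hB.toL2 x.1.toNNReal - hB.toL2 x.2.toNNReal

lemma IsFractionalBrownianMotion.incr_mem (hB : IsFractionalBrownianMotion H B P) (x : ℝ × ℝ) :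
    hB.incr x ∈ gaussianSpace B P := Submodule.sub_mem _ (hB.toL2_mem _) (hB.toL2_mem _)

lemma IsFractionalBrownianMotion.continuous_incr (hB : IsFractionalBrownianMotion H B P)
    (hH : 0 < H) : Continuous hB.incr := by
  have := hB.continuous_toL2 hH
  have := continuous_real_toNNReal
  unfold incr
  fun_prop

lemma IsFractionalBrownianMotion.coeFn_incr (hB : IsFractionalBrownianMotion H B P) (x : ℝ × ℝ) :
    hB.incr x =ᵐ[P] fun ω => B x.1.toNNReal ω - B x.2.toNNReal ω := by
  filter_upwards [Lp.coeFn_sub (hB.toL2 x.1.toNNReal) (hB.toL2 x.2.toNNReal),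
    hB.coeFn_toL2 x.1.toNNReal, hB.coeFn_toL2 x.2.toNNReal] with ω h1 h2 h3
  rw [incr, h1, Pi.sub_apply, h2, h3]

lemma IsFractionalBrownianMotion.norm_incr_sq (hB : IsFractionalBrownianMotion H B P) (hH : 0 < H)
    {T : ℝ} {x : ℝ × ℝ} (hx : x ∈ triangle T) :
    ‖hB.incr x‖ ^ 2 = (x.1 - x.2) ^ (2 * H) := by
  obtain ⟨h1, h2, -⟩ := hx
  rw [incr, hB.norm_toL2_sub hH, Real.coe_toNNReal _ h1.le, Real.coe_toNNReal _ (h1.trans h2).le,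
    abs_of_pos (sub_pos.2 h2)]

lemma IsFractionalBrownianMotion.inner_incr (hB : IsFractionalBrownianMotion H B P)
    {T : ℝ} {x y : ℝ × ℝ} (hx : x ∈ triangle T) (hy : y ∈ triangle T) :
    inner ℝ (hB.incr x) (hB.incr y) = incCov H x.1 x.2 y.1 y.2 := by
  obtain ⟨h1, h2, -⟩ := hx
  obtain ⟨h3, h4, -⟩ := hy
  simp only [incr, inner_sub_left, inner_sub_right, hB.inner_toL2, Real.coe_toNNReal _ h1.le,
    Real.coe_toNNReal _ h3.le, Real.coe_toNNReal _ (h1.trans h2).le,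
    Real.coe_toNNReal _ (h3.trans h4).le, incCov]
  rw [abs_sub_comm x.2 y.1]
  ring

/-- The class of `α_ε` in `L²`. -/
def IsFractionalBrownianMotion.alphaLp (hB : IsFractionalBrownianMotion H B P) (T ε : ℝ) :
    Lp ℝ 2 P := ∫ x in triangle T, kernelLp ε (hB.incr x)

lemma IsFractionalBrownianMotion.integrableOn_kernelLp (hB : IsFractionalBrownianMotion H B P)
    (hH : 0 < H) (T ε : ℝ) : IntegrableOn (fun x => kernelLp ε (hB.incr x)) (triangle T) :=
  ((continuous_kernelLp ε).comp (hB.continuous_incr hH)).integrableOn_triangle T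

/-- Joint measurability of `B` holds only up to a null set, so it is pulled back along the two time
coordinates as quasi-measure-preserving maps. -/
lemma IsFractionalBrownianMotion.aemeasurable_increment (hB : IsFractionalBrownianMotion H B P)
    (T : ℝ) : AEMeasurable (fun z : (ℝ × ℝ) × Ω => B z.1.1.toNNReal z.2 - B z.1.2.toNNReal z.2)
      ((volume.restrict (triangle T)).prod P) := by
  have hle : (volume : Measure (ℝ × ℝ)).restrict (triangle T) ≤
      (volume.restrict (Set.Ici (0 : ℝ))).prod (volume.restrict (Set.Ici (0 : ℝ))) := by
    rw [Measure.prod_restrict, ← Measure.volume_eq_prod]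
    refine Measure.restrict_mono_set _ fun x hx => ?_
    exact ⟨(triangle_subset T hx).1.1, (triangle_subset T hx).2.1⟩
  have h1 : Measure.QuasiMeasurePreserving Prod.fst ((volume : Measure (ℝ × ℝ)).restrict
      (triangle T)) (volume.restrict (Set.Ici (0 : ℝ))) :=
    Measure.quasiMeasurePreserving_fst.mono_left hle.absolutelyContinuous
  have h2 : Measure.QuasiMeasurePreserving Prod.snd ((volume : Measure (ℝ × ℝ)).restrict
      (triangle T)) (volume.restrict (Set.Ici (0 : ℝ))) :=
    Measure.quasiMeasurePreserving_snd.mono_left hle.absolutelyContinuous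
  have hid : Measure.QuasiMeasurePreserving (id : Ω → Ω) P P := .id P
  exact (hB.aemeasurable.comp_quasiMeasurePreserving (QuasiMeasurePreserving.prodMap h1 hid)).sub
    (hB.aemeasurable.comp_quasiMeasurePreserving (QuasiMeasurePreserving.prodMap h2 hid))

lemma IsFractionalBrownianMotion.coeFn_alphaLp (hB : IsFractionalBrownianMotion H B P)
    (hH : 0 < H) {T ε : ℝ} (hT : 0 ≤ T) (hε : 0 < ε) : hB.alphaLp T ε =ᵐ[P] alpha B T ε := by
  set f : (ℝ × ℝ) × Ω → ℝ :=
    fun z => deriv (heatKernel ε) (B z.1.1.toNNReal z.2 - B z.1.2.toNNReal z.2) with hfdef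
  have hf : AEStronglyMeasurable f ((volume.restrict (triangle T)).prod P) :=
    ((measurable_deriv_heatKernel ε).comp_aemeasurable
      (hB.aemeasurable_increment T)).aestronglyMeasurable
  have hC : ∀ z, ‖f z‖ ≤ 3 * (√(2 * Real.pi * ε))⁻¹ * (√ε)⁻¹ :=
    fun z => abs_deriv_heatKernel_le hε _
  have h1 := integral_Lp_ae_eq (hB.integrableOn_kernelLp hH T ε) hf hC
    (.of_forall fun x => by
      filter_upwards [coeFn_kernelLp ε (hB.incr x), hB.coeFn_incr x] with ω h1 h2
      rw [h1, h2])
  have hfi : Integrable f ((volume.restrict (triangle T)).prod P) := .of_bound hf _ (.of_forall hC)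
  filter_upwards [h1, hfi.prod_left_ae] with ω h2 h3
  rw [alphaLp, h2, alpha, ← integral_triangle hT h3]

lemma alpha_of_nonpos {T ε : ℝ} (hε : ε ≤ 0) : alpha B T ε = 0 := by
  ext ω
  have : deriv (heatKernel ε) = fun _ => 0 := by
    rw [heatKernel_of_nonpos hε]; ext; simp
  simp [alpha, this]

lemma IsFractionalBrownianMotion.aemeasurable_alpha (hB : IsFractionalBrownianMotion H B P)
    (hH : 0 < H) {T : ℝ} (hT : 0 ≤ T) (ε : ℝ) : AEMeasurable (alpha B T ε) P := by
  rcases le_or_gt ε 0 with hε | hε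
  · rw [alpha_of_nonpos hε]; exact aemeasurable_const
  · exact (Lp.aestronglyMeasurable _).aemeasurable.congr (hB.coeFn_alphaLp hH hT hε)

lemma IsFractionalBrownianMotion.chaosProj_alphaLp (hB : IsFractionalBrownianMotion H B P)
    (hH : 0 < H) (T ε : ℝ) (n : ℕ) :
    chaosProj B P n (hB.alphaLp T ε) =
      ∫ x in triangle T, chaosProj B P n (kernelLp ε (hB.incr x)) :=
  (ContinuousLinearMap.integral_comp_comm _ (hB.integrableOn_kernelLp hH T ε)).symm

lemma IsFractionalBrownianMotion.chaosProj_zero_alphaLp (hB : IsFractionalBrownianMotion H B P)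
    (hH : 0 < H) (T : ℝ) {ε : ℝ} (hε : 0 < ε) : chaosProj B P 0 (hB.alphaLp T ε) = 0 := by
  rw [hB.chaosProj_alphaLp hH]
  simp [hB.chaosProj_zero_kernelLp hε (hB.incr_mem _)]

/-- Membership in the closed span of the chaoses passes from the integrand to the integral. The
shift by `2` removes `J_1` together with `J_0`, which is zero because `p_ε'(X)` has mean zero. -/
lemma IsFractionalBrownianMotion.hasSum_chaosProj_alphaLp (hB : IsFractionalBrownianMotion H B P)
    (hH : 0 < H) (T : ℝ) {ε : ℝ} (hε : 0 < ε) :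
    HasSum (fun q => chaosProj B P (q + 2) (hB.alphaLp T ε))
      (hB.alphaLp T ε - chaosProj B P 1 (hB.alphaLp T ε)) := by
  have hmem : hB.alphaLp T ε ∈ (⨆ n, wienerChaos B P n).topologicalClosure := by
    have : CompleteSpace (⨆ n, wienerChaos B P n).topologicalClosure :=
      (Submodule.isClosed_topologicalClosure _).completeSpace_coe
    exact integral_mem_submodule _ (hB.integrableOn_kernelLp hH T ε)
      fun x => hB.kernelLp_mem hε (hB.incr_mem x)
  have h := hasSum_starProjection_of_mem_closure (wienerChaos B P)
    (fun m n hmn => hB.wienerChaos_isOrtho hmn) hmem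
  have h2 := (hasSum_nat_add_iff' 2).2 h
  have h0 := hB.chaosProj_zero_alphaLp hH T hε
  simp only [chaosProj] at h0 ⊢
  simpa [Finset.sum_range_succ, h0] using h2

lemma IsFractionalBrownianMotion.hasLaw_chaosProj_one (hB : IsFractionalBrownianMotion H B P)
    (X : Lp ℝ 2 P) :
    HasLaw (chaosProj B P 1 X) (gaussianReal 0 (‖chaosProj B P 1 X‖₊ ^ 2)) P where
  aemeasurable := (Lp.aestronglyMeasurable _).aemeasurable
  map_eq := hB.map_eq_gaussianReal (by
    rw [← wienerChaos_one]; exact Submodule.starProjection_apply_mem _ _)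

end fBm

end

/-! ### Pointwise bounds for the covariance of the higher chaoses -/

section

lemma rpow_neg_three_halves_sub_one_le {x r : ℝ} (hx : 0 ≤ x) (hxr : x ≤ r) (hr : r < 1) :
    (1 - x) ^ (-(3 / 2) : ℝ) - 1 ≤ 2 / (1 - r) ^ 2 * x := by
  have hy : 0 < 1 - x := by linarith
  have h1 : (1 - x) ^ (-(3 / 2) : ℝ) ≤ (1 - x) ^ (-2 : ℝ) :=
    Real.rpow_le_rpow_of_exponent_ge hy (by linarith) (by norm_num)
  have h2 : (1 - x) ^ (-2 : ℝ) = ((1 - x) ^ 2)⁻¹ := by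
    rw [Real.rpow_neg hy.le]; norm_cast
  have h3 : ((1 - x) ^ 2)⁻¹ - 1 ≤ ((1 - x) ^ 2)⁻¹ * (2 * x) := by
    have h4 : ((1 - x) ^ 2)⁻¹ * (1 - x) ^ 2 = 1 := inv_mul_cancel₀ (by positivity)
    have h5 : 0 < ((1 - x) ^ 2)⁻¹ := by positivity
    nlinarith [mul_nonneg h5.le (sq_nonneg x)]
  have h6 : ((1 - x) ^ 2)⁻¹ * (2 * x) ≤ ((1 - r) ^ 2)⁻¹ * (2 * x) := by
    have : 0 < 1 - r := by linarith
    gcongr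
  calc _ ≤ ((1 - r) ^ 2)⁻¹ * (2 * x) := by linarith
    _ = _ := by ring

/-- Bound for the covariance of the chaoses of order at least two, for correlated increments. -/
lemma remainder_le_of_close {ε v₁ v₂ V μ A B c : ℝ} (hε : 0 < ε) (hv₁ : 0 ≤ v₁) (hv₂ : 0 ≤ v₂)
    (hV : 0 < V) (hvV : v₁ * v₂ = V ^ 2) (hμ : 0 ≤ μ) (hA : ε ≤ A) (hB : ε ≤ B)
    (hc : 0 < c) (hc1 : c ≤ 1 / 2) (hμV : μ ≤ V - c * (A - ε + (B - ε))) :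
    0 ≤ μ * (((ε + v₁) * (ε + v₂) - μ ^ 2) ^ (-(3 / 2) : ℝ) -
        ((ε + v₁) * (ε + v₂)) ^ (-(3 / 2) : ℝ)) ∧
      μ * (((ε + v₁) * (ε + v₂) - μ ^ 2) ^ (-(3 / 2) : ℝ) -
        ((ε + v₁) * (ε + v₂)) ^ (-(3 / 2) : ℝ)) ≤
      (2 * c) ^ (-(3 / 2) : ℝ) * (V ^ (-(1 / 2) : ℝ) * (A ^ (-(3 / 4) : ℝ) * B ^ (-(3 / 4) : ℝ))) := by
  have hA0 : 0 < A := hε.trans_le hA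
  have hB0 : 0 < B := hε.trans_le hB
  have hs : 2 * V ≤ v₁ + v₂ := by
    have : (2 * V) ^ 2 ≤ (v₁ + v₂) ^ 2 := by nlinarith [sq_nonneg (v₁ - v₂)]
    exact le_of_sq_le_sq this (by positivity)
  have hAB : 2 * (√A * √B) ≤ A + B := by
    nlinarith [sq_nonneg (√A - √B), Real.sq_sqrt hA0.le, Real.sq_sqrt hB0.le]
  have hμV' : μ ≤ V := hμV.trans (by nlinarith)
  -- By `v₁ + v₂ ≥ 2V` the determinant is at least `2εV + V(V - μ)`. The gap `V - μ` yields `c(A + B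
  -- - 2ε)`, the first term pays for the missing `2cε`, and the arithmetic-geometric mean inequality
  -- makes a product of functions of `A` and `B`.
  have hdet : 2 * c * V * (√A * √B) ≤ (ε + v₁) * (ε + v₂) - μ ^ 2 := by
    have h1 : (ε + v₁) * (ε + v₂) - μ ^ 2 ≥ 2 * ε * V + V * (V - μ) := by
      nlinarith [mul_le_mul_of_nonneg_left hs hε.le, mul_nonneg hμ (sub_nonneg.2 hμV')]
    have h2 : V * (c * (A - ε + (B - ε))) ≤ V * (V - μ) :=
      mul_le_mul_of_nonneg_left (by linarith) hV.le
    have h3 : 2 * c * V * (√A * √B) ≤ c * V * (A + B) := by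
      have := mul_le_mul_of_nonneg_left hAB (mul_pos hc hV).le
      linarith
    have h4 : c * (2 * ε * V) ≤ 2 * ε * V := by
      have : 0 < 2 * ε * V := by positivity
      nlinarith
    nlinarith
  have hD : 0 < 2 * c * V * (√A * √B) := by positivity
  constructor
  · refine mul_nonneg hμ (sub_nonneg.2 ?_)
    refine Real.rpow_le_rpow_of_nonpos (hD.trans_le hdet) (by nlinarith) (by norm_num)
  have h1 : ((ε + v₁) * (ε + v₂) - μ ^ 2) ^ (-(3 / 2) : ℝ) ≤
      (2 * c * V * (√A * √B)) ^ (-(3 / 2) : ℝ) :=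
    Real.rpow_le_rpow_of_nonpos hD hdet (by norm_num)
  have hsq : ∀ z : ℝ, 0 ≤ z → (√z) ^ (-(3 / 2) : ℝ) = z ^ (-(3 / 4) : ℝ) := by
    intro z hz
    rw [Real.sqrt_eq_rpow, ← Real.rpow_mul hz]
    norm_num
  have h2 : (2 * c * V * (√A * √B)) ^ (-(3 / 2) : ℝ) = (2 * c) ^ (-(3 / 2) : ℝ) *
      (V ^ (-(3 / 2) : ℝ) * (A ^ (-(3 / 4) : ℝ) * B ^ (-(3 / 4) : ℝ))) := by
    rw [Real.mul_rpow (x := 2 * c * V) (by positivity) (by positivity),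
      Real.mul_rpow (x := 2 * c) (by positivity) hV.le,
      Real.mul_rpow (x := √A) (by positivity) (by positivity), hsq A hA0.le, hsq B hB0.le]
    ring
  have h3 : V * V ^ (-(3 / 2) : ℝ) = V ^ (-(1 / 2) : ℝ) := by
    rw [mul_comm, ← Real.rpow_add_one hV.ne']; norm_num
  calc _ ≤ μ * ((ε + v₁) * (ε + v₂) - μ ^ 2) ^ (-(3 / 2) : ℝ) := by
        gcongr
        have : 0 ≤ ((ε + v₁) * (ε + v₂)) ^ (-(3 / 2) : ℝ) := by positivity
        linarith
    _ ≤ V * (2 * c * V * (√A * √B)) ^ (-(3 / 2) : ℝ) := by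
        gcongr
        exact Real.rpow_nonneg (hD.le.trans hdet) _
    _ = _ := by rw [h2, ← h3]; ring

/-- The bracket is of first order in `x = μ² / (a₁ a₂) ≤ r² < 1`. Weakening `x` to `x ^ (θ / 2)`
leaves the power `1 + θ` of `μ` adjustable, to be kept low enough for integrability in the distance.
-/
lemma remainder_le_of_far {a₁ a₂ V μ r θ : ℝ} (ha₁ : 0 < a₁) (ha₂ : 0 < a₂)
    (hV : V ^ 2 ≤ a₁ * a₂) (hμ : 0 ≤ μ) (hr : 0 ≤ r) (hr1 : r < 1) (hμV : μ ≤ r * V)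
    (hθ : 0 < θ) (hθ2 : θ ≤ 2) :
    0 ≤ μ * ((a₁ * a₂ - μ ^ 2) ^ (-(3 / 2) : ℝ) - (a₁ * a₂) ^ (-(3 / 2) : ℝ)) ∧
    μ * ((a₁ * a₂ - μ ^ 2) ^ (-(3 / 2) : ℝ) - (a₁ * a₂) ^ (-(3 / 2) : ℝ)) ≤
      2 / (1 - r ^ 2) ^ 2 * (μ ^ (1 + θ) * (a₁ ^ (-((3 + θ) / 2)) * a₂ ^ (-((3 + θ) / 2)))) := by
  set W := a₁ * a₂ with hW
  have hW0 : 0 < W := mul_pos ha₁ ha₂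
  set x := μ ^ 2 / W with hx
  have hx0 : 0 ≤ x := by positivity
  have hμ2 : μ ^ 2 ≤ r ^ 2 * W := by
    calc μ ^ 2 ≤ (r * V) ^ 2 := by gcongr
      _ = r ^ 2 * V ^ 2 := by ring
      _ ≤ _ := by gcongr
  have hxr : x ≤ r ^ 2 := by rw [hx, div_le_iff₀ hW0]; exact hμ2
  have hr2 : r ^ 2 < 1 := by nlinarith
  have hWx : W - μ ^ 2 = W * (1 - x) := by rw [hx]; field_simp
  have h1x : 0 < 1 - x := by linarith
  have hfac : μ * ((W - μ ^ 2) ^ (-(3 / 2) : ℝ) - W ^ (-(3 / 2) : ℝ)) =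
      μ * (W ^ (-(3 / 2) : ℝ) * ((1 - x) ^ (-(3 / 2) : ℝ) - 1)) := by
    rw [hWx, Real.mul_rpow hW0.le h1x.le]; ring
  rw [hfac]
  have hWp : 0 < W ^ (-(3 / 2) : ℝ) := Real.rpow_pos_of_pos hW0 _
  constructor
  · refine mul_nonneg hμ (mul_nonneg hWp.le (sub_nonneg.2 ?_))
    exact Real.one_le_rpow_of_pos_of_le_one_of_nonpos h1x (by linarith) (by norm_num)
  have h1 := rpow_neg_three_halves_sub_one_le hx0 hxr hr2
  have h2 : x ≤ x ^ (θ / 2) := by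
    rcases hx0.eq_or_lt with h | h
    · rw [← h, Real.zero_rpow (by positivity)]
    · have := Real.rpow_le_rpow_of_exponent_ge h (by linarith) (by linarith : θ / 2 ≤ 1)
      rwa [Real.rpow_one] at this
  have h3 : x ^ (θ / 2) = μ ^ θ * W ^ (-(θ / 2)) := by
    rw [hx, Real.div_rpow (by positivity) hW0.le, Real.rpow_neg hW0.le, ← Real.rpow_natCast,
      ← Real.rpow_mul hμ]
    push_cast
    rw [mul_div_cancel₀ θ (two_ne_zero)]
    rfl
  have h4 : μ * μ ^ θ = μ ^ (1 + θ) := by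
    rcases hμ.eq_or_lt with h | h
    · rw [← h, Real.zero_rpow (by positivity : 1 + θ ≠ 0)]; simp
    · rw [Real.rpow_add h, Real.rpow_one]
  have h5 : W ^ (-(3 / 2) : ℝ) * W ^ (-(θ / 2)) = a₁ ^ (-((3 + θ) / 2)) * a₂ ^ (-((3 + θ) / 2)) := by
    rw [← Real.rpow_add hW0, ← Real.mul_rpow ha₁.le ha₂.le]
    congr 1; ring
  have hC : 0 ≤ 2 / (1 - r ^ 2) ^ 2 := by positivity
  calc _ ≤ μ * (W ^ (-(3 / 2) : ℝ) * (2 / (1 - r ^ 2) ^ 2 * x ^ (θ / 2))) := by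
        gcongr
        exact h1.trans (by gcongr)
    _ = _ := by rw [h3, ← h4, ← h5]; ring

/-- The part of the remainder bound that is due to nearby pairs of increments. -/
def closeBound (H ε : ℝ) (x y : ℝ × ℝ) : ℝ :=
  ((x.1 - x.2) ^ (-H) + (y.1 - y.2) ^ (-H)) *
    ((ε + |x.1 - y.1| ^ (2 * H)) ^ (-(3 / 4) : ℝ) * (ε + |x.2 - y.2| ^ (2 * H)) ^ (-(3 / 4) : ℝ))

/-- The part of the remainder bound that is due to distant pairs of increments. -/
def farBound (H ε : ℝ) (x y : ℝ × ℝ) : ℝ :=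
  (x.1 - x.2) ^ (3 * H / 2) * (ε + (x.1 - x.2) ^ (2 * H)) ^ (-(1 + 3 * H / 4)) *
    ((y.1 - y.2) ^ (3 * H / 2) * (ε + (y.1 - y.2) ^ (2 * H)) ^ (-(1 + 3 * H / 4)) *
      |x.2 - y.2| ^ ((2 * H - 2) * (3 * H / 2)))

lemma closeBound_nonneg {H ε : ℝ} (hε : 0 < ε) {x y : ℝ × ℝ} (hx : x.2 < x.1) (hy : y.2 < y.1) :
    0 ≤ closeBound H ε x y := by
  have := sub_pos.2 hx
  have := sub_pos.2 hy
  unfold closeBound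
  positivity

lemma farBound_nonneg {H ε : ℝ} (hε : 0 < ε) {x y : ℝ × ℝ} (hx : x.2 < x.1) (hy : y.2 < y.1) :
    0 ≤ farBound H ε x y := by
  have := sub_pos.2 hx
  have := sub_pos.2 hy
  unfold farBound
  positivity

lemma exists_remainder_le {H : ℝ} (hH : 2 / 3 < H) (hH' : H < 1) :
    ∃ C, 0 ≤ C ∧ ∀ ε, 0 < ε → ∀ x y : ℝ × ℝ, x.2 < x.1 → y.2 < y.1 → x.2 ≠ y.2 →
      |incCov H x.1 x.2 y.1 y.2 *
        (((ε + (x.1 - x.2) ^ (2 * H)) * (ε + (y.1 - y.2) ^ (2 * H)) -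
            incCov H x.1 x.2 y.1 y.2 ^ 2) ^ (-(3 / 2) : ℝ) -
          ((ε + (x.1 - x.2) ^ (2 * H)) * (ε + (y.1 - y.2) ^ (2 * H))) ^ (-(3 / 2) : ℝ))| ≤
        C * (closeBound H ε x y + farBound H ε x y) := by
  refine ⟨(1 - H) ^ (-(3 / 2) : ℝ) + 2 / (1 - ((1 + H) / 2) ^ 2) ^ 2 * 2 ^ (3 * H / 2), ?_, ?_⟩
  · have : 0 < 1 - H := by linarith
    positivity
  rintro ε hε ⟨t, s⟩ ⟨t', s'⟩ hx hy hne
  have hclose := closeBound_nonneg (H := H) hε hx hy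
  have hfar := farBound_nonneg (H := H) hε hx hy
  simp only at hx hy hne ⊢
  have hu : 0 < t - s := sub_pos.2 hx
  have hu' : 0 < t' - s' := sub_pos.2 hy
  have hμ := incCov_nonneg (by linarith) hH' hx hy
  set μ := incCov H t s t' s' with hμdef
  have h1H : 0 < 1 - H := by linarith
  have hvV : (t - s) ^ (2 * H) * (t' - s') ^ (2 * H) = (((t - s) * (t' - s')) ^ H) ^ 2 := by
    rw [← Real.mul_rpow hu.le hu'.le, mul_comm 2 H, Real.rpow_mul (by positivity), Real.rpow_two]
  have hVpos : 0 < ((t - s) * (t' - s')) ^ H := by positivity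
  have hc1 : 0 ≤ (1 - H) ^ (-(3 / 2) : ℝ) := by positivity
  have hc2 : 0 ≤ 2 / (1 - ((1 + H) / 2) ^ 2) ^ 2 * 2 ^ (3 * H / 2) := by positivity
  by_cases hreg : (s - s') ^ 2 ≤ (t - s) * (t' - s') ∧ (t - t') ^ 2 ≤ (t - s) * (t' - s')
  · have h := incCov_le_of_close (by linarith) hH' hx hy hreg.1 hreg.2
    have hA : ε ≤ ε + |t - t'| ^ (2 * H) := by
      have : 0 ≤ |t - t'| ^ (2 * H) := by positivity
      linarith
    have hB : ε ≤ ε + |s - s'| ^ (2 * H) := by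
      have : 0 ≤ |s - s'| ^ (2 * H) := by positivity
      linarith
    obtain ⟨h0, h1⟩ := remainder_le_of_close hε (v₁ := (t - s) ^ (2 * H)) (v₂ := (t' - s') ^ (2 * H))
      (by positivity) (by positivity) hVpos hvV hμ hA hB (c := (1 - H) / 2) (by linarith)
      (by linarith) (by rw [hμdef]; linarith)
    rw [abs_of_nonneg h0]
    -- A geometric mean is at most the sum; this separates the two lengths, so that only one of them
    -- enters each term.
    have hVb : (((t - s) * (t' - s')) ^ H) ^ (-(1 / 2) : ℝ) ≤
        (t - s) ^ (-H) + (t' - s') ^ (-H) := by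
      have e1 : (((t - s) * (t' - s')) ^ H) ^ (-(1 / 2) : ℝ) =
          √((t - s) ^ (-H)) * √((t' - s') ^ (-H)) := by
        rw [← Real.sqrt_mul (by positivity), ← Real.mul_rpow hu.le hu'.le, Real.sqrt_eq_rpow,
          ← Real.rpow_mul (by positivity), ← Real.rpow_mul (by positivity)]
        congr 1; ring
      have p1 : 0 ≤ (t - s) ^ (-H) := by positivity
      have p2 : 0 ≤ (t' - s') ^ (-H) := by positivity
      rw [e1]
      nlinarith [sq_nonneg (√((t - s) ^ (-H)) - √((t' - s') ^ (-H))), Real.sq_sqrt p1,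
        Real.sq_sqrt p2]
    have h2 : (2 * ((1 - H) / 2)) ^ (-(3 / 2) : ℝ) = (1 - H) ^ (-(3 / 2) : ℝ) := by
      congr 1; ring
    rw [h2] at h1
    calc _ ≤ _ := h1
      _ ≤ (1 - H) ^ (-(3 / 2) : ℝ) * closeBound H ε (t, s) (t', s') := by
          unfold closeBound
          gcongr
      _ ≤ _ := by nlinarith [mul_nonneg hc1 hfar, mul_nonneg hc2 hclose, mul_nonneg hc2 hfar]
  · have hreg' : (t - s) * (t' - s') < (s - s') ^ 2 ∨ (t - s) * (t' - s') < (t - t') ^ 2 := by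
      rw [not_and_or, not_le, not_le] at hreg; exact hreg
    have h := incCov_le_of_far (by linarith) hH' hx hy hreg'
    have hp1 : 0 < (t - s) ^ (2 * H) := by positivity
    have hp2 : 0 < (t' - s') ^ (2 * H) := by positivity
    -- The choice `θ = 3H/2 - 1` is positive exactly for `H > 2/3`. It gives `μ` the power `3H/2`,
    -- hence the distance the exponent `3H(H - 1) ≥ -3/4`, always integrable at `0`; with `θ = 2`
    -- this would need `H > 5/6`.
    obtain ⟨h0, h1⟩ := remainder_le_of_far (a₁ := ε + (t - s) ^ (2 * H))
      (a₂ := ε + (t' - s') ^ (2 * H)) (by positivity) (by positivity)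
      (by rw [← hvV]; gcongr <;> linarith) hμ (by linarith) (by linarith : (1 + H) / 2 < 1) h
      (θ := 3 * H / 2 - 1) (by linarith) (by linarith)
    rw [abs_of_nonneg h0]
    have hm : μ ^ (3 * H / 2) ≤ 2 ^ (3 * H / 2) * ((t - s) ^ (3 * H / 2) * (t' - s') ^ (3 * H / 2) *
        |s - s'| ^ ((2 * H - 2) * (3 * H / 2))) := by
      have h2 := incCov_le_mul (by linarith) hH' hx hy hne
      have h3 : μ ≤ 2 * ((t - s) * (t' - s') * |s - s'| ^ (2 * H - 2)) := by
        refine h2.trans ?_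
        gcongr
        linarith
      calc μ ^ (3 * H / 2) ≤ (2 * ((t - s) * (t' - s') * |s - s'| ^ (2 * H - 2))) ^ (3 * H / 2) :=
            Real.rpow_le_rpow hμ h3 (by linarith)
        _ = _ := by
            rw [Real.mul_rpow (by norm_num) (by positivity), Real.mul_rpow (by positivity)
              (by positivity), Real.mul_rpow hu.le hu'.le, Real.rpow_mul (abs_nonneg _)]
    have e1 : 1 + (3 * H / 2 - 1) = 3 * H / 2 := by ring
    have e2 : -((3 + (3 * H / 2 - 1)) / 2) = -(1 + 3 * H / 4) := by ring
    rw [e1, e2] at h1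
    calc _ ≤ _ := h1
      _ ≤ 2 / (1 - ((1 + H) / 2) ^ 2) ^ 2 * ((2 ^ (3 * H / 2) * ((t - s) ^ (3 * H / 2) *
          (t' - s') ^ (3 * H / 2) * |s - s'| ^ ((2 * H - 2) * (3 * H / 2)))) *
            ((ε + (t - s) ^ (2 * H)) ^ (-(1 + 3 * H / 4)) *
              (ε + (t' - s') ^ (2 * H)) ^ (-(1 + 3 * H / 4)))) := by gcongr
      _ = 2 / (1 - ((1 + H) / 2) ^ 2) ^ 2 * 2 ^ (3 * H / 2) * farBound H ε (t, s) (t', s') := by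
          unfold farBound; ring
      _ ≤ _ := by nlinarith [mul_nonneg hc1 hfar, mul_nonneg hc1 hclose, mul_nonneg hc2 hclose]

end

/-! ### Integrating the bounds over pairs of increments -/

section

/-- The integral is cut at `δ = ε ^ (1 / (2H))`, where the two terms of `ε + u ^ (2H)` balance.
Keeping the larger term on each side leaves pure powers, integrable by `hp` near `0` and by `hk` at
infinity. -/
lemma exists_lintegral_rpow_mul_le {H p k : ℝ} (hH : 0 < H) (hp : -1 < p) (hk0 : 0 < k)
    (hk : p + 1 < 2 * H * k) :
    ∃ C, 0 ≤ C ∧ ∀ ε, 0 < ε →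
      ∫⁻ u in Set.Ioi (0 : ℝ), ENNReal.ofReal (u ^ p * (ε + u ^ (2 * H)) ^ (-k)) ≤
        ENNReal.ofReal (C * ε ^ ((p + 1) / (2 * H) - k)) := by
  have hp1 : 0 < p + 1 := by linarith
  have hk1 : 0 < 2 * H * k - p - 1 := by linarith
  refine ⟨(p + 1)⁻¹ + (2 * H * k - p - 1)⁻¹, by positivity, fun ε hε => ?_⟩
  set δ := ε ^ (1 / (2 * H)) with hδ
  have hδ0 : 0 < δ := Real.rpow_pos_of_pos hε _
  rw [← Set.Ioc_union_Ioi_eq_Ioi hδ0.le]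
  refine (lintegral_union_le _ _ _).trans ?_
  have h1 : ∫⁻ u in Set.Ioc 0 δ, ENNReal.ofReal (u ^ p * (ε + u ^ (2 * H)) ^ (-k)) ≤
      ENNReal.ofReal ((p + 1)⁻¹ * ε ^ ((p + 1) / (2 * H) - k)) := by
    have hi : IntegrableOn (fun u : ℝ => ε ^ (-k) * u ^ p) (Set.Ioc 0 δ) :=
      ((intervalIntegrable_iff_integrableOn_Ioc_of_le hδ0.le).1
        (intervalIntegral.intervalIntegrable_rpow' hp)).const_mul _
    calc _ ≤ ∫⁻ u in Set.Ioc 0 δ, ENNReal.ofReal (ε ^ (-k) * u ^ p) := by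
          refine setLIntegral_mono' measurableSet_Ioc fun u hu => ENNReal.ofReal_le_ofReal ?_
          have hu0 : 0 < u := hu.1
          rw [mul_comm]
          gcongr ?_ * _
          refine Real.rpow_le_rpow_of_nonpos hε ?_ (by linarith)
          have : 0 ≤ u ^ (2 * H) := by positivity
          linarith
      _ = _ := by
          rw [← ofReal_integral_eq_lintegral_ofReal hi (by
            filter_upwards [ae_restrict_mem measurableSet_Ioc] with u hu
            have hu0 : 0 < u := hu.1
            simp only [Pi.zero_apply]
            positivity)]
          rw [integral_const_mul, ← intervalIntegral.integral_of_le hδ0.le,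
            integral_rpow (.inl hp), Real.zero_rpow hp1.ne', sub_zero, hδ, ← Real.rpow_mul hε.le]
          congr 1
          rw [sub_eq_add_neg, Real.rpow_add hε, show 1 / (2 * H) * (p + 1) = (p + 1) / (2 * H) by ring]
          field_simp
  have h2 : ∫⁻ u in Set.Ioi δ, ENNReal.ofReal (u ^ p * (ε + u ^ (2 * H)) ^ (-k)) ≤
      ENNReal.ofReal ((2 * H * k - p - 1)⁻¹ * ε ^ ((p + 1) / (2 * H) - k)) := by
    have hlt : p - 2 * H * k < -1 := by linarith
    calc _ ≤ ∫⁻ u in Set.Ioi δ, ENNReal.ofReal (u ^ (p - 2 * H * k)) := by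
          refine setLIntegral_mono' measurableSet_Ioi fun u hu => ENNReal.ofReal_le_ofReal ?_
          have hu0 : 0 < u := hδ0.trans hu
          rw [show p - 2 * H * k = p + 2 * H * -k by ring, Real.rpow_add hu0,
            Real.rpow_mul hu0.le (2 * H) (-k)]
          exact mul_le_mul_of_nonneg_left (Real.rpow_le_rpow_of_nonpos
            (by positivity : 0 < u ^ (2 * H)) (by linarith) (by linarith)) (by positivity)
      _ = _ := by
          rw [← ofReal_integral_eq_lintegral_ofReal (integrableOn_Ioi_rpow_of_lt hlt hδ0) (by
            filter_upwards [ae_restrict_mem measurableSet_Ioi] with u hu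
            have hu0 : 0 < u := hδ0.trans hu
            simp only [Pi.zero_apply]
            positivity)]
          rw [integral_Ioi_rpow_of_lt hlt hδ0, hδ, ← Real.rpow_mul hε.le]
          congr 1
          rw [show 1 / (2 * H) * (p - 2 * H * k + 1) = (p + 1) / (2 * H) - k by field_simp; ring,
            show p - 2 * H * k + 1 = -(2 * H * k - p - 1) by ring, neg_div_neg_eq, div_eq_inv_mul]
  refine (add_le_add h1 h2).trans ?_
  rw [← ENNReal.ofReal_add (by positivity) (by positivity), ← add_mul]

lemma lintegral_comp_abs_eq (f : ℝ → ℝ≥0∞) :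
    ∫⁻ x, f |x| = 2 * ∫⁻ x in Set.Ioi (0 : ℝ), f x := by
  rw [← lintegral_add_compl _ (measurableSet_Ioi (a := (0 : ℝ))), Set.compl_Ioi,
    ← restrict_Iio_eq_restrict_Iic, two_mul]
  congr 1
  · refine setLIntegral_congr_fun measurableSet_Ioi fun x hx => ?_
    rw [abs_of_pos hx]
  · rw [← lintegral_indicator measurableSet_Iio, ← lintegral_indicator measurableSet_Ioi,
      ← lintegral_neg_eq_self]
    refine lintegral_congr fun x => ?_
    by_cases hx : 0 < x
    · rw [Set.indicator_of_mem (by simpa using hx), Set.indicator_of_mem (by simpa using hx),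
        abs_neg, abs_of_pos hx]
    · rw [Set.indicator_of_notMem (by simpa using hx), Set.indicator_of_notMem (by simpa using hx)]

/-- In the coordinates `(t - s, s)` the triangle is contained in a product, and the integrand
splits. -/
lemma lintegral_triangle_le {T : ℝ} {g h : ℝ → ℝ≥0∞} (hg : Measurable g) (hh : Measurable h) :
    ∫⁻ x in triangle T, g (x.1 - x.2) * h x.2 ≤
      (∫⁻ u in Set.Ioi (0 : ℝ), g u) * ∫⁻ s in Set.Ioo 0 T, h s := by
  rw [← lintegral_indicator (measurableSet_triangle T), ← lintegral_indicator measurableSet_Ioi,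
    ← lintegral_indicator measurableSet_Ioo]
  have hg' := hg.indicator (measurableSet_Ioi (a := (0 : ℝ)))
  have hh' := hh.indicator (measurableSet_Ioo (a := (0 : ℝ)) (b := T))
  calc _ ≤ ∫⁻ x : ℝ × ℝ, (Set.Ioi 0).indicator g (x.1 - x.2) * (Set.Ioo 0 T).indicator h x.2 := by
        refine lintegral_mono fun x => ?_
        by_cases hx : x ∈ triangle T
        · obtain ⟨h1, h2, h3⟩ := id hx
          rw [Set.indicator_of_mem hx, Set.indicator_of_mem (by simpa using h2),
            Set.indicator_of_mem (show x.2 ∈ Set.Ioo 0 T from ⟨h1, h2.trans_le h3⟩)]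
        · rw [Set.indicator_of_notMem hx]; exact zero_le
    _ = _ := by
        rw [Measure.volume_eq_prod, lintegral_prod_symm _ (by fun_prop)]
        have : ∀ s : ℝ, ∫⁻ t, (Set.Ioi 0).indicator g (t - s) * (Set.Ioo 0 T).indicator h s =
            (∫⁻ u, (Set.Ioi 0).indicator g u) * (Set.Ioo 0 T).indicator h s := by
          intro s
          rw [lintegral_mul_const _ (by fun_prop),
            lintegral_sub_right_eq_self (fun u => (Set.Ioi 0).indicator g u)]
        simp only [this]
        rw [lintegral_const_mul _ hh']

/-- The shape of `farBound`: each length is integrated separately, and the distance of the left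
endpoints stays in `(-T, T)`. -/
lemma lintegral_triangle_mul_abs_le {T : ℝ} {g K : ℝ → ℝ≥0∞} (hg : Measurable g)
    (hK : Measurable K) :
    ∫⁻ x in triangle T, ∫⁻ y in triangle T, g (x.1 - x.2) * (g (y.1 - y.2) * K |x.2 - y.2|) ≤
      (∫⁻ u in Set.Ioi (0 : ℝ), g u) ^ 2 * (2 * ∫⁻ z in Set.Ioo 0 T, K z) * ENNReal.ofReal T := by
  set J := ∫⁻ u in Set.Ioi (0 : ℝ), g u
  set N := 2 * ∫⁻ z in Set.Ioo 0 T, K z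
  have h1 : ∀ x ∈ triangle T, ∫⁻ y in triangle T, g (x.1 - x.2) * (g (y.1 - y.2) * K |x.2 - y.2|) ≤
      g (x.1 - x.2) * (fun _ => J * N) x.2 := by
    intro x hx
    rw [lintegral_const_mul _ (by fun_prop)]
    refine mul_le_mul_right ?_ _
    refine (lintegral_triangle_le hg (h := fun s => K |x.2 - s|) (by fun_prop)).trans ?_
    refine mul_le_mul_right ?_ _
    have h2 : ∫⁻ s in Set.Ioo 0 T, K |x.2 - s| ≤ ∫⁻ s, (Set.Iio T).indicator K |x.2 - s| := by
      rw [← lintegral_indicator measurableSet_Ioo]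
      refine lintegral_mono fun s => ?_
      by_cases hs : s ∈ Set.Ioo 0 T
      · rw [Set.indicator_of_mem hs, Set.indicator_of_mem]
        have := triangle_subset T hx
        have h0 := hx.1
        have h4 := hx.2.1.trans_le hx.2.2
        rw [Set.mem_Iio, abs_lt]
        constructor <;> linarith [hs.1, hs.2]
      · rw [Set.indicator_of_notMem hs]; exact zero_le
    refine h2.trans (le_of_eq ?_)
    rw [lintegral_sub_left_eq_self (fun z => (Set.Iio T).indicator K |z|), lintegral_comp_abs_eq,
      setLIntegral_indicator measurableSet_Iio, Set.inter_comm, Set.Ioi_inter_Iio]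
  calc _ ≤ ∫⁻ x in triangle T, g (x.1 - x.2) * (fun _ => J * N) x.2 :=
        setLIntegral_mono' (measurableSet_triangle T) h1
    _ ≤ J * ∫⁻ s in Set.Ioo 0 T, J * N := lintegral_triangle_le hg measurable_const
    _ = _ := by
        rw [setLIntegral_const, Real.volume_Ioo, sub_zero]
        ring

/-- The shape of one half of `closeBound`: the second increment is integrated over the whole plane,
where translation invariance decouples its endpoints. -/
lemma lintegral_triangle_mul_prod_le {T : ℝ} {g K : ℝ → ℝ≥0∞} (hg : Measurable g)
    (hK : Measurable K) :
    ∫⁻ x in triangle T, ∫⁻ y in triangle T,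
        g (x.1 - x.2) * (K |x.1 - y.1| * K |x.2 - y.2|) ≤
      (∫⁻ u in Set.Ioo 0 T, g u) * ENNReal.ofReal T * (2 * ∫⁻ z in Set.Ioi (0 : ℝ), K z) ^ 2 := by
  set I := 2 * ∫⁻ z in Set.Ioi (0 : ℝ), K z with hI
  have h1 : ∀ x ∈ triangle T, ∫⁻ y in triangle T, g (x.1 - x.2) * (K |x.1 - y.1| * K |x.2 - y.2|) ≤
      (Set.Iio T).indicator g (x.1 - x.2) * (fun _ => I ^ 2) x.2 := by
    intro x hx
    rw [Set.indicator_of_mem (by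
      have h0 := hx.1
      have h4 := hx.2.2
      rw [Set.mem_Iio]; linarith), lintegral_const_mul _ (by fun_prop)]
    refine mul_le_mul_right ?_ _
    calc _ ≤ ∫⁻ y : ℝ × ℝ, K |x.1 - y.1| * K |x.2 - y.2| := setLIntegral_le_lintegral _ _
      _ = _ := by
        rw [Measure.volume_eq_prod, lintegral_prod_mul (f := fun t => K |x.1 - t|)
          (g := fun t => K |x.2 - t|) (by fun_prop) (by fun_prop),
          lintegral_sub_left_eq_self (fun z => K |z|), lintegral_sub_left_eq_self (fun z => K |z|),
          lintegral_comp_abs_eq, sq]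
  calc _ ≤ ∫⁻ x in triangle T, (Set.Iio T).indicator g (x.1 - x.2) * (fun _ => I ^ 2) x.2 :=
        setLIntegral_mono' (measurableSet_triangle T) h1
    _ ≤ _ := lintegral_triangle_le (hg.indicator measurableSet_Iio) measurable_const
    _ = _ := by
        rw [setLIntegral_const, Real.volume_Ioo, sub_zero, setLIntegral_indicator measurableSet_Iio,
          Set.inter_comm, Set.Ioi_inter_Iio]
        ring

lemma setLIntegral_Ioo_rpow_lt_top {p : ℝ} (hp : -1 < p) (T : ℝ) :
    ∫⁻ z in Set.Ioo 0 T, ENNReal.ofReal (z ^ p) < ∞ := by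
  rcases le_or_gt T 0 with hT | hT
  · simp [Set.Ioo_eq_empty_of_le hT]
  have hi : IntegrableOn (fun u : ℝ => u ^ p) (Set.Ioo 0 T) :=
    ((intervalIntegrable_iff_integrableOn_Ioc_of_le hT.le).1
      (intervalIntegral.intervalIntegrable_rpow' hp)).mono_set Set.Ioo_subset_Ioc_self
  exact hi.lintegral_lt_top

lemma exists_lintegral_farBound_le {H : ℝ} (hH : 2 / 3 < H) (hH' : H < 1) (T : ℝ) :
    ∃ C, 0 ≤ C ∧ ∀ ε, 0 < ε →
      ∫⁻ x in triangle T, ∫⁻ y in triangle T, ENNReal.ofReal (farBound H ε x y) ≤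
        ENNReal.ofReal (C * (ε ^ ((3 * H / 2 + 1) / (2 * H) - (1 + 3 * H / 4))) ^ 2) := by
  obtain ⟨C, hC, h⟩ := exists_lintegral_rpow_mul_le (H := H) (p := 3 * H / 2) (k := 1 + 3 * H / 4)
    (by linarith) (by linarith) (by linarith) (by nlinarith)
  set N := 2 * ∫⁻ z in Set.Ioo 0 T, ENNReal.ofReal (z ^ ((2 * H - 2) * (3 * H / 2))) with hN
  have hNt : N * ENNReal.ofReal T ≠ ∞ := by
    have := setLIntegral_Ioo_rpow_lt_top (p := (2 * H - 2) * (3 * H / 2))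
      -- `3H² - 3H + 3/4 = (3/4)(2H - 1)²`, so the exponent is at least `-3/4`.
      (by nlinarith [sq_nonneg (2 * H - 1)]) T
    exact ENNReal.mul_ne_top (ENNReal.mul_ne_top (by simp) this.ne) (by simp)
  refine ⟨C ^ 2 * (N * ENNReal.ofReal T).toReal, by positivity, fun ε hε => ?_⟩
  set g : ℝ → ℝ≥0∞ :=
    fun u => ENNReal.ofReal (u ^ (3 * H / 2) * (ε + u ^ (2 * H)) ^ (-(1 + 3 * H / 4))) with hg
  calc _ = ∫⁻ x in triangle T, ∫⁻ y in triangle T, g (x.1 - x.2) * (g (y.1 - y.2) *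
          (fun z => ENNReal.ofReal (z ^ ((2 * H - 2) * (3 * H / 2)))) |x.2 - y.2|) := by
        refine setLIntegral_congr_fun (measurableSet_triangle T) fun x hx =>
          setLIntegral_congr_fun (measurableSet_triangle T) fun y hy => ?_
        have := sub_pos.2 hx.2.1
        have := sub_pos.2 hy.2.1
        simp only [hg, farBound]
        rw [ENNReal.ofReal_mul (p := (x.1 - x.2) ^ (3 * H / 2) *
            (ε + (x.1 - x.2) ^ (2 * H)) ^ (-(1 + 3 * H / 4))) (by positivity),
          ENNReal.ofReal_mul (p := (y.1 - y.2) ^ (3 * H / 2) *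
            (ε + (y.1 - y.2) ^ (2 * H)) ^ (-(1 + 3 * H / 4))) (by positivity)]
    _ ≤ _ := lintegral_triangle_mul_abs_le (g := g)
        (K := fun z => ENNReal.ofReal (z ^ ((2 * H - 2) * (3 * H / 2)))) (by fun_prop) (by fun_prop)
    _ ≤ ENNReal.ofReal (C * ε ^ ((3 * H / 2 + 1) / (2 * H) - (1 + 3 * H / 4))) ^ 2 * N *
          ENNReal.ofReal T := by
        rw [← hN]
        gcongr
        exact h ε hε
    _ = _ := by
        rw [← ENNReal.ofReal_pow (by positivity), mul_assoc, ← ENNReal.ofReal_toReal hNt,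
          ← ENNReal.ofReal_mul (by positivity)]
        congr 1
        rw [ENNReal.toReal_ofReal ENNReal.toReal_nonneg]
        ring

lemma exists_lintegral_closeBound_le {H : ℝ} (hH : 2 / 3 < H) (hH' : H < 1) (T : ℝ) :
    ∃ C, 0 ≤ C ∧ ∀ ε, 0 < ε →
      ∫⁻ x in triangle T, ∫⁻ y in triangle T, ENNReal.ofReal (closeBound H ε x y) ≤
        ENNReal.ofReal (C * (ε ^ (1 / (2 * H) - 3 / 4)) ^ 2) := by
  obtain ⟨C, hC, h⟩ := exists_lintegral_rpow_mul_le (H := H) (p := 0) (k := 3 / 4)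
    (by linarith) (by linarith) (by linarith) (by linarith)
  set M := (∫⁻ z in Set.Ioo 0 T, ENNReal.ofReal (z ^ (-H))) * ENNReal.ofReal T with hM
  have hMt : M ≠ ∞ := by
    have := setLIntegral_Ioo_rpow_lt_top (p := -H) (by linarith) T
    exact ENNReal.mul_ne_top this.ne (by simp)
  refine ⟨2 * (M.toReal * (2 * C) ^ 2), by positivity, fun ε hε => ?_⟩
  set g : ℝ → ℝ≥0∞ := fun u => ENNReal.ofReal (u ^ (-H)) with hg
  set K : ℝ → ℝ≥0∞ := fun u => ENNReal.ofReal ((ε + u ^ (2 * H)) ^ (-(3 / 4) : ℝ)) with hK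
  have hKle : ∫⁻ z in Set.Ioi (0 : ℝ), K z ≤
      ENNReal.ofReal (C * ε ^ (1 / (2 * H) - 3 / 4)) := by
    have := h ε hε
    simpa [hK] using this
  have hmain : ∫⁻ x in triangle T, ∫⁻ y in triangle T,
      g (x.1 - x.2) * (K |x.1 - y.1| * K |x.2 - y.2|) ≤
      ENNReal.ofReal (M.toReal * (2 * C) ^ 2 * (ε ^ (1 / (2 * H) - 3 / 4)) ^ 2) := by
    refine (lintegral_triangle_mul_prod_le (by fun_prop) (by fun_prop)).trans ?_
    rw [← hM]
    calc _ ≤ M * (2 * ENNReal.ofReal (C * ε ^ (1 / (2 * H) - 3 / 4))) ^ 2 := by gcongr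
      _ = _ := by
        have h2 : (2 : ℝ≥0∞) = ENNReal.ofReal 2 := by simp
        rw [h2, ← ENNReal.ofReal_mul (by norm_num), ← ENNReal.ofReal_pow (by positivity)]
        nth_rewrite 1 [← ENNReal.ofReal_toReal hMt]
        rw [← ENNReal.ofReal_mul ENNReal.toReal_nonneg]
        congr 1
        ring
  -- The two terms of `closeBound` are exchanged by swapping the increments.
  have hswap : ∫⁻ x in triangle T, ∫⁻ y in triangle T,
      g (y.1 - y.2) * (K |x.1 - y.1| * K |x.2 - y.2|) =
      ∫⁻ x in triangle T, ∫⁻ y in triangle T,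
        g (x.1 - x.2) * (K |x.1 - y.1| * K |x.2 - y.2|) := by
    rw [lintegral_lintegral_swap (by simp only [Function.uncurry_def]; fun_prop)]
    simp only [abs_sub_comm]
  calc _ = ∫⁻ x in triangle T, ∫⁻ y in triangle T,
        (g (x.1 - x.2) * (K |x.1 - y.1| * K |x.2 - y.2|) +
          g (y.1 - y.2) * (K |x.1 - y.1| * K |x.2 - y.2|)) := by
        refine setLIntegral_congr_fun (measurableSet_triangle T) fun x hx =>
          setLIntegral_congr_fun (measurableSet_triangle T) fun y hy => ?_
        have := sub_pos.2 hx.2.1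
        have := sub_pos.2 hy.2.1
        simp only [hg, hK, closeBound]
        rw [ENNReal.ofReal_mul (by positivity), ENNReal.ofReal_mul (by positivity),
          ENNReal.ofReal_add (by positivity) (by positivity), add_mul]
    _ = (∫⁻ x in triangle T, ∫⁻ y in triangle T,
          g (x.1 - x.2) * (K |x.1 - y.1| * K |x.2 - y.2|)) +
        ∫⁻ x in triangle T, ∫⁻ y in triangle T,
          g (y.1 - y.2) * (K |x.1 - y.1| * K |x.2 - y.2|) := by
        rw [← lintegral_add_left]
        · refine lintegral_congr fun x => ?_
          rw [lintegral_add_left (by fun_prop)]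
        · exact Measurable.lintegral_prod_right' (ν := volume.restrict (triangle T)) (f := fun z : (ℝ × ℝ) × (ℝ × ℝ) =>
            g (z.1.1 - z.1.2) * (K |z.1.1 - z.2.1| * K |z.1.2 - z.2.2|)) (by fun_prop)
    _ ≤ _ := by
        rw [hswap]
        refine (add_le_add hmain hmain).trans (le_of_eq ?_)
        rw [← ENNReal.ofReal_add (by positivity) (by positivity)]
        congr 1
        ring

end

/-! ### The higher chaoses vanish after renormalization -/

section

/-- The squared norm of the integral is a double integral of inner products. Lower integrals of
absolute values allow the bounds to be inserted without first proving the kernel integrable on the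
product. -/
lemma enorm_integral_sq_le {α E : Type*} [MeasurableSpace α] {μ : Measure α}
    [NormedAddCommGroup E] [InnerProductSpace ℝ E] [CompleteSpace E] {f : α → E}
    (hf : Integrable f μ) :
    ENNReal.ofReal (‖∫ x, f x ∂μ‖ ^ 2) ≤ ∫⁻ x, ∫⁻ y, ENNReal.ofReal |inner ℝ (f x) (f y)| ∂μ ∂μ := by
  have he : ∀ r : ℝ, ENNReal.ofReal |r| = ‖r‖ₑ := fun r => by
    rw [← Real.norm_eq_abs, ofReal_norm]
  simp only [he]
  rw [← abs_of_nonneg (sq_nonneg ‖∫ x, f x ∂μ‖), he, ← real_inner_self_eq_norm_sq, ← integral_inner hf]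
  refine (enorm_integral_le_lintegral_enorm _).trans (lintegral_mono fun x => ?_)
  rw [real_inner_comm, ← integral_inner hf]
  exact enorm_integral_le_lintegral_enorm _

lemma lintegral_lintegral_const_mul_add {α β : Type*} [MeasurableSpace α] [MeasurableSpace β]
    {μ : Measure α} {ν : Measure β} [SFinite ν] {c : ℝ≥0∞} (hc : c ≠ ∞) {f : α → β → ℝ≥0∞}
    (hf : Measurable fun z : α × β => f z.1 z.2) (g : α → β → ℝ≥0∞) :
    ∫⁻ x, ∫⁻ y, c * (f x y + g x y) ∂ν ∂μ =
      c * ((∫⁻ x, ∫⁻ y, f x y ∂ν ∂μ) + ∫⁻ x, ∫⁻ y, g x y ∂ν ∂μ) := by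
  rw [← lintegral_add_left (hf.lintegral_prod_right' (ν := ν)), ← lintegral_const_mul' _ _ hc]
  refine lintegral_congr fun x => ?_
  have hx : Measurable (f x) := hf.comp measurable_prodMk_left
  rw [lintegral_const_mul' _ _ hc, lintegral_add_left hx]

variable {Ω : Type*} [MeasurableSpace Ω] {P : Measure Ω} [IsProbabilityMeasure P]
  {H : ℝ} {B : ℝ≥0 → Ω → ℝ}

/-- Each of the three terms containing a projection equals, up to sign, the same first-order
covariance; together they subtract it once. -/
lemma IsFractionalBrownianMotion.inner_kernelLp_sub_chaosProj
    (hB : IsFractionalBrownianMotion H B P) {ε : ℝ} (hε : 0 < ε) {X Y : Lp ℝ 2 P}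
    (hX : X ∈ gaussianSpace B P) (hY : Y ∈ gaussianSpace B P) :
    inner ℝ (kernelLp ε X - chaosProj B P 1 (kernelLp ε X))
        (kernelLp ε Y - chaosProj B P 1 (kernelLp ε Y)) =
      (2 * Real.pi)⁻¹ * (inner ℝ X Y *
        (((ε + ‖X‖ ^ 2) * (ε + ‖Y‖ ^ 2) - inner ℝ X Y ^ 2) ^ (-(3 / 2) : ℝ) -
          ((ε + ‖X‖ ^ 2) * (ε + ‖Y‖ ^ 2)) ^ (-(3 / 2) : ℝ))) := by
  have hG : ∀ X ∈ gaussianSpace B P, P.map X = gaussianReal 0 (‖X‖₊ ^ 2) :=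
    fun X hX => hB.map_eq_gaussianReal hX
  rw [hB.chaosProj_one_kernelLp hε hX, hB.chaosProj_one_kernelLp hε hY]
  simp only [inner_sub_left, inner_sub_right, real_inner_smul_left, real_inner_smul_right]
  rw [real_inner_comm (kernelLp ε Y) X, inner_kernelLp_kernelLp hG hε hX hY,
    inner_kernelLp_left hG hε hX hY, inner_kernelLp_left hG hε hY hX, real_inner_comm X Y,
    Real.mul_rpow (by positivity) (by positivity)]
  have h : (√(2 * Real.pi))⁻¹ * (√(2 * Real.pi))⁻¹ = (2 * Real.pi)⁻¹ := by
    rw [← mul_inv, Real.mul_self_sqrt (by positivity)]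
  rw [← h]
  ring

lemma IsFractionalBrownianMotion.exists_norm_alphaLp_sub_chaosProj_sq_le
    (hB : IsFractionalBrownianMotion H B P) (hH : 2 / 3 < H) (hH' : H < 1) (T : ℝ) :
    ∃ C, 0 ≤ C ∧ ∀ ε, 0 < ε →
      ‖hB.alphaLp T ε - chaosProj B P 1 (hB.alphaLp T ε)‖ ^ 2 ≤
        C * ((ε ^ (1 / (2 * H) - 3 / 4)) ^ 2 +
          (ε ^ ((3 * H / 2 + 1) / (2 * H) - (1 + 3 * H / 4))) ^ 2) := by
  obtain ⟨C, hC, h⟩ := exists_remainder_le hH hH'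
  obtain ⟨C₁, hC₁, h₁⟩ := exists_lintegral_closeBound_le hH hH' T
  obtain ⟨C₂, hC₂, h₂⟩ := exists_lintegral_farBound_le hH hH' T
  refine ⟨C * (C₁ + C₂), by positivity, fun ε hε => ?_⟩
  have hi := hB.integrableOn_kernelLp (by linarith) T ε
  have hi' := ContinuousLinearMap.integrable_comp (chaosProj B P 1) hi
  rw [hB.chaosProj_alphaLp (by linarith), alphaLp, ← integral_sub hi hi']
  rw [← ENNReal.ofReal_le_ofReal_iff (by positivity)]
  refine (enorm_integral_sq_le (hi.sub hi')).trans ?_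
  have hc : Measurable fun z : (ℝ × ℝ) × ℝ × ℝ => ENNReal.ofReal (closeBound H ε z.1 z.2) := by
    unfold closeBound; fun_prop
  calc _ ≤ ∫⁻ x in triangle T, ∫⁻ y in triangle T, ENNReal.ofReal C *
          (ENNReal.ofReal (closeBound H ε x y) + ENNReal.ofReal (farBound H ε x y)) := by
        refine setLIntegral_mono_ae' (measurableSet_triangle T) (.of_forall fun x hx => ?_)
        -- Pairs with equal left endpoints, excluded from the pointwise bound, form a null set for
        -- each `x`.
        have hne : ∀ᵐ y : ℝ × ℝ, y.2 ≠ x.2 :=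
          Measure.quasiMeasurePreserving_snd.ae (Measure.ae_ne volume x.2)
        refine setLIntegral_mono_ae' (measurableSet_triangle T) ?_
        filter_upwards [hne] with y hxy hy
        have hcn := closeBound_nonneg (H := H) hε hx.2.1 hy.2.1
        have hfn := farBound_nonneg (H := H) hε hx.2.1 hy.2.1
        rw [← ENNReal.ofReal_add hcn hfn, ← ENNReal.ofReal_mul hC]
        refine ENNReal.ofReal_le_ofReal ?_
        simp only [Pi.sub_apply]
        rw [hB.inner_kernelLp_sub_chaosProj hε (hB.incr_mem x) (hB.incr_mem y),
          hB.norm_incr_sq (by linarith) hx, hB.norm_incr_sq (by linarith) hy, hB.inner_incr hx hy,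
          abs_mul]
        refine (mul_le_of_le_one_left (abs_nonneg _) ?_).trans
          (h ε hε x y hx.2.1 hy.2.1 (Ne.symm hxy))
        rw [abs_of_pos (by positivity)]
        exact inv_le_one_of_one_le₀ (by linarith [Real.pi_gt_three])
    _ = ENNReal.ofReal C * ((∫⁻ x in triangle T, ∫⁻ y in triangle T,
          ENNReal.ofReal (closeBound H ε x y)) + ∫⁻ x in triangle T, ∫⁻ y in triangle T,
            ENNReal.ofReal (farBound H ε x y)) := by
        exact lintegral_lintegral_const_mul_add ENNReal.ofReal_ne_top hc _
    _ ≤ ENNReal.ofReal C * (ENNReal.ofReal (C₁ * (ε ^ (1 / (2 * H) - 3 / 4)) ^ 2) +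
          ENNReal.ofReal (C₂ * (ε ^ ((3 * H / 2 + 1) / (2 * H) - (1 + 3 * H / 4))) ^ 2)) :=
        mul_le_mul_right (add_le_add (h₁ ε hε) (h₂ ε hε)) _
    _ ≤ _ := by
        rw [← ENNReal.ofReal_add (by positivity) (by positivity), ← ENNReal.ofReal_mul hC]
        refine ENNReal.ofReal_le_ofReal ?_
        rw [mul_assoc]
        refine mul_le_mul_of_nonneg_left ?_ hC
        have e1 := mul_nonneg hC₁ (sq_nonneg (ε ^ ((3 * H / 2 + 1) / (2 * H) - (1 + 3 * H / 4))))
        have e2 := mul_nonneg hC₂ (sq_nonneg (ε ^ (1 / (2 * H) - 3 / 4)))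
        linarith

lemma tendsto_rpow_nhdsGT_zero {p : ℝ} (hp : 0 < p) :
    Tendsto (fun ε : ℝ => ε ^ p) (𝓝[>] 0) (𝓝 0) := by
  have := (Real.continuousAt_rpow_const 0 p (.inr hp.le)).tendsto
  rw [Real.zero_rpow hp.ne'] at this
  exact this.mono_left nhdsWithin_le_nhds

/-- The components of `α_ε` in the chaoses of order at least two vanish after renormalization. -/
lemma IsFractionalBrownianMotion.tendsto_norm_smul_alphaLp_sub_chaosProj
    (hB : IsFractionalBrownianMotion H B P) (hH : 2 / 3 < H) (hH' : H < 1) (T : ℝ) :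
    Tendsto (fun ε : ℝ => ‖ε ^ (3 / 2 - 1 / H) •
      (hB.alphaLp T ε - chaosProj B P 1 (hB.alphaLp T ε))‖) (𝓝[>] 0) (𝓝 0) := by
  obtain ⟨C, hC, h⟩ := hB.exists_norm_alphaLp_sub_chaosProj_sq_le hH hH' T
  have hH0 : 0 < H := by linarith
  -- The normalization wins in both regimes: `(3H - 2)/(4H)` for close pairs, `(3H - 2)(1 - H)/(4H)`
  -- for distant ones.
  have e1 : 0 < 3 / 2 - 1 / H + (1 / (2 * H) - 3 / 4) := by
    rw [show 3 / 2 - 1 / H + (1 / (2 * H) - 3 / 4) = (3 * H - 2) / (4 * H) by field_simp; ring]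
    have : 0 < 3 * H - 2 := by linarith
    positivity
  have e2 : 0 < 3 / 2 - 1 / H + ((3 * H / 2 + 1) / (2 * H) - (1 + 3 * H / 4)) := by
    rw [show 3 / 2 - 1 / H + ((3 * H / 2 + 1) / (2 * H) - (1 + 3 * H / 4)) =
      (3 * H - 2) * (1 - H) / (4 * H) by field_simp; ring]
    have : 0 < 3 * H - 2 := by linarith
    have : 0 < 1 - H := by linarith
    positivity
  have hlim := ((tendsto_rpow_nhdsGT_zero e1).add (tendsto_rpow_nhdsGT_zero e2)).const_mul √C
  rw [add_zero, mul_zero] at hlim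
  refine squeeze_zero' (.of_forall fun _ => norm_nonneg _) ?_ hlim
  filter_upwards [self_mem_nhdsWithin] with ε hε
  have hε : 0 < ε := hε
  rw [norm_smul, Real.norm_of_nonneg (by positivity)]
  refine abs_le_of_sq_le_sq' ?_ (by positivity) |>.2
  rw [mul_pow, mul_pow, Real.sq_sqrt hC, Real.rpow_add hε, Real.rpow_add hε, ← mul_add, mul_pow]
  have := mul_le_mul_of_nonneg_left (h ε hε) (sq_nonneg (ε ^ (3 / 2 - 1 / H)))
  refine this.trans ?_
  rw [mul_left_comm]
  gcongr
  have := mul_nonneg (Real.rpow_nonneg hε.le (1 / (2 * H) - 3 / 4))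
    (Real.rpow_nonneg hε.le ((3 * H / 2 + 1) / (2 * H) - (1 + 3 * H / 4)))
  nlinarith

end

/-! ### The Beta integral in the limiting constant -/

section

lemma lintegral_rpow_mul_exp_neg_mul_rpow {p q b : ℝ} (hp : 0 < p) (hq : -1 < q) (hb : 0 < b) :
    ∫⁻ x in Set.Ioi (0 : ℝ), ENNReal.ofReal (x ^ q * Real.exp (-b * x ^ p)) =
      ENNReal.ofReal (b ^ (-(q + 1) / p) * (1 / p) * Real.Gamma ((q + 1) / p)) := by
  rw [← integral_rpow_mul_exp_neg_mul_rpow hp hq hb,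
    ofReal_integral_eq_lintegral_ofReal (integrableOn_rpow_mul_exp_neg_mul_rpow hq hp hb)]
  filter_upwards [ae_restrict_mem measurableSet_Ioi] with x hx
  have : 0 < x := hx
  simp only [Pi.zero_apply]
  positivity

/-- `Γ(k) (1 + x^p)^(-k)` is written as `∫ y^(k-1) exp (-(1 + x^p) y) dy`; after Tonelli both
integrals are Gamma integrals. Working with lower integrals makes the exchange free of integrability
conditions. -/
lemma integral_rpow_mul_one_add_rpow_neg {p q k : ℝ} (hp : 0 < p) (hq : -1 < q)
    (hk : (q + 1) / p < k) :
    ∫ x in Set.Ioi (0 : ℝ), x ^ q * (1 + x ^ p) ^ (-k) =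
      beta ((q + 1) / p) (k - (q + 1) / p) / p := by
  set a := (q + 1) / p with ha
  have ha0 : 0 < a := div_pos (by linarith) hp
  have hk0 : 0 < k := ha0.trans hk
  have hΓ : 0 < Real.Gamma k := Real.Gamma_pos_of_pos hk0
  have hΓ1 : 0 < Real.Gamma a := Real.Gamma_pos_of_pos ha0
  have hΓ2 : 0 < Real.Gamma (k - a) := Real.Gamma_pos_of_pos (by linarith)
  have h1 : ∀ x ∈ Set.Ioi (0 : ℝ), ENNReal.ofReal (x ^ q * (1 + x ^ p) ^ (-k)) *
      ENNReal.ofReal (Real.Gamma k) = ∫⁻ y in Set.Ioi (0 : ℝ),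
        ENNReal.ofReal (x ^ q * (y ^ (k - 1) * Real.exp (-(1 + x ^ p) * y))) := by
    intro x hx
    have hx : 0 < x := hx
    have h := lintegral_rpow_mul_exp_neg_mul_rpow one_pos (by linarith : -1 < k - 1)
      (by positivity : 0 < 1 + x ^ p)
    simp only [Real.rpow_one, sub_add_cancel, div_one, mul_one] at h
    simp only [ENNReal.ofReal_mul (Real.rpow_nonneg hx.le q)]
    rw [lintegral_const_mul' _ _ ENNReal.ofReal_ne_top]
    simp only [← ENNReal.ofReal_mul (Real.rpow_nonneg hx.le q)]
    rw [h, ← ENNReal.ofReal_mul (by positivity), ← ENNReal.ofReal_mul (by positivity), mul_assoc]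
  have h2 : ∀ y ∈ Set.Ioi (0 : ℝ), ∫⁻ x in Set.Ioi (0 : ℝ),
        ENNReal.ofReal (x ^ q * (y ^ (k - 1) * Real.exp (-(1 + x ^ p) * y))) =
      ENNReal.ofReal (1 / p * Real.Gamma a) *
        ENNReal.ofReal (y ^ (k - a - 1) * Real.exp (-1 * y)) := by
    intro y hy
    have hy : 0 < y := hy
    have hc : 0 ≤ y ^ (k - 1) * Real.exp (-1 * y) := by positivity
    have he : ∀ x : ℝ, x ^ q * (y ^ (k - 1) * Real.exp (-(1 + x ^ p) * y)) =
        (y ^ (k - 1) * Real.exp (-1 * y)) * (x ^ q * Real.exp (-y * x ^ p)) := by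
      intro x
      rw [show -(1 + x ^ p) * y = -1 * y + -y * x ^ p by ring, Real.exp_add]
      ring
    simp only [he, ENNReal.ofReal_mul hc]
    rw [lintegral_const_mul' _ _ ENNReal.ofReal_ne_top,
      lintegral_rpow_mul_exp_neg_mul_rpow hp hq hy, ← ENNReal.ofReal_mul hc,
      ← ENNReal.ofReal_mul (by positivity)]
    congr 1
    rw [show k - a - 1 = (k - 1) + -(q + 1) / p by rw [ha]; ring, Real.rpow_add hy, ← ha]
    ring
  have hG := lintegral_rpow_mul_exp_neg_mul_rpow one_pos (by linarith : -1 < k - a - 1) one_pos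
  simp only [Real.rpow_one, sub_add_cancel, div_one, mul_one, Real.one_rpow, one_mul] at hG
  have hmain : (∫⁻ x in Set.Ioi (0 : ℝ), ENNReal.ofReal (x ^ q * (1 + x ^ p) ^ (-k))) *
      ENNReal.ofReal (Real.Gamma k) =
      ENNReal.ofReal (1 / p * Real.Gamma a * Real.Gamma (k - a)) := by
    rw [← lintegral_mul_const' _ _ ENNReal.ofReal_ne_top,
      setLIntegral_congr_fun measurableSet_Ioi h1,
      lintegral_lintegral_swap (by simp only [Function.uncurry_def]; fun_prop),
      setLIntegral_congr_fun measurableSet_Ioi h2, lintegral_const_mul' _ _ ENNReal.ofReal_ne_top,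
      hG, ← ENNReal.ofReal_mul (by positivity)]
  rw [integral_eq_lintegral_of_nonneg_ae (by
      filter_upwards [ae_restrict_mem measurableSet_Ioi] with x hx
      have : 0 < x := hx
      simp only [Pi.zero_apply]
      positivity) (by fun_prop), eq_div_iff hp.ne']
  have := congrArg ENNReal.toReal hmain
  rw [ENNReal.toReal_mul, ENNReal.toReal_ofReal hΓ.le, ENNReal.toReal_ofReal (by positivity)] at this
  rw [beta, add_sub_cancel, eq_div_iff hΓ.ne', mul_right_comm, this]
  field_simp

end

/-! ### Limit of the first chaos -/

section

section endIncrement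

variable {E : Type*} [NormedAddCommGroup E] [NormedSpace ℝ E]

lemma integral_triangle_eq_integral_sub {T : ℝ} (hT : 0 ≤ T) {g : ℝ × ℝ → E}
    (hg : IntegrableOn g (triangle T)) :
    ∫ x in triangle T, g x = ∫ u in (0 : ℝ)..T, ∫ s in (0 : ℝ)..(T - u), g (u + s, s) := by
  have hg' := (integrable_indicator_iff (measurableSet_triangle T)).2 hg
  rw [← integral_indicator (measurableSet_triangle T), Measure.volume_eq_prod]
  rw [Measure.volume_eq_prod] at hg'
  have hm := measurePreserving_add_prod (volume : Measure ℝ) (volume : Measure ℝ)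
  have hgm := hg'
  rw [← hm.map_eq] at hgm ⊢
  have hgi : Integrable (fun z : ℝ × ℝ => (triangle T).indicator g (z.1 + z.2, z.2))
      (volume.prod volume) := hm.integrable_comp_of_integrable hg'
  rw [integral_map hm.measurable.aemeasurable hgm.aestronglyMeasurable,
    integral_prod _ hgi, intervalIntegral.integral_of_le hT,
    ← integral_indicator measurableSet_Ioc]
  refine integral_congr_ae (.of_forall fun u => ?_)
  simp only
  classical
  by_cases hu : u ∈ Set.Ioc 0 T
  · rw [Set.indicator_of_mem hu, intervalIntegral.integral_of_le (sub_nonneg.2 hu.2),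
      ← integral_indicator measurableSet_Ioc]
    refine integral_congr_ae (.of_forall fun s => ?_)
    simp only [Set.indicator_apply]
    refine if_congr ?_ rfl rfl
    simp only [triangle, Set.mem_ofPred_eq, Set.mem_Ioc]
    have := hu.1
    constructor
    · rintro ⟨h1, h2, h3⟩; exact ⟨h1, by linarith⟩
    · rintro ⟨h1, h2⟩; exact ⟨h1, by linarith, by linarith⟩
  · rw [Set.indicator_of_notMem hu]
    refine integral_eq_zero_of_ae (.of_forall fun s => ?_)
    refine Set.indicator_of_notMem ?_ _
    rintro ⟨h1, h2, h3⟩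
    simp only at h1 h2 h3
    exact hu ⟨by linarith, by linarith⟩

/-- The integral over `[0, T - u]` of the increments of `b` of length `u`, written as a difference
of integrals near the endpoints. -/
def endIncrement (b : ℝ → E) (T u : ℝ) : E := (∫ s in (T - u)..T, b s) - ∫ s in (0 : ℝ)..u, b s

/-- The integrals of `b` over `[u, T]` and `[0, T - u]` differ only near the two ends. -/
lemma integral_increment_eq_endIncrement {b : ℝ → E} (hb : Continuous b) (T u : ℝ) :
    ∫ s in (0 : ℝ)..(T - u), (b (u + s) - b s) = endIncrement b T u := by
  have hi : ∀ x y, IntervalIntegrable b volume x y := fun x y => hb.intervalIntegrable x y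
  have hc : Continuous fun s => b (u + s) := by fun_prop
  rw [intervalIntegral.integral_sub (hc.intervalIntegrable _ _) (hi _ _), intervalIntegral.integral_comp_add_left (fun s => b s), add_zero, add_sub_cancel,
    intervalIntegral.integral_interval_sub_interval_comm (hi _ _) (hi _ _) (hi _ _),
    intervalIntegral.integral_symm, intervalIntegral.integral_symm (T - u) T, endIncrement]
  abel

lemma integral_triangle_smul_increment {T : ℝ} (hT : 0 ≤ T) {b : ℝ → E} (hb : Continuous b)
    {φ : ℝ → ℝ} (hφ : Continuous φ) :
    ∫ x in triangle T, φ (x.1 - x.2) • (b x.1 - b x.2) =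
      ∫ u in (0 : ℝ)..T, φ u • endIncrement b T u := by
  have hc : Continuous fun x : ℝ × ℝ => φ (x.1 - x.2) • (b x.1 - b x.2) := by fun_prop
  rw [integral_triangle_eq_integral_sub hT (hc.integrableOn_triangle T)]
  simp only [add_sub_cancel_right, intervalIntegral.integral_smul,
    integral_increment_eq_endIncrement hb]

lemma continuous_endIncrement {b : ℝ → E} (hb : Continuous b) (T : ℝ) :
    Continuous (endIncrement b T) := by
  have hi : ∀ x y, IntervalIntegrable b volume x y := fun x y => hb.intervalIntegrable x y
  have hP := intervalIntegral.continuous_primitive hi 0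
  have he : endIncrement b T =
      fun u => (∫ s in (0 : ℝ)..T, b s) - (∫ s in (0 : ℝ)..(T - u), b s) - ∫ s in (0 : ℝ)..u, b s := by
    ext u
    rw [endIncrement, intervalIntegral.integral_interval_sub_left (hi _ _) (hi _ _)]
  rw [he]
  exact (continuous_const.sub (hP.comp (continuous_const.sub continuous_id))).sub hP

variable {b : ℝ → E} {H T u : ℝ}

/-- Linear growth in `u`, uniform up to `T`; it provides the majorant for dominated convergence. -/
lemma norm_endIncrement_le (hb0 : b 0 = 0) (hbH : ∀ s t, ‖b t - b s‖ ≤ |t - s| ^ H) (hH : 0 < H)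
    (hu : 0 ≤ u) (huT : u ≤ T) : ‖endIncrement b T u‖ ≤ 2 * T ^ H * u := by
  have h0 : ∀ s, 0 ≤ s → s ≤ T → ‖b s‖ ≤ T ^ H := by
    intro s hs hsT
    have := hbH 0 s
    rw [hb0, sub_zero, sub_zero, abs_of_nonneg hs] at this
    exact this.trans (Real.rpow_le_rpow hs hsT hH.le)
  have h1 : ‖∫ s in (T - u)..T, b s‖ ≤ T ^ H * |T - (T - u)| := by
    refine intervalIntegral.norm_integral_le_of_norm_le_const fun s hs => ?_
    rw [Set.uIoc_of_le (by linarith)] at hs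
    exact h0 s (by linarith [hs.1]) hs.2
  have h2 : ‖∫ s in (0 : ℝ)..u, b s‖ ≤ T ^ H * |u - 0| := by
    refine intervalIntegral.norm_integral_le_of_norm_le_const fun s hs => ?_
    rw [Set.uIoc_of_le hu] at hs
    exact h0 s hs.1.le (hs.2.trans huT)
  rw [sub_sub_cancel, abs_of_nonneg hu] at h1
  rw [sub_zero, abs_of_nonneg hu] at h2
  refine (norm_sub_le _ _).trans ?_
  linarith

/-- By Hölder continuity `b` is close to `b T` on the last interval and to `b 0 = 0` on the first,
with error `u ^ H` on each. -/
lemma norm_endIncrement_sub_le [CompleteSpace E] (hb : Continuous b) (hb0 : b 0 = 0)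
    (hbH : ∀ s t, ‖b t - b s‖ ≤ |t - s| ^ H) (hH : 0 < H) (hu : 0 ≤ u) :
    ‖endIncrement b T u - u • b T‖ ≤ 2 * u ^ H * u := by
  have h1 : ‖∫ s in (T - u)..T, (b s - b T)‖ ≤ u ^ H * |T - (T - u)| := by
    refine intervalIntegral.norm_integral_le_of_norm_le_const fun s hs => ?_
    rw [Set.uIoc_of_le (by linarith)] at hs
    refine (hbH T s).trans (Real.rpow_le_rpow (abs_nonneg _) ?_ hH.le)
    rw [abs_le]
    constructor <;> linarith [hs.1, hs.2]
  have h2 : ‖∫ s in (0 : ℝ)..u, b s‖ ≤ u ^ H * |u - 0| := by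
    refine intervalIntegral.norm_integral_le_of_norm_le_const fun s hs => ?_
    rw [Set.uIoc_of_le hu] at hs
    have := hbH 0 s
    rw [hb0, sub_zero, sub_zero, abs_of_nonneg hs.1.le] at this
    exact this.trans (Real.rpow_le_rpow hs.1.le hs.2 hH.le)
  rw [intervalIntegral.integral_sub (hb.intervalIntegrable _ _)
    (intervalIntegrable_const), intervalIntegral.integral_const] at h1
  rw [sub_sub_cancel, abs_of_nonneg hu] at h1
  rw [sub_zero, abs_of_nonneg hu] at h2
  rw [endIncrement, sub_right_comm]
  refine (norm_sub_le _ _).trans ?_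
  linarith

/-- Substitution `u = δ x` with `δ = ε ^ (1 / (2H))`. All powers of `ε` combine to `δ⁻¹`, which the
linear growth of `endIncrement` compensates. -/
lemma smul_integral_endIncrement_eq (hH : 0 < H) (hT : 0 < T) {ε : ℝ} (hε : 0 < ε) :
    ε ^ (3 / 2 - 1 / H) •
        ∫ u in (0 : ℝ)..T, ((ε + |u| ^ (2 * H)) ^ (-(3 / 2) : ℝ)) • endIncrement b T u =
      ∫ x in Set.Ioi (0 : ℝ), (Set.Ioc 0 (T / ε ^ (1 / (2 * H)))).indicator (fun x =>
        ((ε ^ (1 / (2 * H)))⁻¹ * (1 + x ^ (2 * H)) ^ (-(3 / 2) : ℝ)) •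
          endIncrement b T (ε ^ (1 / (2 * H)) * x)) x := by
  set δ := ε ^ (1 / (2 * H)) with hδ
  have hδ0 : 0 < δ := Real.rpow_pos_of_pos hε _
  have hδH : δ ^ (2 * H) = ε := by
    rw [hδ, ← Real.rpow_mul hε.le, one_div_mul_cancel (by positivity), Real.rpow_one]
  have hδε : ε ^ (3 / 2 - 1 / H) * (δ * ε ^ (-(3 / 2) : ℝ)) = δ⁻¹ := by
    rw [hδ, ← Real.rpow_neg hε.le, ← Real.rpow_add hε, ← Real.rpow_add hε]
    congr 1
    field_simp
    ring
  have h := intervalIntegral.smul_integral_comp_mul_left (a := 0) (b := T / δ)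
    (fun u => ((ε + |u| ^ (2 * H)) ^ (-(3 / 2) : ℝ)) • endIncrement b T u) δ
  rw [mul_zero, mul_div_cancel₀ _ hδ0.ne'] at h
  rw [setIntegral_indicator measurableSet_Ioc, Set.inter_eq_right.2 Set.Ioc_subset_Ioi_self, ← h,
    smul_smul, intervalIntegral.integral_of_le (by positivity), ← integral_smul]
  refine setIntegral_congr_fun measurableSet_Ioc fun x hx => ?_
  have hx0 : 0 < x := hx.1
  rw [abs_of_pos (by positivity), Real.mul_rpow hδ0.le hx0.le, hδH,
    show ε + ε * x ^ (2 * H) = ε * (1 + x ^ (2 * H)) by ring,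
    Real.mul_rpow hε.le (by positivity), smul_smul, ← hδε]
  congr 1
  ring

/-- Dominated convergence on the half-line. The majorant behaves like `x ^ (1 - 3H)` at infinity,
integrable because `H > 2/3`. -/
lemma tendsto_smul_integral_endIncrement [CompleteSpace E] (hb : Continuous b) (hb0 : b 0 = 0)
    (hbH : ∀ s t, ‖b t - b s‖ ≤ |t - s| ^ H) (hH : 2 / 3 < H) (hT : 0 < T) :
    Tendsto (fun ε : ℝ => ε ^ (3 / 2 - 1 / H) •
        ∫ u in (0 : ℝ)..T, ((ε + |u| ^ (2 * H)) ^ (-(3 / 2) : ℝ)) • endIncrement b T u)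
      (𝓝[>] 0) (𝓝 ((∫ x in Set.Ioi (0 : ℝ), x * (1 + x ^ (2 * H)) ^ (-(3 / 2) : ℝ)) • b T)) := by
  have hH0 : 0 < H := by linarith
  have hδ : Tendsto (fun ε : ℝ => ε ^ (1 / (2 * H))) (𝓝[>] 0) (𝓝 0) :=
    tendsto_rpow_nhdsGT_zero (by positivity)
  have hint : IntegrableOn (fun x : ℝ => x * (1 + x ^ (2 * H)) ^ (-(3 / 2) : ℝ)) (Set.Ioi 0) := by
    obtain ⟨C, hC, h⟩ := exists_lintegral_rpow_mul_le (H := H) (p := 1) (k := 3 / 2) hH0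
      (by norm_num) (by norm_num) (by linarith)
    refine ⟨by fun_prop, ?_⟩
    rw [hasFiniteIntegral_iff_ofReal]
    · have := h 1 one_pos
      simp only [Real.rpow_one] at this
      exact this.trans_lt ENNReal.ofReal_lt_top
    · filter_upwards [ae_restrict_mem measurableSet_Ioi] with x hx
      have : 0 < x := hx
      simp only [Pi.zero_apply]
      positivity
  rw [← integral_smul_const]
  refine Tendsto.congr' (f₁ := fun ε : ℝ => ∫ x in Set.Ioi (0 : ℝ),
      (Set.Ioc 0 (T / ε ^ (1 / (2 * H)))).indicator (fun x =>
        ((ε ^ (1 / (2 * H)))⁻¹ * (1 + x ^ (2 * H)) ^ (-(3 / 2) : ℝ)) •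
          endIncrement b T (ε ^ (1 / (2 * H)) * x)) x) ?_ ?_
  · filter_upwards [self_mem_nhdsWithin] with ε hε
    exact (smul_integral_endIncrement_eq hH0 hT hε).symm
  refine tendsto_integral_filter_of_dominated_convergence
    (fun x => 2 * T ^ H * (x * (1 + x ^ (2 * H)) ^ (-(3 / 2) : ℝ))) ?_ ?_ (hint.const_mul _) ?_
  · refine .of_forall fun ε => ?_
    have hc := (continuous_endIncrement hb T).comp (continuous_const_mul (ε ^ (1 / (2 * H))))
    have hm : Measurable fun x : ℝ => (ε ^ (1 / (2 * H)))⁻¹ * (1 + x ^ (2 * H)) ^ (-(3 / 2) : ℝ) := by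
      fun_prop
    exact (hm.aestronglyMeasurable.smul hc.aestronglyMeasurable).indicator measurableSet_Ioc
  · filter_upwards [self_mem_nhdsWithin] with ε hε
    filter_upwards [ae_restrict_mem measurableSet_Ioi] with x hx
    have hε : 0 < ε := hε
    have hx0 : 0 < x := hx
    set δ := ε ^ (1 / (2 * H))
    have hδ0 : 0 < δ := Real.rpow_pos_of_pos hε _
    by_cases hxT : x ∈ Set.Ioc 0 (T / δ)
    · rw [Set.indicator_of_mem hxT, norm_smul, Real.norm_of_nonneg (by positivity)]
      have h1 : δ * x ≤ T := by
        have := hxT.2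
        rwa [le_div_iff₀' hδ0] at this
      calc _ ≤ δ⁻¹ * (1 + x ^ (2 * H)) ^ (-(3 / 2) : ℝ) * (2 * T ^ H * (δ * x)) := by
            gcongr
            exact norm_endIncrement_le hb0 hbH hH0 (by positivity) h1
        _ = _ := by field_simp
    · rw [Set.indicator_of_notMem hxT, norm_zero]
      positivity
  · filter_upwards [ae_restrict_mem measurableSet_Ioi] with x hx
    have hx0 : 0 < x := hx
    rw [tendsto_iff_norm_sub_tendsto_zero]
    have hδx : Tendsto (fun ε : ℝ => ε ^ (1 / (2 * H)) * x) (𝓝[>] 0) (𝓝 0) := by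
      simpa using hδ.mul_const x
    have hlim : Tendsto (fun ε : ℝ => (1 + x ^ (2 * H)) ^ (-(3 / 2) : ℝ) * (2 * x) *
        (ε ^ (1 / (2 * H)) * x) ^ H) (𝓝[>] 0) (𝓝 0) := by
      have := (hδx.rpow_const (p := H) (.inr hH0.le)).const_mul
        ((1 + x ^ (2 * H)) ^ (-(3 / 2) : ℝ) * (2 * x))
      simpa [Real.zero_rpow hH0.ne'] using this
    refine squeeze_zero' (.of_forall fun _ => norm_nonneg _) ?_ hlim
    filter_upwards [self_mem_nhdsWithin, hδx.eventually_le_const hT] with ε hε h1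
    have hε : 0 < ε := hε
    set δ := ε ^ (1 / (2 * H))
    have hδ0 : 0 < δ := Real.rpow_pos_of_pos hε _
    rw [Set.indicator_of_mem (show x ∈ Set.Ioc 0 (T / δ) from ⟨hx0, by rwa [le_div_iff₀' hδ0]⟩)]
    have he : (x * (1 + x ^ (2 * H)) ^ (-(3 / 2) : ℝ)) • b T =
        (δ⁻¹ * (1 + x ^ (2 * H)) ^ (-(3 / 2) : ℝ)) • ((δ * x) • b T) := by
      rw [smul_smul]
      congr 1
      field_simp
    rw [he, ← smul_sub, norm_smul, Real.norm_of_nonneg (by positivity)]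
    calc _ ≤ δ⁻¹ * (1 + x ^ (2 * H)) ^ (-(3 / 2) : ℝ) * (2 * (δ * x) ^ H * (δ * x)) := by
          gcongr
          exact norm_endIncrement_sub_le hb hb0 hbH hH0 (by positivity)
      _ = _ := by field_simp

end endIncrement

variable {Ω : Type*} [MeasurableSpace Ω] {P : Measure Ω} [IsProbabilityMeasure P]
  {H : ℝ} {B : ℝ≥0 → Ω → ℝ}

lemma IsFractionalBrownianMotion.chaosProj_one_alphaLp (hB : IsFractionalBrownianMotion H B P)
    (hH : 0 < H) {T ε : ℝ} (hT : 0 ≤ T) (hε : 0 < ε) :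
    chaosProj B P 1 (hB.alphaLp T ε) = (-(√(2 * Real.pi))⁻¹) •
      ∫ u in (0 : ℝ)..T, ((ε + |u| ^ (2 * H)) ^ (-(3 / 2) : ℝ)) •
        endIncrement (fun s => hB.toL2 s.toNNReal) T u := by
  -- The absolute value only serves to make the weight continuous on the whole line; on the triangle
  -- `u` is positive.
  have hφ : Continuous fun u : ℝ => (ε + |u| ^ (2 * H)) ^ (-(3 / 2) : ℝ) :=
    ((continuous_const.add (continuous_abs.rpow_const fun _ => .inr (by positivity)))).rpow_const
      fun u => .inl (add_pos_of_pos_of_nonneg hε (by positivity)).ne'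
  rw [← integral_triangle_smul_increment (b := fun s => hB.toL2 s.toNNReal) hT
    ((hB.continuous_toL2 hH).comp continuous_real_toNNReal) hφ, hB.chaosProj_alphaLp hH,
    ← integral_smul]
  refine setIntegral_congr_fun (measurableSet_triangle T) fun x hx => ?_
  rw [hB.chaosProj_one_kernelLp hε (hB.incr_mem x), hB.norm_incr_sq hH hx, smul_smul,
    abs_of_pos (sub_pos.2 hx.2.1)]
  rfl

lemma IsFractionalBrownianMotion.tendsto_smul_chaosProj_one_alphaLp
    (hB : IsFractionalBrownianMotion H B P) (hH : 2 / 3 < H) {T : ℝ} (hT : 0 < T) :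
    Tendsto (fun ε : ℝ => ε ^ (3 / 2 - 1 / H) • chaosProj B P 1 (hB.alphaLp T ε)) (𝓝[>] 0)
      (𝓝 ((-(√(2 * Real.pi))⁻¹ * (beta (1 / H) ((3 * H - 2) / (2 * H)) / (2 * H))) •
        hB.toL2 T.toNNReal)) := by
  have hH0 : 0 < H := by linarith
  have hC : ∫ x in Set.Ioi (0 : ℝ), x * (1 + x ^ (2 * H)) ^ (-(3 / 2) : ℝ) =
      beta (1 / H) ((3 * H - 2) / (2 * H)) / (2 * H) := by
    have := integral_rpow_mul_one_add_rpow_neg (p := 2 * H) (q := 1) (k := 3 / 2) (by positivity)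
      (by norm_num) (by rw [div_lt_iff₀ (by positivity)]; linarith)
    simp only [Real.rpow_one] at this
    rw [this]
    congr 2 <;> (field_simp; ring)
  have h := tendsto_smul_integral_endIncrement (b := fun s : ℝ => hB.toL2 s.toNNReal) (H := H)
    (T := T) ((hB.continuous_toL2 hH0).comp continuous_real_toNNReal)
    (by simp only [Real.toNNReal_zero]; exact hB.toL2_zero hH0)
    -- Negative times are sent to `0` by a 1-Lipschitz map, so the Hölder bound holds on the whole
    -- line.
    (fun s t => by
      rw [hB.norm_toL2_sub' hH0, Real.coe_toNNReal', Real.coe_toNNReal']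
      exact Real.rpow_le_rpow (abs_nonneg _) (abs_max_sub_max_le_abs _ _ _) hH0.le) hH hT
  rw [hC] at h
  rw [mul_smul]
  refine (h.const_smul (-(√(2 * Real.pi))⁻¹)).congr' ?_
  filter_upwards [self_mem_nhdsWithin] with ε hε
  rw [hB.chaosProj_one_alphaLp hH0 hT.le hε, smul_comm]

/-- `B(2, 2H - 1) = 1 / (2H (2H - 1))`, so the stated variance is the squared coefficient of `B_T`
times `T ^ (2H)`. -/
lemma limitVariance_eq {H T : ℝ} (hH : 1 / 2 < H) :
    limitVariance H T = T ^ (2 * H) *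
      (-(√(2 * Real.pi))⁻¹ * (beta (1 / H) ((3 * H - 2) / (2 * H)) / (2 * H))) ^ 2 := by
  have hH0 : 0 < H := by linarith
  have h1 : 0 < 2 * H - 1 := by linarith
  have hb : beta 2 (2 * H - 1) = (2 * H * (2 * H - 1))⁻¹ := by
    have hΓ := (Real.Gamma_pos_of_pos h1).ne'
    have e1 : Real.Gamma (2 + (2 * H - 1)) = 2 * H * ((2 * H - 1) * Real.Gamma (2 * H - 1)) := by
      rw [show 2 + (2 * H - 1) = 2 * H + 1 by ring, Real.Gamma_add_one (by positivity)]
      congr 1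
      rw [← Real.Gamma_add_one h1.ne', sub_add_cancel]
    rw [beta, e1, Real.Gamma_two]
    field_simp
  rw [limitVariance, hb, mul_pow, neg_sq, inv_pow, Real.sq_sqrt (by positivity)]
  field_simp
  ring

end

/-! ### From convergence in `L²` to convergence in law -/

section

variable {Ω : Type*} [MeasurableSpace Ω] {P : Measure Ω} [IsProbabilityMeasure P]
  {H : ℝ} {B : ℝ≥0 → Ω → ℝ}

/-- Convergence in `L²` implies convergence in measure, hence in law. Representatives need to agree
only eventually, since `α_ε` is identified with its class for `ε > 0` alone. -/
lemma tendstoInDistribution_of_tendsto_Lp {ι : Type*} {l : Filter ι} [l.IsCountablyGenerated]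
    {F : ι → Lp ℝ 2 P} {G : Lp ℝ 2 P} (h : Tendsto F l (𝓝 G)) {X : ι → Ω → ℝ}
    (hX : ∀ i, AEMeasurable (X i) P) (hFX : ∀ᶠ i in l, X i =ᵐ[P] F i) {μ : Measure ℝ}
    [IsProbabilityMeasure μ] (hG : P.map G = μ) :
    TendstoInDistribution X l (id : ℝ → ℝ) (fun _ => P) μ := by
  have hm : TendstoInMeasure P X l G := by
    refine tendstoInMeasure_of_tendsto_eLpNorm (p := 2) two_ne_zero
      (fun i => (hX i).aestronglyMeasurable) (Lp.aestronglyMeasurable G) ?_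
    refine (Lp.tendsto_Lp_iff_tendsto_eLpNorm' F G |>.1 h).congr' ?_
    filter_upwards [hFX] with i hi
    exact eLpNorm_congr_ae (hi.symm.sub .rfl)
  have hd := hm.tendstoInDistribution_of_aemeasurable hX (Lp.aestronglyMeasurable G).aemeasurable
  refine ⟨hX, aemeasurable_id, ?_⟩
  exact hd.tendsto.trans (le_of_eq (congrArg 𝓝 (Subtype.ext (hG.trans Measure.map_id.symm))))

lemma IsFractionalBrownianMotion.map_smul_toL2 (hB : IsFractionalBrownianMotion H B P)
    (hH : 1 / 2 < H) {T : ℝ} (hT : 0 < T) :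
    P.map ((-(√(2 * Real.pi))⁻¹ * (beta (1 / H) ((3 * H - 2) / (2 * H)) / (2 * H))) •
      hB.toL2 T.toNNReal : Lp ℝ 2 P) = gaussianReal 0 (limitVariance H T).toNNReal := by
  have hn := hB.norm_toL2_sub (by linarith) 0 T.toNNReal
  rw [hB.toL2_zero (by linarith), sub_zero, Real.coe_toNNReal _ hT.le, NNReal.coe_zero, sub_zero,
    abs_of_pos hT] at hn
  rw [hB.map_eq_gaussianReal (Submodule.smul_mem _ _ (hB.toL2_mem _)), limitVariance_eq hH]
  congr 1
  refine NNReal.coe_injective ?_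
  rw [Real.coe_toNNReal _ (by positivity), NNReal.coe_pow, coe_nnnorm, norm_smul, mul_pow, hn,
    Real.norm_eq_abs, sq_abs, mul_comm]

end

end SelfIntersection

end

theorem mainTheorem1 {Ω : Type*} [MeasurableSpace Ω] (P : Measure Ω) [IsProbabilityMeasure P]
    (H T : ℝ) (hH : 2 / 3 < H) (hH' : H < 1) (hT : 0 < T)
    (B : ℝ≥0 → Ω → ℝ) (hB : SelfIntersection.IsFractionalBrownianMotion H B P) :
    -- the central limit theorem
    TendstoInDistribution
      (fun (ε : ℝ) (ω : Ω) => ε ^ (3 / 2 - 1 / H) * SelfIntersection.alpha B T ε ω)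
      (𝓝[>] 0) (id : ℝ → ℝ) (fun _ => P)
      (gaussianReal 0 (SelfIntersection.limitVariance H T).toNNReal) ∧
    -- the variables are in `L²`, and there, with `A ε` the class of `α_ε`:
    ∃ A : ℝ → Lp ℝ 2 P,
      (∀ ε, 0 < ε → A ε =ᵐ[P] SelfIntersection.alpha B T ε) ∧
      -- the first chaos component is centered Gaussian,
      (∀ ε, 0 < ε → ∃ v : ℝ≥0,
        HasLaw (SelfIntersection.chaosProj B P 1 (A ε)) (gaussianReal 0 v) P) ∧
      -- it has the same limit in law after renormalization,
      TendstoInDistribution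
        (fun (ε : ℝ) (ω : Ω) =>
          ε ^ (3 / 2 - 1 / H) * SelfIntersection.chaosProj B P 1 (A ε) ω)
        (𝓝[>] 0) (id : ℝ → ℝ) (fun _ => P)
        (gaussianReal 0 (SelfIntersection.limitVariance H T).toNNReal) ∧
      -- the rest is the sum of the components in the chaoses of order at least two,
      (∀ ε, 0 < ε → HasSum (fun q : ℕ => SelfIntersection.chaosProj B P (q + 2) (A ε))
        (A ε - SelfIntersection.chaosProj B P 1 (A ε))) ∧
      -- and vanishes in `L²` after renormalization
      Tendsto
        (fun ε : ℝ =>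
          ‖ε ^ (3 / 2 - 1 / H) • (A ε - SelfIntersection.chaosProj B P 1 (A ε))‖)
        (𝓝[>] 0) (𝓝 0) := by
  have hH0 : 0 < H := by linarith
  have h1 := hB.tendsto_smul_chaosProj_one_alphaLp hH hT
  have h2 := hB.tendsto_norm_smul_alphaLp_sub_chaosProj hH hH' T
  have hlaw := hB.map_smul_toL2 (by linarith) hT
  refine ⟨?_, hB.alphaLp T, fun ε hε => hB.coeFn_alphaLp hH0 hT.le hε,
    fun ε _ => ⟨_, hB.hasLaw_chaosProj_one _⟩, ?_,
    fun ε hε => hB.hasSum_chaosProj_alphaLp hH0 T hε, h2⟩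
  · have h3 := h1.add (tendsto_zero_iff_norm_tendsto_zero.2 h2)
    simp only [← smul_add, add_sub_cancel, add_zero] at h3
    refine SelfIntersection.tendstoInDistribution_of_tendsto_Lp h3
      (fun ε => (hB.aemeasurable_alpha hH0 hT.le ε).const_mul _) ?_ hlaw
    filter_upwards [self_mem_nhdsWithin] with ε hε
    filter_upwards [hB.coeFn_alphaLp hH0 hT.le hε,
      Lp.coeFn_smul (ε ^ (3 / 2 - 1 / H)) (hB.alphaLp T ε)] with ω hω hω'
    rw [hω', Pi.smul_apply, hω, smul_eq_mul]
  · refine SelfIntersection.tendstoInDistribution_of_tendsto_Lp h1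
      (fun ε => (Lp.aestronglyMeasurable _).aemeasurable.const_mul _) (.of_forall fun ε => ?_) hlaw
    filter_upwards [Lp.coeFn_smul (ε ^ (3 / 2 - 1 / H))
      (SelfIntersection.chaosProj B P 1 (hB.alphaLp T ε))] with ω hω
    rw [hω, Pi.smul_apply, smul_eq_mul]
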